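/- Let $n\ge 0$ be an integer, let $k$ be a field in which $n!$ is invertible, and let $\delta\in k^\times$. Let $S$ be the monoid of $(n,n)$-Brauer diagrams, i.e. of equivalence relations on $n$ northern nodes $1,\dots,n$ and $n$ southern nodes $\bar 1,\dots,\bar n$ all of whose classes have exactly two elements; the product $t\circ t'$ is obtained by concatenating $t$ above $t'$ and deleting the cycles. If $m(t,t')$ denotes the number of these cycles, then $\alpha(t,t'):=\delta^{m(t,t')}$ is a 2-cocycle of $S$, and the Brauer algebra is the twisted monoid algebra $A=k_\alpha S$, with $k$-basis $S$ and multiplication $t\cdot t'=\alpha(t,t')\,t\circ t'$. Put $d=\lfloor n/2\rfloor$, and for $1\le i\le d+1$ put $n_i=n-2(d-i+1)$. Let $e_i\in S$ be the idempotent diagram with edges $\{p,\bar p\}$ for $p\le n_i$ and $\{n_i+2q-1,n_i+2q\}$, $\{\overline{n_i+2q-1},\overline{n_i+2q}\}$ for $1\le q\le d-i+1$. Let $\Gamma_{e_i}$ be the group of units of the monoid $e_i\circ S\circ e_i$; it is identified with the symmetric group $\mathfrak S_{n_i}$ via $\sigma\mapsto t_\sigma$, where $t_\sigma$ has the same arcs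 as $e_i$ and propagating lines $\{\sigma(p),\bar p\}$, $p\le n_i$. For $s,t\in S$ write $\mathscr J(s)\le\mathscr J(t)$ if $S\circ s\circ S\subseteq S\circ t\circ S$, where $\mathscr J(s)=\{t: S\circ t\circ S=S\circ s\circ S\}$, and put $S_i=\mathscr J(e_i)$, $J_i=\bigoplus_{l\le i}kS_l\subseteq A$ and $J_0=0$. For each $i$ let $T_{(i,1)},\dots,T_{(i,l_i)}$ be representatives of the isomorphism classes of simple $k_\alpha\Gamma_{e_i}$-modules, let $f_{(i,r)}\in k_\alpha\Gamma_{e_i}\subseteq A$ be the primitive central idempotent of $k_\alpha\Gamma_{e_i}$ with $f_{(i,r)}T_{(i,r)}\neq 0$, and regard $T_{(i,r)}$ also as a $k\mathfrak S_{n_i}$-module on which $\sigma$ acts as $\delta^{-(d-i+1)}t_\sigma$. Let $\Lambda=\{(i,r): 1\le i\le d+1,\ 1\le r\le l_i\}$. For $(i,r),(j,s)\in\Lambda$ define: * $(i,r)<(j,s)$ if $S_j<_{\mathscr J}S_i$; * $(i,r)\sqsubset(j,s)$ if $S_j<_{\mathscr J}S_i$ and ($f_{(i,r)}J_jf_{(j,s)}\not\subseteq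 J_{j-1}$ or $f_{(j,s)}J_jf_{(i,r)}\not\subseteq J_{j-1}$); * $\unlhd$ is the transitive closure of the relation "$=$ or $\sqsubset$", and $(i,r)\lhd(j,s)$ means $(i,r)\unlhd(j,s)$ and $(i,r)\ne(j,s)$. Then, for all $(i,r),(j,s)\in\Lambda$: (a) $(i,r)<(j,s)$ if and only if $j<i$. (b) For all $x\in\Gamma_{e_i}$, $t\in e_i\circ S$ and $u\in S\circ e_i$ one has $\alpha(x,t)=\delta^{d-i+1}=\alpha(u,x)$. If $j<i$, then $S_j\cap e_i\circ S\circ e_j$ is a transitive $\mathfrak S_{n_i}\times\mathfrak S_{n_j}$-set via $(\sigma,\tau)\cdot t=t_\sigma\circ t\circ t_\tau^{-1}$ (inverse in $\Gamma_{e_j}$), and it contains $e_j$. (c) $(i,r)\lhd(j,s)$ if and only if $j<i$ and $T_{(i,r)}$ is isomorphic to a direct summand of $$\mathrm{Ind}_{\mathfrak S_{n_j}\times\mathfrak S_2\times\cdots\times\mathfrak S_2}^{\mathfrak S_{n_i}}\bigl(T_{(j,s)}\otimes k\otimes\cdots\otimes k\bigr),$$ where there are $i-j$ factors $\mathfrak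 S_2$ acting trivially on the factors $k$, and $\mathfrak S_{n_j}\times\mathfrak S_2\times\cdots\times\mathfrak S_2$ is the standard Young subgroup $\mathfrak S_{n_j}\times\langle(n_j+1,n_j+2)\rangle\times\cdots\times\langle(n_i-1,n_i)\rangle$ of $\mathfrak S_{n_i}$. -/

import Mathlib

universe u

namespace SetoidAux

open Setoid

variable {X Y P Q : Type*}

theorem map_le_iff_le_comap {f : X → Y} {r : Setoid X} {s : Setoid Y} :
    r.map f ≤ s ↔ r ≤ s.comap f := by
  constructor
  · intro h x y hxy
    exact h (Relation.EqvGen.rel _ _ ⟨x, y, hxy, rfl, rfl⟩)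
  · intro h
    refine Setoid.eqvGen_le ?_
    rintro _ _ ⟨x, y, hxy, rfl, rfl⟩
    exact h hxy

theorem map_sup (f : X → Y) (r s : Setoid X) : (r ⊔ s).map f = r.map f ⊔ s.map f := by
  refine eq_of_forall_ge_iff fun t => ?_
  rw [map_le_iff_le_comap, sup_le_iff, sup_le_iff, map_le_iff_le_comap, map_le_iff_le_comap]

theorem map_map (f : X → Y) (g : Y → P) (r : Setoid X) : (r.map f).map g = r.map (g ∘ f) := by
  refine eq_of_forall_ge_iff fun t => ?_
  simp only [map_le_iff_le_comap, comap_comp]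

theorem map_rel_iff {f : X → Y} (hf : f.Injective) (r : Setoid X) (x y : Y) :
    r.map f x y ↔ (∃ a b, r a b ∧ f a = x ∧ f b = y) ∨ x = y := by
  rw [coe_map_of_ker_le r f (by rw [ker_eq_bot_iff.2 hf]; exact bot_le)]
  rfl

/-- Contraction of a join along an injection. -/
theorem comap_sup_map {g : Y → X} (V : Setoid X) (R : Setoid Y) :
    (V ⊔ R.map g).comap g = V.comap g ⊔ R := by
  apply le_antisymm
  · set K := V.comap g ⊔ R with hK
    have hVK : ∀ a b, V (g a) (g b) → K a b := fun a b h =>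
      (le_sup_left : V.comap g ≤ K) h
    let T : Setoid X :=
      { r := fun x y => V x y ∨ ∃ a b, V x (g a) ∧ K a b ∧ V (g b) y
        iseqv :=
          { refl := fun x => Or.inl (V.refl' x)
            symm := by
              rintro x y (h | ⟨a, b, h1, h2, h3⟩)
              · exact Or.inl (V.symm' h)
              · exact Or.inr ⟨b, a, V.symm' h3, K.symm' h2, V.symm' h1⟩
            trans := by
              rintro x y z (h | ⟨a, b, h1, h2, h3⟩) (h' | ⟨c, d, h1', h2', h3'⟩)
              · exact Or.inl (V.trans' h h')
              · exact Or.inr ⟨c, d, V.trans' h h1', h2', h3'⟩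
              · exact Or.inr ⟨a, b, h1, h2, V.trans' h3 h'⟩
              · exact Or.inr ⟨a, d, h1, K.trans' h2 (K.trans' (hVK _ _ (V.trans' h3 h1')) h2'),
                  h3'⟩ } }
    have hT : V ⊔ R.map g ≤ T := by
      refine sup_le (fun x y h => Or.inl h) (map_le_iff_le_comap.2 fun a b h => ?_)
      exact Or.inr ⟨a, b, V.refl' _, (le_sup_right : R ≤ K) h, V.refl' _⟩
    intro a b hab
    rcases hT hab with h | ⟨c, d, h1, h2, h3⟩
    · exact hVK _ _ h
    · exact K.trans' (hVK _ _ h1) (K.trans' h2 (hVK _ _ h3))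
  · refine sup_le (fun a b h => (le_sup_left : V ≤ V ⊔ R.map g) h) ?_
    exact map_le_iff_le_comap.1 le_sup_right

/-- Base change for setoids along a cartesian square of injections. -/
theorem comap_map_of_pullback {i : P → X} {g : Y → X} {g0 : Q → P} {i0 : Q → Y}
    (hi : i.Injective) (hg : g.Injective) (hi0 : i0.Injective)
    (hc : ∀ q, g (i0 q) = i (g0 q)) (hp : ∀ p y, i p = g y → ∃ q, g0 q = p ∧ i0 q = y)
    (W : Setoid P) : (W.map i).comap g = (W.comap g0).map i0 := by
  apply le_antisymm
  · intro a b hab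
    rw [comap_rel, map_rel_iff hi] at hab
    rw [map_rel_iff hi0]
    rcases hab with ⟨p, p', h, h1, h2⟩ | h
    · obtain ⟨q, rfl, rfl⟩ := hp _ _ h1
      obtain ⟨q', rfl, rfl⟩ := hp _ _ h2
      exact Or.inl ⟨q, q', h, rfl, rfl⟩
    · exact Or.inr (hg h)
  · refine map_le_iff_le_comap.2 fun a b h => ?_
    rw [comap_rel, comap_rel, hc, hc]
    exact le_comap_map h

/-- Counting the classes of a join, according to whether they meet the range of `g`. -/
theorem ncard_classes_sup [Finite X] {i : P → X} {g : Y → X} (hi : i.Injective)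
    (W : Setoid P) (R : Setoid Y) (M₁ M₂ : Set X)
    (h₁ : ∀ x, x ∈ M₁ ↔ x ∉ Set.range g) (h₁i : M₁ ⊆ Set.range i) :
    {c ∈ (W.map i ⊔ R.map g).classes | c ⊆ M₁ ∪ M₂}.ncard =
      {c ∈ ((W.map i ⊔ R.map g).comap g).classes | c ⊆ g ⁻¹' M₂}.ncard +
      {c ∈ W.classes | c ⊆ i ⁻¹' M₁}.ncard := by
  set Z := W.map i ⊔ R.map g with hZ
  have hWZ : ∀ {p q}, W p q → Z (i p) (i q) := fun h =>
    (le_sup_left : W.map i ≤ Z) (le_comap_map h)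
  have hsplit : {c ∈ Z.classes | c ⊆ M₁ ∪ M₂} =
      {c ∈ Z.classes | c ⊆ M₁ ∪ M₂ ∧ ¬ c ⊆ M₁} ∪ {c ∈ Z.classes | c ⊆ M₁} := by
    ext c
    simp only [Set.mem_union, Set.mem_ofPred_eq]
    constructor
    · rintro ⟨h, h'⟩
      by_cases hc : c ⊆ M₁
      · exact Or.inr ⟨h, hc⟩
      · exact Or.inl ⟨h, h', hc⟩
    · rintro (⟨h, h', -⟩ | ⟨h, h'⟩)
      · exact ⟨h, h'⟩
      · exact ⟨h, h'.trans Set.subset_union_left⟩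
  have hdisj : Disjoint {c ∈ Z.classes | c ⊆ M₁ ∪ M₂ ∧ ¬ c ⊆ M₁} {c ∈ Z.classes | c ⊆ M₁} := by
    rw [Set.disjoint_left]
    rintro c ⟨-, -, h⟩ ⟨-, h'⟩
    exact h h'
  rw [hsplit, Set.ncard_union_eq hdisj (Set.toFinite _) (Set.toFinite _)]
  congr 1
  · have hmeet : ∀ c, ¬ c ⊆ M₁ → ∃ y, g y ∈ c := by
      intro c hc
      obtain ⟨x, hx, hx'⟩ := Set.not_subset.1 hc
      rw [h₁, not_not] at hx'
      obtain ⟨y, rfl⟩ := hx'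
      exact ⟨y, hx⟩
    rw [← Set.InjOn.ncard_image (f := fun c => g ⁻¹' c)
      (s := {c ∈ Z.classes | c ⊆ M₁ ∪ M₂ ∧ ¬ c ⊆ M₁})]
    · congr 1
      ext d
      constructor
      · rintro ⟨c, ⟨hc, hcM, hcn⟩, rfl⟩
        obtain ⟨y, hy⟩ := hmeet c hcn
        refine ⟨⟨y, ?_⟩, fun z hz => ?_⟩
        · obtain ⟨x, rfl⟩ := hc
          ext z
          exact ⟨fun h => Z.trans' h (Z.symm' hy), fun h => Z.trans' h hy⟩
        · rcases hcM hz with h | h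
          · exact absurd ⟨z, rfl⟩ ((h₁ _).1 h)
          · exact h
      · rintro ⟨⟨y, rfl⟩, hd⟩
        refine ⟨{x | Z x (g y)}, ⟨⟨g y, rfl⟩, fun x hx => ?_, fun h => ?_⟩, rfl⟩
        · by_cases hxM : x ∈ M₁
          · exact Or.inl hxM
          · rw [h₁, not_not] at hxM
            obtain ⟨z, rfl⟩ := hxM
            exact Or.inr (hd hx)
        · exact (h₁ _).1 (h (Z.refl' (g y))) ⟨y, rfl⟩
    · rintro c ⟨hc, -, hcn⟩ c' ⟨hc', -, -⟩ h
      obtain ⟨y, hy⟩ := hmeet c hcn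
      have hy' : y ∈ g ⁻¹' c' := by
        rw [← show g ⁻¹' c = g ⁻¹' c' from h]; exact hy
      exact eq_of_mem_classes hc hy hc' hy'
  · rw [← Set.ncard_image_of_injective (f := fun d => i '' d) _ (Set.image_injective.2 hi)]
    congr 1
    have key : ∀ d ∈ W.classes, d ⊆ i ⁻¹' M₁ → ∀ x ∈ i '' d, {z | Z z x} = i '' d := by
      intro d hd hdM
      have hle : Z ≤ ker (fun x => x ∈ i '' d) := by
        refine sup_le (map_le_iff_le_comap.2 fun p q h => ?_)
          (map_le_iff_le_comap.2 fun a b h => ?_)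
        · change (i p ∈ i '' d) = (i q ∈ i '' d)
          rw [hi.mem_set_image, hi.mem_set_image]
          obtain ⟨y, rfl⟩ := hd
          exact propext ⟨fun h' => W.trans' (W.symm' h) h', fun h' => W.trans' h h'⟩
        · change (g a ∈ i '' d) = (g b ∈ i '' d)
          have : ∀ y, g y ∉ i '' d := by
            rintro y ⟨p, hp, hpy⟩
            exact (h₁ _).1 (hdM hp) ⟨y, hpy.symm⟩
          simp [this]
      rintro _ ⟨p, hp, rfl⟩
      ext z
      constructor
      · intro hz
        have := hle hz
        change (z ∈ i '' d) = (i p ∈ i '' d) at this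
        rw [this]
        exact ⟨p, hp, rfl⟩
      · rintro ⟨q, hq, rfl⟩
        obtain ⟨y, rfl⟩ := hd
        exact hWZ (W.trans' hq (W.symm' hp))
    ext c
    constructor
    · rintro ⟨⟨x, rfl⟩, hc⟩
      obtain ⟨p, rfl⟩ := h₁i (hc (Z.refl' x))
      have hd : {q | W q p} ⊆ i ⁻¹' M₁ := fun q hq => hc (hWZ hq)
      refine ⟨{q | W q p}, ⟨⟨p, rfl⟩, hd⟩, ?_⟩
      exact (key _ ⟨p, rfl⟩ hd (i p) ⟨p, W.refl' p, rfl⟩).symm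
    · rintro ⟨d, ⟨⟨p, rfl⟩, hd⟩, rfl⟩
      refine ⟨⟨i p, ?_⟩, ?_⟩
      · exact (key _ ⟨p, rfl⟩ hd (i p) ⟨p, W.refl' p, rfl⟩).symm
      · rintro _ ⟨q, hq, rfl⟩
        exact hd hq

end SetoidAux


namespace TwistedBrauer

open Equiv in
theorem dihedral_aux {X : Type*} [Finite X] (p q : Perm X) (hp : p * p = 1) (hq : q * q = 1)
    (hne : ∀ y, ¬ (p y = y ∧ q y = y)) (x : X) (hx : q x = x) :
    ∃! y, y ≠ x ∧ (p y = y ∨ q y = y) ∧ (p * q).SameCycle x y := by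
  set c := p * q with hc
  have hp' : p⁻¹ = p := inv_eq_of_mul_eq_one_left hp
  have hq' : q⁻¹ = q := inv_eq_of_mul_eq_one_left hq
  have hqc : ∀ k : ℤ, q * c ^ k * q⁻¹ = c ^ (-k) := by
    intro k
    rw [← conj_zpow, zpow_neg, ← inv_zpow]
    congr 1
    rw [hc, mul_inv_rev, hp', hq', mul_assoc, mul_assoc, hq, mul_one]
  have hqk : ∀ k : ℤ, q ((c ^ k) x) = (c ^ (-k)) x := by
    intro k
    rw [← hqc, hq', Perm.mul_apply, Perm.mul_apply, hx]
  have hpk : ∀ k : ℤ, p ((c ^ k) x) = (c ^ (1 - k)) x := by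
    intro k
    have : p = c * q := by rw [hc, mul_assoc, hq, mul_one]
    rw [this, Perm.mul_apply, hqk, sub_eq_add_neg, zpow_add, zpow_one, Perm.mul_apply]
    rfl
  set l : ℤ := (Function.minimalPeriod (c • ·) x : ℤ) with hl
  have hdvd : ∀ k : ℤ, (c ^ k) x = x ↔ l ∣ k := fun k =>
    MulAction.zpow_smul_eq_iff_minimalPeriod_dvd (a := c) (b := x) (n := k)
  have heq : ∀ k k' : ℤ, (c ^ k) x = (c ^ k') x ↔ l ∣ k - k' := by
    intro k k'
    rw [← hdvd, sub_eq_neg_add, zpow_add, Perm.mul_apply, zpow_neg, Perm.inv_eq_iff_eq]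
  have hl0 : 0 < l := by
    rw [hl]
    have : 0 < Function.minimalPeriod (c • ·) x :=
      Function.minimalPeriod_pos_of_mem_periodicPts
        ((MulAction.injective c).mem_periodicPts x)
    exact_mod_cast this
  have hpfix : ∀ k : ℤ, p ((c ^ k) x) = (c ^ k) x ↔ l ∣ 2 * k - 1 := by
    intro k
    rw [hpk, heq, ← dvd_neg]
    ring_nf
  have hqfix : ∀ k : ℤ, q ((c ^ k) x) = (c ^ k) x ↔ l ∣ 2 * k := by
    intro k
    rw [hqk, heq, ← dvd_neg]
    ring_nf
  have hex : ∃ k : ℤ, ¬ l ∣ k ∧ (l ∣ 2 * k - 1 ∨ l ∣ 2 * k) := by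
    obtain ⟨m, hm | hm⟩ := Int.even_or_odd' l
    · refine ⟨m, fun h => ?_, Or.inr (by rw [hm])⟩
      have := Int.le_of_dvd (by omega) h
      omega
    · refine ⟨m + 1, fun h => ?_, Or.inl ⟨1, by rw [hm]; ring⟩⟩
      have h1 : (c ^ (m + 1)) x = x := (hdvd _).2 h
      have h2 := (hpfix (m + 1)).2 ⟨1, by rw [hm]; ring⟩
      rw [h1] at h2
      exact hne x ⟨h2, hx⟩
  obtain ⟨k, hk, hk'⟩ := hex
  refine ⟨(c ^ k) x, ⟨fun h => hk ((hdvd k).1 h), ?_, k, rfl⟩, ?_⟩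
  · rcases hk' with h | h
    · exact Or.inl ((hpfix k).2 h)
    · exact Or.inr ((hqfix k).2 h)
  · rintro _ ⟨hj, hj', ⟨j, rfl⟩⟩
    rw [Ne, hdvd] at hj
    rw [hpfix, hqfix] at hj'
    rw [heq]
    have hodd : ∀ a b : ℤ, l ∣ 2 * a - 1 → l ∣ 2 * b → l ∣ b := by
      intro a b ha hb
      have : IsCoprime l 2 := by
        obtain ⟨u, hu⟩ := ha
        exact ⟨-u, a, by linarith [mul_comm u l]⟩
      exact this.dvd_of_dvd_mul_left hb
    rcases hk' with h | h <;> rcases hj' with h' | h'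
    · refine hodd k _ h ?_
      have := dvd_sub h' h
      ring_nf at this ⊢
      exact this
    · exact absurd (hodd _ _ h h') hj
    · exact absurd (hodd _ _ h' h) hk
    · obtain ⟨m, hm | hm⟩ := Int.even_or_odd' l
      · rw [hm] at h h' hj hk ⊢
        obtain ⟨u, hu⟩ := (mul_dvd_mul_iff_left (two_ne_zero)).1 h
        obtain ⟨v, hv⟩ := (mul_dvd_mul_iff_left (two_ne_zero)).1 h'
        have hodd' : ∀ w a : ℤ, a = m * w → ¬ 2 * m ∣ a → Odd w := by
          intro w a ha hna
          rw [← Int.not_even_iff_odd]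
          rintro ⟨z, hz⟩
          exact hna ⟨z, by rw [ha, hz]; ring⟩
        obtain ⟨z, hz⟩ := (hodd' v j hv hj).sub_odd (hodd' u k hu hk)
        refine ⟨z, ?_⟩
        rw [hu, hv, ← mul_sub, hz]; ring
      · have h3 : IsCoprime l 2 := ⟨1, -m, by rw [hm]; ring⟩
        exact absurd (h3.dvd_of_dvd_mul_left h) hk

theorem exists_perm_of_setoid {X : Type*} (r : Setoid X)
    (h : ∀ x, ∃ y, ∀ z, r x z ↔ z = x ∨ z = y) :
    ∃ p : Equiv.Perm X, p * p = 1 ∧ ∀ x z, r x z ↔ z = x ∨ z = p x := by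
  choose f hf using h
  have hinv : Function.Involutive f := by
    intro x
    have h1 : r x (f x) := (hf x _).2 (Or.inr rfl)
    rcases (hf (f x) x).1 (r.symm' h1) with h2 | h2
    · rw [← h2, ← h2]
    · exact h2.symm
  exact ⟨hinv.toPerm, Equiv.ext hinv, hf⟩

theorem sameCycle_aux {X : Type*} (p q : Equiv.Perm X) (hp : p * p = 1) (hq : q * q = 1)
    (r s : Setoid X) (hr : ∀ x z, r x z ↔ z = x ∨ z = p x)
    (hs : ∀ x z, s x z ↔ z = x ∨ z = q x) (x : X) (hx : q x = x) (y : X) :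
    (r ⊔ s) x y ↔ (p * q).SameCycle x y := by
  have hqx : ∀ y, (p * q).SameCycle x y → (p * q).SameCycle x (q y) := by
    rintro _ ⟨k, rfl⟩
    refine ⟨-k, ?_⟩
    have hp' : p⁻¹ = p := inv_eq_of_mul_eq_one_left hp
    have hq' : q⁻¹ = q := inv_eq_of_mul_eq_one_left hq
    have : q * (p * q) ^ k * q⁻¹ = (p * q) ^ (-k) := by
      rw [← conj_zpow, zpow_neg, ← inv_zpow]
      congr 1
      rw [mul_inv_rev, hp', hq', mul_assoc, mul_assoc, hq, mul_one]
    rw [← this, hq', Equiv.Perm.mul_apply, Equiv.Perm.mul_apply, hx]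
  have hpx : ∀ y, (p * q).SameCycle x y → (p * q).SameCycle x (p y) := by
    intro y hy
    have h1 := hqx y hy
    have h2 : (p * q).SameCycle x ((p * q) (q y)) := Equiv.Perm.sameCycle_apply_right.2 h1
    have h3 : (p * q) (q y) = p y := by
      rw [← Equiv.Perm.mul_apply, mul_assoc, hq, mul_one]
    rwa [h3] at h2
  have hpp : ∀ y, p (p y) = y := fun y => by rw [← Equiv.Perm.mul_apply, hp]; rfl
  have hqq : ∀ y, q (q y) = y := fun y => by rw [← Equiv.Perm.mul_apply, hq]; rfl
  constructor
  · intro h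
    have hle : r ⊔ s ≤ Setoid.ker (fun y => (p * q).SameCycle x y) := by
      refine sup_le (fun a b hab => ?_) (fun a b hab => ?_)
      · rcases (hr a b).1 hab with rfl | rfl
        · exact Setoid.refl' _ _
        · exact propext ⟨hpx a, fun h => by simpa only [hpp] using hpx _ h⟩
      · rcases (hs a b).1 hab with rfl | rfl
        · exact Setoid.refl' _ _
        · exact propext ⟨hqx a, fun h => by simpa only [hqq] using hqx _ h⟩
    have := hle h
    change (p * q).SameCycle x x = (p * q).SameCycle x y at this
    rw [← this]
  · rintro ⟨k, rfl⟩
    have hstep : ∀ z, (r ⊔ s) z ((p * q) z) := by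
      intro z
      refine Setoid.trans' _ (y := q z) ?_ ?_
      · exact (le_sup_right : s ≤ r ⊔ s) ((hs _ _).2 (Or.inr rfl))
      · exact (le_sup_left : r ≤ r ⊔ s) ((hr _ _).2 (Or.inr rfl))
    induction k using Int.induction_on with
    | zero => exact Setoid.refl' _ _
    | succ k ih =>
      rw [add_comm, zpow_add, zpow_one, Equiv.Perm.mul_apply]
      exact Setoid.trans' _ ih (hstep _)
    | pred k ih =>
      refine Setoid.trans' _ ih (Setoid.symm' _ ?_)
      have := hstep (((p * q) ^ (-(k:ℤ) - 1)) x)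
      rwa [← Equiv.Perm.mul_apply (p * q), ← zpow_one_add, show (1 + (-(k:ℤ) - 1)) = -k by ring]
        at this


/-! ## Brauer diagrams -/

/-- An `(n,n)`-Brauer diagram: an equivalence relation on the `n` northern nodes `Sum.inl p` and
the `n` southern nodes `Sum.inr p` all of whose classes consist of exactly two nodes. -/
structure BrauerDiagram (n : ℕ) where
  rel : Setoid (Fin n ⊕ Fin n)
  existsUnique_partner : ∀ x, ∃! y, y ≠ x ∧ rel x y

namespace BrauerDiagram

variable {n : ℕ}

/-- The embedding of the nodes of a diagram into a stack of layers of nodes, indexed by `L`: the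
northern nodes go to layer `a` and the southern nodes to layer `b`. -/
def place {L : Type*} (a b : L) : Fin n ⊕ Fin n → L × Fin n :=
  Sum.elim (fun p => (a, p)) (fun p => (b, p))

/-- The concatenation of `t` above `t'`, with the southern nodes of `t` identified with the
northern nodes of `t'` (layer `1`): its classes are the connected components. -/
def concat (t t' : BrauerDiagram n) : Setoid (Fin 3 × Fin n) :=
  t.rel.map (place 0 1) ⊔ t'.rel.map (place 1 2)

/-- The number `m(t,t')` of cycles in the concatenation of `t` above `t'`: the number of its
connected components all of whose nodes lie in the middle layer (every middle node lies on
exactly one edge of `t` and exactly one edge of `t'`). -/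
noncomputable def numCycles (t t' : BrauerDiagram n) : ℕ :=
  {c ∈ (concat t t').classes | c ⊆ {x | x.1 = 1}}.ncard

theorem ext_rel {t t' : BrauerDiagram n} (h : t.rel = t'.rel) : t = t' := by
  cases t; cases t'; congr

theorem eq_of_le {t t' : BrauerDiagram n} (h : t.rel ≤ t'.rel) : t = t' := by
  refine ext_rel (le_antisymm h fun x y hxy => ?_)
  by_cases hyx : y = x
  · rw [hyx]
  obtain ⟨z, ⟨hz, hxz⟩, -⟩ := t.existsUnique_partner x
  have := (t'.existsUnique_partner x).unique ⟨hz, h hxz⟩ ⟨hyx, hxy⟩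
  rwa [← this]

theorem place_injective {L : Type*} {a b : L} (hab : a ≠ b) :
    Function.Injective (place a b : Fin n ⊕ Fin n → L × Fin n) := by
  rintro (p | p) (q | q) h <;> simp_all [place]


theorem place_pair {L : Type*} {a b : L} (hab : a ≠ b) (t : BrauerDiagram n) (x : L × Fin n) :
    ∃ y, (∀ z, t.rel.map (place a b) x z ↔ z = x ∨ z = y) ∧
      (y = x ↔ x.1 ≠ a ∧ x.1 ≠ b) := by
  by_cases hx : ∃ u, place a b u = x
  · obtain ⟨u, rfl⟩ := hx
    obtain ⟨v, ⟨hv, huv⟩, hu⟩ := t.existsUnique_partner u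
    refine ⟨place a b v, fun z => ?_, ?_⟩
    · rw [SetoidAux.map_rel_iff (place_injective hab)]
      constructor
      · rintro (⟨u', w, h, h1, rfl⟩ | h)
        · obtain rfl := place_injective hab h1
          by_cases hw : w = u'
          · exact Or.inl (by rw [hw])
          · exact Or.inr (by rw [hu w ⟨hw, h⟩])
        · exact Or.inl h.symm
      · rintro (rfl | rfl)
        · exact Or.inr rfl
        · exact Or.inl ⟨u, v, huv, rfl, rfl⟩
    · refine iff_of_false (fun h => hv (place_injective hab h)) ?_
      rcases u with p | p <;> simp [place]
  · refine ⟨x, fun z => ?_, iff_of_true rfl ⟨?_, ?_⟩⟩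
    · rw [SetoidAux.map_rel_iff (place_injective hab)]
      constructor
      · rintro (⟨u', w, h, h1, rfl⟩ | h)
        · exact absurd ⟨_, h1⟩ hx
        · exact Or.inl h.symm
      · rintro (rfl | rfl) <;> exact Or.inr rfl
    · rintro rfl
      exact hx ⟨Sum.inl x.2, rfl⟩
    · rintro rfl
      exact hx ⟨Sum.inr x.2, rfl⟩

theorem concat_partner (t t' : BrauerDiagram n) (x : Fin 3 × Fin n) (hx : x.1 ≠ 1) :
    ∃! y, y ≠ x ∧ y.1 ≠ 1 ∧ concat t t' x y := by
  choose f hf hf' using place_pair (L := Fin 3) (a := 0) (b := 1) (by decide) t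
  choose g hg hg' using place_pair (L := Fin 3) (a := 1) (b := 2) (by decide) t'
  obtain ⟨p, hp, hpr⟩ := exists_perm_of_setoid _ (fun x => ⟨f x, hf x⟩)
  obtain ⟨q, hq, hqr⟩ := exists_perm_of_setoid _ (fun x => ⟨g x, hg x⟩)
  have hpf : ∀ x, p x = x ↔ x.1 = 2 := by
    intro x
    have : p x = x ↔ f x = x := by
      have h1 := hpr x (f x)
      have h2 := (hf x (f x)).2 (Or.inr rfl)
      have h3 := hf x (p x)
      have h4 := (hpr x (p x)).2 (Or.inr rfl)
      constructor
      · intro h; rcases h1.1 h2 with h5 | h5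
        · exact h5
        · rw [h5, h]
      · intro h; rcases h3.1 h4 with h5 | h5
        · exact h5
        · rw [h5, h]
    rw [this, hf']
    generalize x.1 = a
    revert a; decide
  have hqf : ∀ x, q x = x ↔ x.1 = 0 := by
    intro x
    have : q x = x ↔ g x = x := by
      have h1 := hqr x (g x)
      have h2 := (hg x (g x)).2 (Or.inr rfl)
      have h3 := hg x (q x)
      have h4 := (hqr x (q x)).2 (Or.inr rfl)
      constructor
      · intro h; rcases h1.1 h2 with h5 | h5
        · exact h5
        · rw [h5, h]
      · intro h; rcases h3.1 h4 with h5 | h5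
        · exact h5
        · rw [h5, h]
    rw [this, hg']
    generalize x.1 = a
    revert a; decide
  have houter : ∀ y : Fin 3 × Fin n, y.1 ≠ 1 ↔ (p y = y ∨ q y = y) := by
    intro y
    rw [hpf, hqf]
    generalize y.1 = a
    revert a; decide
  have hne : ∀ y, ¬ (p y = y ∧ q y = y) := by
    rintro y ⟨h1, h2⟩
    rw [hpf] at h1
    rw [hqf, h1] at h2
    exact absurd h2 (by decide)
  rcases (houter x).1 hx with h | h
  · have := dihedral_aux q p hq hp (fun y hy => hne y hy.symm) x h
    have hs : ∀ y, concat t t' x y ↔ (q * p).SameCycle x y := fun y => by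
      rw [← sameCycle_aux q p hq hp _ _ hqr hpr x h, concat, sup_comm]
    simp only [houter, hs]
    simpa only [or_comm] using this
  · have := dihedral_aux p q hp hq hne x h
    have hs : ∀ y, concat t t' x y ↔ (p * q).SameCycle x y :=
      sameCycle_aux p q hp hq _ _ hpr hqr x h
    simpa only [houter, hs] using this

/-- The composition `t ∘ t'`: concatenate `t` above `t'`, delete the cycles, and keep the
connections between the outer nodes. -/
def comp (t t' : BrauerDiagram n) : BrauerDiagram n where
  rel := (concat t t').comap (place 0 2)
  existsUnique_partner x := by
    have hinj := place_injective (n := n) (show (0 : Fin 3) ≠ 2 by decide)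
    have hout : ∀ u : Fin n ⊕ Fin n, (place (0 : Fin 3) 2 u).1 ≠ 1 := by
      rintro (p | p) <;> simp [place]
    obtain ⟨y, ⟨h1, h2, h3⟩, hu⟩ := concat_partner t t' (place 0 2 x) (hout x)
    have hy : ∃ v, place 0 2 v = y := by
      obtain ⟨a, p⟩ := y
      fin_cases a
      · exact ⟨Sum.inl p, rfl⟩
      · exact absurd rfl h2
      · exact ⟨Sum.inr p, rfl⟩
    obtain ⟨v, rfl⟩ := hy
    refine ⟨v, ⟨fun h => h1 (by rw [h]), h3⟩, fun w hw => ?_⟩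
    exact hinj (hu _ ⟨fun h => hw.1 (hinj h), hout w, hw.2⟩)

/-- The diagram connecting each pair of opposite nodes. -/
def idDiagram (n : ℕ) : BrauerDiagram n where
  rel := Setoid.ker (Sum.elim id id)
  existsUnique_partner := by
    rintro (p | p)
    · refine ⟨Sum.inr p, ⟨by simp, rfl⟩, ?_⟩
      rintro (q | q) ⟨h1, h2⟩
      · exact absurd (congrArg Sum.inl (show p = q from h2)).symm h1
      · exact (congrArg Sum.inr (show p = q from h2)).symm
    · refine ⟨Sum.inl p, ⟨by simp, rfl⟩, ?_⟩
      rintro (q | q) ⟨h1, h2⟩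
      · exact (congrArg Sum.inl (show p = q from h2)).symm
      · exact absurd (congrArg Sum.inr (show p = q from h2)).symm h1

theorem concat_upper (t t' : BrauerDiagram n) {u v : Fin n ⊕ Fin n} (h : t.rel u v) :
    concat t t' (place 0 1 u) (place 0 1 v) :=
  (le_sup_left : t.rel.map (place 0 1) ≤ concat t t') (Setoid.le_comap_map h)

theorem concat_lower (t t' : BrauerDiagram n) {u v : Fin n ⊕ Fin n} (h : t'.rel u v) :
    concat t t' (place 1 2 u) (place 1 2 v) :=
  (le_sup_right : t'.rel.map (place 1 2) ≤ concat t t') (Setoid.le_comap_map h)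

theorem idDiagram_comp (t : BrauerDiagram n) : comp (idDiagram n) t = t := by
  refine (eq_of_le fun u v h => ?_).symm
  have key : ∀ u : Fin n ⊕ Fin n, concat (idDiagram n) t (place 0 2 u) (place 1 2 u) := by
    rintro (p | p)
    · exact concat_upper (idDiagram n) t (u := Sum.inl p) (v := Sum.inr p) rfl
    · exact Setoid.refl' _ _
  exact Setoid.trans' (concat _ _) (key u)
    (Setoid.trans' _ (concat_lower _ _ h) (Setoid.symm' (concat _ _) (key v)))

theorem comp_idDiagram (t : BrauerDiagram n) : comp t (idDiagram n) = t := by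
  refine (eq_of_le fun u v h => ?_).symm
  have key : ∀ u : Fin n ⊕ Fin n, concat t (idDiagram n) (place 0 2 u) (place 0 1 u) := by
    rintro (p | p)
    · exact Setoid.refl' _ _
    · exact concat_lower t (idDiagram n) (u := Sum.inr p) (v := Sum.inl p) rfl
  exact Setoid.trans' (concat _ _) (key u)
    (Setoid.trans' _ (concat_upper _ _ h) (Setoid.symm' (concat _ _) (key v)))

/-- The concatenation of three diagrams. -/
def concat₃ (t t' t'' : BrauerDiagram n) : Setoid (Fin 4 × Fin n) :=
  t.rel.map (place 0 1) ⊔ t'.rel.map (place 1 2) ⊔ t''.rel.map (place 2 3)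

/-- The map on nodes induced by a map on layers. -/
def lay {L L' : Type*} (f : L → L') : L × Fin n → L' × Fin n := Prod.map f id

theorem lay_injective {L L' : Type*} {f : L → L'} (hf : f.Injective) :
    Function.Injective (lay f : L × Fin n → L' × Fin n) := hf.prodMap Function.injective_id

theorem lay_comp_place {L L' : Type*} (f : L → L') (a b : L) :
    lay f ∘ (place a b : Fin n ⊕ Fin n → _) = place (f a) (f b) := by
  ext1 (p | p) <;> rfl

theorem upper_pair (t t' t'' : BrauerDiagram n) :
    concat₃ t t' t'' = (concat t t').map (lay ![0, 1, 2]) ⊔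
      (t''.rel.map (place 1 2)).map (lay ![0, 2, 3]) := by
  rw [concat, concat₃, SetoidAux.map_sup, SetoidAux.map_map, SetoidAux.map_map,
    SetoidAux.map_map, lay_comp_place, lay_comp_place, lay_comp_place]
  rfl

theorem lower_pair (t t' t'' : BrauerDiagram n) :
    concat₃ t t' t'' = (concat t' t'').map (lay ![1, 2, 3]) ⊔
      (t.rel.map (place 0 1)).map (lay ![0, 1, 3]) := by
  rw [concat, concat₃, SetoidAux.map_sup, SetoidAux.map_map, SetoidAux.map_map,
    SetoidAux.map_map, lay_comp_place, lay_comp_place, lay_comp_place, sup_assoc, sup_comm]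
  rfl

theorem lay_pullback {L₁ L₂ : Type*} {a b : L₁} {a' b' : L₂} {f : L₁ → Fin 4} {g : L₂ → Fin 4}
    (h : ∀ l l', f l = g l' → (l = a ∧ l' = a') ∨ (l = b ∧ l' = b'))
    (p : L₁ × Fin n) (y : L₂ × Fin n) (hpy : lay f p = lay g y) :
    ∃ q : Fin n ⊕ Fin n, place a b q = p ∧ place a' b' q = y := by
  obtain ⟨l, p⟩ := p
  obtain ⟨l', y⟩ := y
  obtain ⟨h1, h2⟩ := Prod.ext_iff.1 hpy
  obtain rfl : p = y := h2
  rcases h _ _ h1 with ⟨rfl, rfl⟩ | ⟨rfl, rfl⟩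
  · exact ⟨Sum.inl p, rfl, rfl⟩
  · exact ⟨Sum.inr p, rfl, rfl⟩

theorem concat_comp_left (t t' t'' : BrauerDiagram n) :
    concat (comp t t') t'' = (concat₃ t t' t'').comap (lay ![0, 2, 3]) := by
  rw [upper_pair, SetoidAux.comap_sup_map, concat]
  congr 1
  refine (SetoidAux.comap_map_of_pullback (lay_injective (by decide))
    (lay_injective (by decide)) (place_injective (by decide)) ?_ ?_ _).symm
  · rintro (p | p) <;> rfl
  · exact lay_pullback (by decide)

theorem concat_comp_right (t t' t'' : BrauerDiagram n) :
    concat t (comp t' t'') = (concat₃ t t' t'').comap (lay ![0, 1, 3]) := by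
  rw [lower_pair, SetoidAux.comap_sup_map, concat, sup_comm]
  congr 1
  refine (SetoidAux.comap_map_of_pullback (lay_injective (by decide))
    (lay_injective (by decide)) (place_injective (by decide)) ?_ ?_ _).symm
  · rintro (p | p) <;> rfl
  · exact lay_pullback (by decide)

theorem comp_assoc (t t' t'' : BrauerDiagram n) :
    comp (comp t t') t'' = comp t (comp t' t'') := by
  apply ext_rel
  change (concat (comp t t') t'').comap _ = (concat t (comp t' t'')).comap _
  rw [concat_comp_left, concat_comp_right]
  ext u v
  rcases u with p | p <;> rcases v with q | q <;> rfl

theorem numCycles_left (t t' t'' : BrauerDiagram n) :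
    {c ∈ (concat₃ t t' t'').classes | c ⊆ {x | x.1 = 1} ∪ {x | x.1 = 2}}.ncard =
      numCycles (comp t t') t'' + numCycles t t' := by
  have e1 : (lay ![0, 2, 3] : Fin 3 × Fin n → Fin 4 × Fin n) ⁻¹' {x | x.1 = 2} =
      {x | x.1 = 1} := by
    ext ⟨a, p⟩
    change ![0, 2, 3] a = (2 : Fin 4) ↔ a = 1
    revert a; decide
  have e2 : (lay ![0, 1, 2] : Fin 3 × Fin n → Fin 4 × Fin n) ⁻¹' {x | x.1 = 1} =
      {x | x.1 = 1} := by
    ext ⟨a, p⟩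
    change ![0, 1, 2] a = (1 : Fin 4) ↔ a = 1
    revert a; decide
  rw [numCycles, numCycles, concat_comp_left, upper_pair,
    SetoidAux.ncard_classes_sup (lay_injective (by decide)), e1, e2]
  · rintro ⟨a, p⟩
    constructor
    · rintro h ⟨⟨b, q⟩, hb⟩
      have h1 : ![0, 2, 3] b = a := (Prod.ext_iff.1 hb).1
      have h2 : a = 1 := h
      rw [h2] at h1
      clear hb; revert b; decide
    · intro h
      change a = 1
      by_contra ha
      have : ∀ a : Fin 4, a ≠ 1 → ∃ b, (![0, 2, 3] b : Fin 4) = a := by decide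
      obtain ⟨b, hb⟩ := this a ha
      exact h ⟨(b, p), Prod.ext hb rfl⟩
  · rintro ⟨a, p⟩ h
    exact ⟨(1, p), Prod.ext (Eq.symm h) rfl⟩

theorem numCycles_right (t t' t'' : BrauerDiagram n) :
    {c ∈ (concat₃ t t' t'').classes | c ⊆ {x | x.1 = 1} ∪ {x | x.1 = 2}}.ncard =
      numCycles t (comp t' t'') + numCycles t' t'' := by
  have e1 : (lay ![0, 1, 3] : Fin 3 × Fin n → Fin 4 × Fin n) ⁻¹' {x | x.1 = 1} =
      {x | x.1 = 1} := by
    ext ⟨a, p⟩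
    change ![0, 1, 3] a = (1 : Fin 4) ↔ a = 1
    revert a; decide
  have e2 : (lay ![1, 2, 3] : Fin 3 × Fin n → Fin 4 × Fin n) ⁻¹' {x | x.1 = 2} =
      {x | x.1 = 1} := by
    ext ⟨a, p⟩
    change ![1, 2, 3] a = (2 : Fin 4) ↔ a = 1
    revert a; decide
  rw [Set.union_comm, numCycles, numCycles, concat_comp_right, lower_pair,
    SetoidAux.ncard_classes_sup (lay_injective (by decide)), e1, e2]
  · rintro ⟨a, p⟩
    constructor
    · rintro h ⟨⟨b, q⟩, hb⟩
      have h1 : ![0, 1, 3] b = a := (Prod.ext_iff.1 hb).1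
      have h2 : a = 2 := h
      rw [h2] at h1
      clear hb; revert b; decide
    · intro h
      change a = 2
      by_contra ha
      have : ∀ a : Fin 4, a ≠ 2 → ∃ b, (![0, 1, 3] b : Fin 4) = a := by decide
      obtain ⟨b, hb⟩ := this a ha
      exact h ⟨(b, p), Prod.ext hb rfl⟩
  · rintro ⟨a, p⟩ h
    exact ⟨(1, p), Prod.ext (Eq.symm h) rfl⟩

instance : Monoid (BrauerDiagram n) where
  mul := comp
  one := idDiagram n
  mul_assoc := comp_assoc
  one_mul := idDiagram_comp
  mul_one := comp_idDiagram

end BrauerDiagram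


/-! ## Twisted monoid algebras -/

/-- A 2-cocycle of the monoid `S` with values in `kˣ`. -/
structure TwoCocycle (S k : Type*) [Monoid S] [Field k] where
  toFun : S → S → kˣ
  cocycle : ∀ u t s, toFun (u * t) s * toFun u t = toFun u (t * s) * toFun t s

instance {S k : Type*} [Monoid S] [Field k] : CoeFun (TwoCocycle S k) fun _ => S → S → kˣ :=
  ⟨TwoCocycle.toFun⟩

/-- The restriction of a 2-cocycle along a (not necessarily unital) homomorphism. -/
def TwoCocycle.restrict {S M k : Type*} [Monoid S] [Monoid M] [Field k] (α : TwoCocycle S k)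
    (f : M →ₙ* S) : TwoCocycle M k where
  toFun x y := α (f x) (f y)
  cocycle u t s := by simpa only [map_mul] using α.cocycle (f u) (f t) (f s)

/-- The twisted monoid algebra `k_α S`: the `k`-vector space with basis `S` and multiplication
`s · t = α(s,t) (s ∘ t)`. -/
def TwistedAlgebra {S k : Type*} [Monoid S] [Field k] (_α : TwoCocycle S k) : Type _ := S →₀ k

namespace TwistedAlgebra

variable {S k : Type*} [Monoid S] [Field k] {α : TwoCocycle S k}

noncomputable instance : AddCommGroup (TwistedAlgebra α) := inferInstanceAs (AddCommGroup (S →₀ k))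

noncomputable instance : Module k (TwistedAlgebra α) := inferInstanceAs (Module k (S →₀ k))

/-- The basis of the twisted monoid algebra given by the elements of the monoid. -/
noncomputable def basis (α : TwoCocycle S k) : Module.Basis S k (TwistedAlgebra α) :=
  Module.Basis.ofRepr (LinearEquiv.refl k (S →₀ k))

/-- The multiplication of the twisted monoid algebra as a bilinear map. -/
noncomputable def mulHom (α : TwoCocycle S k) :
    TwistedAlgebra α →ₗ[k] TwistedAlgebra α →ₗ[k] TwistedAlgebra α :=
  (basis α).constr k fun s => (basis α).constr k fun t => (α s t : k) • basis α (s * t)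

theorem mulHom_basis (s t : S) :
    mulHom α (basis α s) (basis α t) = (α s t : k) • basis α (s * t) := by
  simp [mulHom]

theorem map_one_left (α : TwoCocycle S k) (s : S) : α 1 s = α 1 1 := by
  have := α.cocycle 1 1 s
  rw [one_mul, one_mul] at this
  exact (mul_left_cancel this).symm

theorem map_one_right (α : TwoCocycle S k) (s : S) : α s 1 = α 1 1 := by
  have := α.cocycle s 1 1
  rw [mul_one, mul_one] at this
  exact mul_left_cancel this

theorem mulHom_assoc (a b c : TwistedAlgebra α) :
    mulHom α (mulHom α a b) c = mulHom α a (mulHom α b c) := by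
  have h₃ : ∀ s t, mulHom α (mulHom α (basis α s) (basis α t)) =
      mulHom α (basis α s) ∘ₗ mulHom α (basis α t) := by
    intro s t
    refine (basis α).ext fun u => ?_
    rw [LinearMap.comp_apply, mulHom_basis, mulHom_basis, map_smul, map_smul,
      LinearMap.smul_apply, mulHom_basis, mulHom_basis, smul_smul, smul_smul, mul_assoc]
    congr 1
    have := congrArg (Units.val : kˣ → k) (α.cocycle s t u)
    push_cast at this
    rw [mul_comm, this, mul_comm]
  have h₂ : ∀ s c, (mulHom α).flip c ∘ₗ mulHom α (basis α s) =
      mulHom α (basis α s) ∘ₗ (mulHom α).flip c := fun s c =>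
    (basis α).ext fun t => LinearMap.congr_fun (h₃ s t) c
  have h₁ : (mulHom α).flip c ∘ₗ (mulHom α).flip b = (mulHom α).flip (mulHom α b c) :=
    (basis α).ext fun s => LinearMap.congr_fun (h₂ s c) b
  exact LinearMap.congr_fun h₁ a

/-- The identity element `α(1,1)⁻¹ · 1` of the twisted monoid algebra. -/
noncomputable def unit (α : TwoCocycle S k) : TwistedAlgebra α :=
  (((α 1 1)⁻¹ : kˣ) : k) • basis α 1

theorem unit_mulHom (a : TwistedAlgebra α) : mulHom α (unit α) a = a := by
  have h : mulHom α (unit α) = LinearMap.id := (basis α).ext fun s => by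
    rw [unit, map_smul, LinearMap.smul_apply, mulHom_basis, smul_smul, map_one_left α s, one_mul,
      Units.inv_mul, one_smul, LinearMap.id_apply]
  exact LinearMap.congr_fun h a

theorem mulHom_unit (a : TwistedAlgebra α) : mulHom α a (unit α) = a := by
  have h : (mulHom α).flip (unit α) = LinearMap.id := (basis α).ext fun s => by
    rw [LinearMap.flip_apply, unit, map_smul, mulHom_basis, smul_smul, map_one_right α s, mul_one,
      Units.inv_mul, one_smul, LinearMap.id_apply]
  exact LinearMap.congr_fun h a

noncomputable instance : Ring (TwistedAlgebra α) where
  __ := (inferInstance : AddCommGroup (TwistedAlgebra α))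
  mul a b := mulHom α a b
  one := unit α
  left_distrib a b c := map_add (mulHom α a) b c
  right_distrib a b c := LinearMap.map_add₂ (mulHom α) a b c
  zero_mul a := LinearMap.map_zero₂ (mulHom α) a
  mul_zero a := map_zero (mulHom α a)
  mul_assoc := mulHom_assoc
  one_mul := unit_mulHom
  mul_one := mulHom_unit

noncomputable instance : Algebra k (TwistedAlgebra α) :=
  Algebra.ofModule (fun c a b => LinearMap.map_smul₂ (mulHom α) c a b)
    (fun c a b => map_smul (mulHom α a) c b)

theorem basis_mul_basis (s t : S) :
    basis α s * basis α t = (α s t : k) • basis α (s * t) := mulHom_basis s t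

theorem one_def : (1 : TwistedAlgebra α) = (((α 1 1)⁻¹ : kˣ) : k) • basis α 1 := rfl

/-- If the cocycle `α` is constant with value `a` on the image of a group homomorphism
`f : G →* S`, then `g ↦ a⁻¹ · f(g)` is multiplicative; for bijective `f` it extends to the
isomorphism `k G ≅ k_α S` whose inverse is given by `f(g) ↦ a · g`. -/
noncomputable def untwist {G : Type*} [Group G] (f : G →* S) (a : kˣ)
    (h : ∀ g g', α (f g) (f g') = a) : G →* TwistedAlgebra α where
  toFun g := ((a⁻¹ : kˣ) : k) • basis α (f g)
  map_one' := by
    have := h 1 1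
    rw [map_one] at this
    rw [one_def, map_one, this]
  map_mul' g g' := by
    rw [smul_mul_smul_comm, basis_mul_basis, h, smul_smul, map_mul, mul_assoc, Units.inv_mul,
      mul_one]

end TwistedAlgebra

/-! ## The order relations on the simple modules of a twisted monoid algebra -/

section General

variable {S k : Type*} [Monoid S] [Field k]

/-- The monoid `e ∘ S ∘ e` with identity element `e`. -/
def LocalMonoid {e : S} (_he : IsIdempotentElem e) : Type _ := Subsemigroup.corner e

instance {e : S} (he : IsIdempotentElem e) : Monoid (LocalMonoid he) where
  mul x y := ⟨x.1 * y.1, (Subsemigroup.corner e).mul_mem x.2 y.2⟩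
  mul_assoc x y z := Subtype.ext (mul_assoc x.1 y.1 z.1)
  one := ⟨e, e, by simp only [he.eq]⟩
  one_mul x := Subtype.ext ((Subsemigroup.mem_corner_iff he).1 x.2).1
  mul_one x := Subtype.ext ((Subsemigroup.mem_corner_iff he).1 x.2).2

/-- The group `Γ_e` of units of `e ∘ S ∘ e`. -/
abbrev MaxSubgroup {e : S} (he : IsIdempotentElem e) : Type _ := (LocalMonoid he)ˣ

/-- The inclusion of `Γ_e` into `S`. -/
def MaxSubgroup.incl {e : S} (he : IsIdempotentElem e) : MaxSubgroup he →ₙ* S where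
  toFun x := x.1.1
  map_mul' _ _ := rfl

/-- The twisted group algebra `k_α Γ_e`. -/
abbrev GroupAlg (α : TwoCocycle S k) {e : S} (he : IsIdempotentElem e) : Type _ :=
  TwistedAlgebra (α.restrict (MaxSubgroup.incl he))

/-- The inclusion of `k_α Γ_e` into `k_α S`. -/
noncomputable def GroupAlg.incl (α : TwoCocycle S k) {e : S} (he : IsIdempotentElem e) :
    GroupAlg α he →ₗ[k] TwistedAlgebra α :=
  (TwistedAlgebra.basis _).constr k fun x => TwistedAlgebra.basis α (MaxSubgroup.incl he x)

/-- The set `S ∘ s ∘ S`. -/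
def twoSided (s : S) : Set S := {x | ∃ a b, a * s * b = x}

/-- The `J`-class of `s`. -/
def jClass (s : S) : Set S := {t | twoSided t = twoSided s}

/-- The strict order `J(s) < J(t)` on `J`-classes. -/
def JLT (s t : S) : Prop := twoSided s ⊂ twoSided t

/-- The set `J(f) ∩ e ∘ S ∘ f`. -/
def HomSet (e f : S) : Set S := {t | t ∈ jClass f ∧ ∃ s, e * s * f = t}

theorem HomSet.act_mem {e f : S} (he : IsIdempotentElem e) (hf : IsIdempotentElem f)
    (x : MaxSubgroup he) (y : MaxSubgroup hf) {t : S} (ht : t ∈ HomSet e f) :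
    MaxSubgroup.incl he x * t * MaxSubgroup.incl hf y⁻¹ ∈ HomSet e f := by
  obtain ⟨hJ, s, rfl⟩ := ht
  have hx : ∀ x : MaxSubgroup he, e * MaxSubgroup.incl he x = MaxSubgroup.incl he x ∧
      MaxSubgroup.incl he x * e = MaxSubgroup.incl he x := fun x =>
    (Subsemigroup.mem_corner_iff he).1 x.1.2
  have hy : ∀ x : MaxSubgroup hf, f * MaxSubgroup.incl hf x = MaxSubgroup.incl hf x ∧
      MaxSubgroup.incl hf x * f = MaxSubgroup.incl hf x := fun x =>
    (Subsemigroup.mem_corner_iff hf).1 x.1.2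
  have hxx : MaxSubgroup.incl he x⁻¹ * MaxSubgroup.incl he x = e := by
    rw [← map_mul, inv_mul_cancel]; rfl
  have hyy : MaxSubgroup.incl hf y⁻¹ * MaxSubgroup.incl hf y = f := by
    rw [← map_mul, inv_mul_cancel]; rfl
  refine ⟨?_, MaxSubgroup.incl he x * e * s * (f * MaxSubgroup.incl hf y⁻¹), ?_⟩
  · rw [jClass, Set.mem_ofPred_eq] at hJ ⊢
    rw [← hJ]
    apply Set.Subset.antisymm
    · rintro _ ⟨a, b, rfl⟩
      exact ⟨a * MaxSubgroup.incl he x, MaxSubgroup.incl hf y⁻¹ * b, by simp only [mul_assoc]⟩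
    · rintro _ ⟨a, b, rfl⟩
      refine ⟨a * MaxSubgroup.incl he x⁻¹, MaxSubgroup.incl hf y * b, ?_⟩
      calc _ = a * ((MaxSubgroup.incl he x⁻¹ * MaxSubgroup.incl he x) * e) * s *
            (f * (MaxSubgroup.incl hf y⁻¹ * MaxSubgroup.incl hf y)) * b := by
            simp only [mul_assoc]
        _ = _ := by rw [hxx, hyy, he.eq, hf.eq]; simp only [mul_assoc]
  · calc _ = (e * MaxSubgroup.incl he x) * e * s * (f * (MaxSubgroup.incl hf y⁻¹ * f)) := by
          simp only [mul_assoc]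
      _ = _ := by rw [(hx x).1, (hy _).2]; simp only [mul_assoc]

/-- The action `(x, y) · t = x ∘ t ∘ y⁻¹` of `Γ_e × Γ_f` on `J(f) ∩ e ∘ S ∘ f`. -/
instance HomSet.mulAction {e f : S} (he : IsIdempotentElem e) (hf : IsIdempotentElem f) :
    MulAction (MaxSubgroup he × MaxSubgroup hf) (HomSet e f) where
  smul g t := ⟨MaxSubgroup.incl he g.1 * t * MaxSubgroup.incl hf g.2⁻¹,
    HomSet.act_mem he hf g.1 g.2 t.2⟩
  one_smul t := by
    obtain ⟨t, hJ, s, rfl⟩ := t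
    apply Subtype.ext
    change e * (e * s * f) * f = e * s * f
    rw [← mul_assoc, ← mul_assoc, he.eq, mul_assoc, hf.eq]
  mul_smul g g' t := by
    apply Subtype.ext
    change MaxSubgroup.incl he (g.1 * g'.1) * t * MaxSubgroup.incl hf (g.2 * g'.2)⁻¹ =
      MaxSubgroup.incl he g.1 * (MaxSubgroup.incl he g'.1 * t * MaxSubgroup.incl hf g'.2⁻¹) *
        MaxSubgroup.incl hf g.2⁻¹
    rw [mul_inv_rev, map_mul, map_mul]
    simp only [mul_assoc]

/-- The family `T` is a set of representatives of the isomorphism classes of simple modules over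
the ring `R`. -/
structure IsSimpleRepresentatives (R : Type u) [Ring R] {ι : Type*} (T : ι → Type u)
    [∀ r, AddCommGroup (T r)] [∀ r, Module R (T r)] : Prop where
  simple : ∀ r, IsSimpleModule R (T r)
  eq_of_iso : ∀ r s, Nonempty (T r ≃ₗ[R] T s) → r = s
  complete : ∀ (M : Type u) [AddCommGroup M] [Module R M] [IsSimpleModule R M],
    ∃ r, Nonempty (M ≃ₗ[R] T r)

/-- `f` is the block idempotent of `R` corresponding to the simple module `M`: the primitive
central idempotent of `R` with `f M ≠ 0`. -/
structure IsBlockIdempotent {R : Type*} [Ring R] (M : Type*) [AddCommGroup M] [Module R M]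
    (f : R) : Prop where
  idempotent : IsIdempotentElem f
  central : f ∈ Subring.center R
  ne_zero : f ≠ 0
  primitive : ∀ g ∈ Subring.center R, IsIdempotentElem g → g * f = g → g = 0 ∨ g = f
  acts : ∃ m : M, f • m ≠ 0

/- In the following, `e i`, for `i` in a linearly ordered set `I`, are idempotents representing the
`J`-classes of `S`, and `T i r` are representatives of the simple modules of `k_α Γ_{e i}`. -/
variable {I : Type*} [LinearOrder I] {e : I → S} (he : ∀ i, IsIdempotentElem (e i))
  (α : TwoCocycle S k) {l : I → ℕ}

/-- The span `J_j` of the `J`-classes of the `e i` with `i ≤ j`. -/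
noncomputable def spanLE (e : I → S) (α : TwoCocycle S k) (j : I) : Submodule k (TwistedAlgebra α) :=
  Submodule.span k (TwistedAlgebra.basis α '' {s | ∃ i ≤ j, s ∈ jClass (e i)})

/-- The span `J_{j-1}` of the `J`-classes of the `e i` with `i < j`. -/
noncomputable def spanLT (e : I → S) (α : TwoCocycle S k) (j : I) : Submodule k (TwistedAlgebra α) :=
  Submodule.span k (TwistedAlgebra.basis α '' {s | ∃ i < j, s ∈ jClass (e i)})

/-- The relation `(i,r) < (j,s)` on the set of labels. -/
def LabelLT (e : I → S) (x y : Σ i, Fin (l i)) : Prop := JLT (e y.1) (e x.1)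

variable (T : ∀ i, Fin (l i) → Type*) [∀ i r, AddCommGroup (T i r)]
  [∀ i r, Module (GroupAlg α (he i)) (T i r)]

/-- The relation `(i,r) ⊏ (j,s)` on the set of labels. -/
def SqLT (x y : Σ i, Fin (l i)) : Prop :=
  JLT (e y.1) (e x.1) ∧
    ∃ (f : GroupAlg α (he x.1)) (g : GroupAlg α (he y.1)),
      IsBlockIdempotent (T x.1 x.2) f ∧ IsBlockIdempotent (T y.1 y.2) g ∧
      ((∃ a ∈ spanLE e α y.1,
          GroupAlg.incl α _ f * a * GroupAlg.incl α _ g ∉ spanLT e α y.1) ∨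
        (∃ a ∈ spanLE e α y.1,
          GroupAlg.incl α _ g * a * GroupAlg.incl α _ f ∉ spanLT e α y.1))

/-- The relation `(i,r) ⊴ (j,s)`: the transitive closure of the reflexive relation `⊑`. -/
def UnlhdLE : (Σ i, Fin (l i)) → (Σ i, Fin (l i)) → Prop :=
  Relation.TransGen fun x y => x = y ∨ SqLT he α T x y

/-- The strict relation `(i,r) ⊲ (j,s)`. -/
def UnlhdLT (x y : Σ i, Fin (l i)) : Prop := UnlhdLE he α T x y ∧ x ≠ y

end General

/-- The representation `ρ` is isomorphic to a direct summand of the representation `σ`. -/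
def IsDirectSummand {k G V W : Type*} [Field k] [Group G] [AddCommGroup V] [Module k V]
    [AddCommGroup W] [Module k W] (ρ : Representation k G V) (σ : Representation k G W) : Prop :=
  ∃ (f : ρ.IntertwiningMap σ) (g : σ.IntertwiningMap ρ), ∀ v, g (f v) = v

/-! ## The Brauer algebra -/

namespace BrauerDiagram

variable {n : ℕ}

/-- The cocycle `α(t,t') = δ ^ m(t,t')`. The Brauer algebra of degree `n` with parameter `δ` is
`TwistedAlgebra (brauerCocycle n δ)`. -/
noncomputable def brauerCocycle {k : Type*} [Field k] (n : ℕ) (δ : kˣ) :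
    TwoCocycle (BrauerDiagram n) k where
  toFun t t' := δ ^ numCycles t t'
  cocycle u t s := by
    rw [← pow_add, ← pow_add]
    exact congrArg (δ ^ ·) ((numCycles_left u t s).symm.trans (numCycles_right u t s))

/- With `d = ⌊n/2⌋`, the elements `0, 1, …, d` of `Fin (n / 2 + 1)` stand for the indices
`1, 2, …, d + 1` of the `J`-classes, so that `d - i` below is the number `d - i + 1` in terms of
the indices that start from `1`. -/

/-- The number `n_i` of propagating lines of `e_i`. -/
def level (n : ℕ) (i : Fin (n / 2 + 1)) : ℕ := n - 2 * (n / 2 - i)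

theorem level_add (i : Fin (n / 2 + 1)) : level n i + 2 * (n / 2 - i) = n := by
  unfold level; omega

/-- The labels of the northern (`b = true`) and southern (`b = false`) nodes whose fibres are the
edges of `t_σ`. -/
def permLabel (i : Fin (n / 2 + 1)) (σ : Equiv.Perm (Fin (level n i))) (b : Bool) (p : Fin n) :
    Fin (level n i) ⊕ Bool × ℕ :=
  if h : (p : ℕ) < level n i then Sum.inl (σ ⟨p, h⟩) else Sum.inr (b, (p - level n i) / 2)

theorem permLabel_eq_iff (i : Fin (n / 2 + 1)) (σ τ : Equiv.Perm (Fin (level n i))) (b b' : Bool)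
    (p q : Fin n) : permLabel i σ b p = permLabel i τ b' q ↔
      (∃ (hp : (p : ℕ) < level n i) (hq : (q : ℕ) < level n i), σ ⟨p, hp⟩ = τ ⟨q, hq⟩) ∨
      (level n i ≤ p ∧ level n i ≤ q ∧ b = b' ∧ (p - level n i) / 2 = (q - level n i) / 2) := by
  unfold permLabel
  by_cases hp : (p : ℕ) < level n i <;> by_cases hq : (q : ℕ) < level n i
  · rw [dif_pos hp, dif_pos hq, Sum.inl.injEq]
    exact ⟨fun h => Or.inl ⟨hp, hq, h⟩, by
      rintro (⟨_, _, h⟩ | ⟨h, -⟩)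
      · exact h
      · omega⟩
  · rw [dif_pos hp, dif_neg hq]
    refine iff_of_false (by simp) ?_
    rintro (⟨-, h, -⟩ | ⟨h, -⟩) <;> omega
  · rw [dif_neg hp, dif_pos hq]
    refine iff_of_false (by simp) ?_
    rintro (⟨h, -, -⟩ | ⟨-, h, -⟩) <;> omega
  · rw [dif_neg hp, dif_neg hq, Sum.inr.injEq, Prod.mk.injEq]
    exact ⟨fun h => Or.inr ⟨by omega, by omega, h⟩, by
      rintro (⟨h, -⟩ | ⟨-, -, h⟩)
      · omega
      · exact h⟩

theorem exists_neighbour (i : Fin (n / 2 + 1)) (p : Fin n) (hp : level n i ≤ p) :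
    ∃ q : Fin n, q ≠ p ∧ level n i ≤ q ∧ (p - level n i) / 2 = (q - level n i) / 2 ∧
      ∀ q' : Fin n, q' ≠ p → level n i ≤ q' → (p - level n i) / 2 = (q' - level n i) / 2 →
        q' = q := by
  have hn := level_add (n := n) i
  have hpn := p.2
  rcases Nat.even_or_odd' ((p : ℕ) - level n i) with ⟨a, ha | ha⟩
  · refine ⟨⟨p + 1, by omega⟩, ?_, ?_, ?_, ?_⟩
    · simp [Fin.ext_iff]
    · simp only; omega
    · simp only; omega
    · intro q' h1 h2 h3
      rw [Ne, Fin.ext_iff] at h1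
      rw [Fin.ext_iff]; simp only; omega
  · refine ⟨⟨p - 1, by omega⟩, ?_, ?_, ?_, ?_⟩
    · rw [Ne, Fin.ext_iff]; simp only; omega
    · simp only; omega
    · simp only; omega
    · intro q' h1 h2 h3
      rw [Ne, Fin.ext_iff] at h1
      rw [Fin.ext_iff]; simp only; omega

/-- The diagram `t_σ`: its propagating lines connect the northern node `σ(p)` to the southern node
`p`, for the `n_i` leftmost nodes `p`, and the remaining northern, respectively southern, nodes are
connected in pairs of neighbours by arcs. -/
def permDiagram (i : Fin (n / 2 + 1)) (σ : Equiv.Perm (Fin (level n i))) : BrauerDiagram n where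
  rel := Setoid.ker (Sum.elim (permLabel i 1 true) (permLabel i σ false))
  existsUnique_partner := by
    have hn := level_add (n := n) i
    rintro (p | p) <;> by_cases hp : (p : ℕ) < level n i
    · refine ⟨Sum.inr ⟨σ⁻¹ ⟨p, hp⟩, by omega⟩, ⟨by simp, ?_⟩, ?_⟩
      · exact (permLabel_eq_iff _ _ _ _ _ _ _).2 (Or.inl ⟨hp, (σ⁻¹ ⟨p, hp⟩).2, by simp⟩)
      · rintro (q | q) ⟨h1, h2⟩
        · rcases (permLabel_eq_iff _ _ _ _ _ _ _).1 h2 with ⟨_, hq, h⟩ | ⟨h, -⟩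
          · exact absurd (congrArg Sum.inl (Fin.ext (show (q : ℕ) = p from
              (Fin.ext_iff.1 h).symm))) h1
          · omega
        · rcases (permLabel_eq_iff _ _ _ _ _ _ _).1 h2 with ⟨_, hq, h⟩ | ⟨h, -⟩
          · congr 1
            rw [Fin.ext_iff]
            have h3 : σ⁻¹ ⟨p, hp⟩ = ⟨q, hq⟩ := by
              rw [Equiv.Perm.inv_eq_iff_eq, ← h]; rfl
            exact (Fin.ext_iff.1 h3).symm
          · omega
    · obtain ⟨q, h1, h2, h3, h4⟩ := exists_neighbour i p (by omega)
      refine ⟨Sum.inl q, ⟨fun h => h1 (Sum.inl_injective h), ?_⟩, ?_⟩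
      · exact (permLabel_eq_iff _ _ _ _ _ _ _).2 (Or.inr ⟨by omega, h2, rfl, h3⟩)
      · rintro (q' | q') ⟨h1', h2'⟩ <;>
          rcases (permLabel_eq_iff _ _ _ _ _ _ _).1 h2' with ⟨h, -⟩ | ⟨-, h, hb, h'⟩
        · omega
        · exact congrArg Sum.inl (h4 q' (fun h => h1' (congrArg Sum.inl h)) h h')
        · omega
        · cases hb
    · refine ⟨Sum.inl ⟨σ ⟨p, hp⟩, by omega⟩, ⟨by simp, ?_⟩, ?_⟩
      · exact (permLabel_eq_iff _ _ _ _ _ _ _).2 (Or.inl ⟨hp, (σ ⟨p, hp⟩).2, rfl⟩)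
      · rintro (q | q) ⟨h1, h2⟩
        · rcases (permLabel_eq_iff _ _ _ _ _ _ _).1 h2 with ⟨_, hq, h⟩ | ⟨h, -⟩
          · congr 1
            rw [Fin.ext_iff]
            exact (Fin.ext_iff.1 h).symm
          · omega
        · rcases (permLabel_eq_iff _ _ _ _ _ _ _).1 h2 with ⟨_, hq, h⟩ | ⟨h, -⟩
          · have := Fin.ext_iff.1 (σ.injective h)
            exact absurd (congrArg Sum.inr (Fin.ext (show (q : ℕ) = p from this.symm))) h1
          · omega
    · obtain ⟨q, h1, h2, h3, h4⟩ := exists_neighbour i p (by omega)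
      refine ⟨Sum.inr q, ⟨fun h => h1 (Sum.inr_injective h), ?_⟩, ?_⟩
      · exact (permLabel_eq_iff _ _ _ _ _ _ _).2 (Or.inr ⟨by omega, h2, rfl, h3⟩)
      · rintro (q' | q') ⟨h1', h2'⟩ <;>
          rcases (permLabel_eq_iff _ _ _ _ _ _ _).1 h2' with ⟨h, -⟩ | ⟨-, h, hb, h'⟩
        · omega
        · cases hb
        · omega
        · exact congrArg Sum.inr (h4 q' (fun h => h1' (congrArg Sum.inr h)) h h')

theorem permDiagram_mul (i : Fin (n / 2 + 1)) (σ τ : Equiv.Perm (Fin (level n i))) :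
    permDiagram i σ * permDiagram i τ = permDiagram i (σ * τ) := by
  have hn := level_add (n := n) i
  have key : ∀ p q : Fin n, permLabel i 1 true p = permLabel i (σ * τ) false q →
      concat (permDiagram i σ) (permDiagram i τ) (0, p) (2, q) := by
    intro p q h
    rcases (permLabel_eq_iff _ _ _ _ _ _ _).1 h with ⟨hp, hq, h⟩ | ⟨-, -, hb, -⟩
    · set r : Fin n := ⟨τ ⟨q, hq⟩, by omega⟩ with hr
      refine Setoid.trans' _ (y := (1, r)) ?_ ?_
      · exact concat_upper (permDiagram i σ) (permDiagram i τ) (u := Sum.inl p) (v := Sum.inr r)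
          ((permLabel_eq_iff _ _ _ _ _ _ _).2 (Or.inl ⟨hp, (τ ⟨q, hq⟩).2, h⟩))
      · exact concat_lower (permDiagram i σ) (permDiagram i τ) (u := Sum.inl r) (v := Sum.inr q)
          ((permLabel_eq_iff _ _ _ _ _ _ _).2 (Or.inl ⟨(τ ⟨q, hq⟩).2, hq, rfl⟩))
    · cases hb
  refine (eq_of_le ?_).symm
  rintro (p | p) (q | q) h
  · exact concat_upper (permDiagram i σ) (permDiagram i τ) (u := Sum.inl p) (v := Sum.inl q) h
  · exact key p q h
  · exact Setoid.symm' (concat _ _) (key q p h.symm)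
  · refine concat_lower (permDiagram i σ) (permDiagram i τ) (u := Sum.inr p) (v := Sum.inr q) ?_
    refine (permLabel_eq_iff _ _ _ _ _ _ _).2 ?_
    rcases (permLabel_eq_iff _ _ _ _ _ _ _).1 h with ⟨hp, hq, h⟩ | h
    · exact Or.inl ⟨hp, hq, σ.injective h⟩
    · exact Or.inr h

theorem numCycles_permDiagram (i : Fin (n / 2 + 1)) (σ τ : Equiv.Perm (Fin (level n i))) :
    numCycles (permDiagram i σ) (permDiagram i τ) = n / 2 - i := by
  have hn := level_add (n := n) i
  set C := concat (permDiagram i σ) (permDiagram i τ) with hC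
  let F : Fin 3 × Fin n → Fin 3 × ℕ := fun x =>
    if (x.2 : ℕ) < level n i then (0, 0) else (x.1, (x.2 - level n i) / 2 + 1)
  have hF : C ≤ Setoid.ker F := by
    have hl : ∀ (a b : Fin 3) (ρ : Equiv.Perm (Fin (level n i))),
        (permDiagram i ρ).rel.map (place a b) ≤ Setoid.ker F := by
      intro a b ρ
      rw [SetoidAux.map_le_iff_le_comap]
      rintro (p | p) (q | q) h <;>
        rcases (permLabel_eq_iff _ _ _ _ _ _ _).1 h with ⟨hp, hq, h⟩ | ⟨hp, hq, hb, h⟩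
      all_goals first
        | cases hb; done
        | (simp only [Setoid.comap_rel, Setoid.ker_def, F, place, Sum.elim_inl, Sum.elim_inr]
           rw [if_pos hp, if_pos hq])
        | (simp only [Setoid.comap_rel, Setoid.ker_def, F, place, Sum.elim_inl, Sum.elim_inr]
           rw [if_neg (by omega), if_neg (by omega), h])
    exact sup_le (hl 0 1 σ) (hl 1 2 τ)
  have harc : ∀ p q : Fin n, level n i ≤ p → level n i ≤ q →
      (p - level n i) / 2 = (q - level n i) / 2 → C (1, p) (1, q) := fun p q hp hq h =>
    concat_upper (permDiagram i σ) (permDiagram i τ) (u := Sum.inr p) (v := Sum.inr q)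
      ((permLabel_eq_iff _ _ _ _ _ _ _).2 (Or.inr ⟨hp, hq, rfl, h⟩))
  let G : ℕ → Set (Fin 3 × Fin n) := fun a => F ⁻¹' {(1, a + 1)}
  have hG : {c ∈ C.classes | c ⊆ {x | x.1 = 1}} = G '' Set.Iio (n / 2 - i) := by
    have hcl : ∀ p : Fin n, level n i ≤ p →
        {x | C x (1, p)} = G ((p - level n i) / 2) := by
      intro p hp
      have hFp : F (1, p) = (1, (p - level n i) / 2 + 1) :=
        if_neg (not_lt.2 hp)
      ext x
      constructor
      · intro hx
        have := hF hx
        rw [Setoid.ker_def, hFp] at this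
        exact this
      · intro hx
        change F x = _ at hx
        obtain ⟨b, q⟩ := x
        by_cases hq : (q : ℕ) < level n i
        · simp [F, hq] at hx
        · simp only [F, hq, if_false, Prod.mk.injEq, Nat.add_right_cancel_iff] at hx
          obtain ⟨rfl, hx⟩ := hx
          exact harc q p (by omega) hp hx
    ext c
    constructor
    · rintro ⟨⟨⟨b, p⟩, rfl⟩, hc⟩
      obtain rfl : b = 1 := hc (Setoid.refl' C (b, p))
      have hp : level n i ≤ p := by
        by_contra hp
        push Not at hp
        have h0 : C ((0 : Fin 3), ⟨σ ⟨p, hp⟩, by omega⟩) (1, p) :=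
          concat_upper (permDiagram i σ) (permDiagram i τ)
            (u := Sum.inl ⟨σ ⟨p, hp⟩, by omega⟩) (v := Sum.inr p)
            ((permLabel_eq_iff _ _ _ _ _ _ _).2 (Or.inl ⟨(σ ⟨p, hp⟩).2, hp, rfl⟩))
        have h1 : (0 : Fin 3) = 1 := hc h0
        exact absurd h1 (by decide)
      refine ⟨(p - level n i) / 2, ?_, (hcl p hp).symm⟩
      have := p.2
      rw [Set.mem_Iio]; omega
    · rintro ⟨a, ha, rfl⟩
      rw [Set.mem_Iio] at ha
      have hp : level n i + 2 * a < n := by omega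
      have h2 : (level n i + 2 * a - level n i) / 2 = a := by omega
      have := hcl ⟨level n i + 2 * a, hp⟩ (by simp)
      simp only [h2] at this
      refine ⟨⟨_, this.symm⟩, ?_⟩
      rintro ⟨b, q⟩ hx
      change F (b, q) = _ at hx
      by_cases hq : (q : ℕ) < level n i
      · simp [F, hq] at hx
      · simp only [F, hq, if_false, Prod.mk.injEq] at hx
        exact hx.1
  rw [numCycles, ← hC, hG, Set.InjOn.ncard_image]
  · rw [Set.ncard_eq_toFinset_card']; simp
  · intro a ha b hb hab
    rw [Set.mem_Iio] at ha
    have hp : level n i + 2 * a < n := by omega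
    have h2 : (level n i + 2 * a - level n i) / 2 = a := by omega
    have hFa : F (1, ⟨level n i + 2 * a, hp⟩) = (1, a + 1) := by
      simp [F]
    have hmem : ((1 : Fin 3), (⟨level n i + 2 * a, hp⟩ : Fin n)) ∈ G b := by
      have : G a = G b := hab
      rw [← this]
      exact hFa
    change F _ = _ at hmem
    rw [hFa] at hmem
    simpa using hmem

/-- The idempotent diagram `e_i`. -/
def idem (i : Fin (n / 2 + 1)) : BrauerDiagram n := permDiagram i 1

theorem isIdempotentElem_idem (i : Fin (n / 2 + 1)) : IsIdempotentElem (idem (n := n) i) := by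
  rw [IsIdempotentElem, idem, permDiagram_mul, one_mul]

/-- The homomorphism `σ ↦ t_σ` from the symmetric group of degree `n_i` to `Γ_{e_i}` (it is an
isomorphism). -/
def permHom (i : Fin (n / 2 + 1)) :
    Equiv.Perm (Fin (level n i)) →* MaxSubgroup (isIdempotentElem_idem (n := n) i) :=
  MonoidHom.toHomUnits
    { toFun := fun σ => ⟨permDiagram i σ, (Subsemigroup.mem_corner_iff
        (isIdempotentElem_idem i)).2 ⟨by rw [idem, permDiagram_mul, one_mul],
          by rw [idem, permDiagram_mul, mul_one]⟩⟩
      map_one' := rfl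
      map_mul' := fun σ τ => Subtype.ext (permDiagram_mul i σ τ).symm }

/-- The action of `𝔖_{n_i} × 𝔖_{n_j}` on `S_j ∩ e_i ∘ S ∘ e_j`. -/
instance (i j : Fin (n / 2 + 1)) :
    MulAction (Equiv.Perm (Fin (level n i)) × Equiv.Perm (Fin (level n j)))
      (HomSet (idem (n := n) i) (idem j)) :=
  letI := HomSet.mulAction (isIdempotentElem_idem (n := n) i) (isIdempotentElem_idem j)
  MulAction.compHom (HomSet (idem (n := n) i) (idem j)) ((permHom i).prodMap (permHom j))

variable {k : Type*} [Field k]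

/-- A `k_α Γ_{e_i}`-module, viewed as a representation of `𝔖_{n_i}` via the isomorphisms
`k 𝔖_{n_i} ≅ k Γ_{e_i} ≅ k_α Γ_{e_i}`, the second of which has the inverse `t ↦ δ ^ (d - i) · t`. -/
noncomputable def symmRep (δ : kˣ) (i : Fin (n / 2 + 1)) (V : Type*) [AddCommGroup V] [Module k V]
    [Module (GroupAlg (brauerCocycle n δ) (isIdempotentElem_idem i)) V]
    [IsScalarTower k (GroupAlg (brauerCocycle n δ) (isIdempotentElem_idem i)) V] :
    Representation k (Equiv.Perm (Fin (level n i))) V :=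
  (Algebra.lsmul k k V : GroupAlg (brauerCocycle n δ) (isIdempotentElem_idem i) →ₐ[k]
      Module.End k V).toMonoidHom.comp
    (TwistedAlgebra.untwist (permHom i) (δ ^ (n / 2 - (i : ℕ)))
      fun σ τ => congrArg (δ ^ ·) (numCycles_permDiagram i σ τ))

theorem level_eq {i j : Fin (n / 2 + 1)} (h : j < i) :
    level n j + ((i : ℕ) - j) * 2 = level n i := by
  have : (j : ℕ) < i := h
  unfold level; omega

/-- The embedding of `𝔖_{n_j} × 𝔖_2 × ⋯ × 𝔖_2` (with `i - j` factors `𝔖_2`) into `𝔖_{n_i}` as the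
standard Young subgroup. -/
def youngHom {i j : Fin (n / 2 + 1)} (h : j < i) :
    Equiv.Perm (Fin (level n j)) × (Fin ((i : ℕ) - j) → Equiv.Perm (Fin 2)) →*
      Equiv.Perm (Fin (level n i)) :=
  ((Equiv.permCongrHom <|
      ((Equiv.refl _).sumCongr ((Equiv.sigmaEquivProd _ _).trans finProdFinEquiv)).trans
        (finSumFinEquiv.trans (finCongr (level_eq h)))).toMonoidHom.comp
    (Equiv.Perm.sumCongrHom (Fin (level n j)) (Σ _ : Fin ((i : ℕ) - j), Fin 2))).comp
    ((MonoidHom.id _).prodMap (Equiv.Perm.sigmaCongrRightHom fun _ => Fin 2))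

/-- The representation of `𝔖_{n_i}` induced from the representation `V ⊗ k ⊗ ⋯ ⊗ k` of
`𝔖_{n_j} × 𝔖_2 × ⋯ × 𝔖_2`, where each factor `𝔖_2` acts trivially. -/
noncomputable def youngInd {i j : Fin (n / 2 + 1)} (h : j < i) {V : Type*} [AddCommGroup V]
    [Module k V] (ρ : Representation k (Equiv.Perm (Fin (level n j))) V) :=
  Representation.ind (youngHom h)
    (Representation.tprod (ρ.comp (MonoidHom.fst _ _)) (Representation.trivial k _ k))

end BrauerDiagram

end TwistedBrauer

/-! Everything about the monoid is governed by the number of propagating lines (`thr`). It cannot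
grow under products. The northern arcs of a diagram form an involution, and involutions moving
equally many points are conjugate, so two diagrams with equally many propagating lines differ only
by permutations of the northern and southern nodes. Hence every diagram is a permutation times some
`t_ρ` times a permutation (`exists_eq_extUnit_mul`). The `J`-classes are therefore the sets of
diagrams with `n_l` propagating lines, and `S_j ∩ e_i ∘ S ∘ e_j` is the orbit of `e_j`. The cocycle
values come from the cocycle identity itself: for the triple `(e_i, e_i, t)` it forces `m(e_i, t) =
m(e_i, e_i)`, and invertible diagrams create no cycles.

For (c), Frobenius reciprocity and Maschke's averaging translate "direct summand of the induced
representation" into `RestrictsTo`: there is a nonzero `𝔖_{n_j}`-map from `T_(j,s)` to the vectors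
of `T_(i,r)` fixed by the transpositions of the Young subgroup. On the other side, `e_i J_j e_j` is
spanned modulo `J_{j-1}` by the diagrams `σ e_j τ`. Since `f` and `g` are central, `f J_j g ⊄
J_{j-1}` means `f e_j g ∉ J_{j-1}`. The condition with `f` and `g` exchanged is equivalent:
reflecting diagrams inverts permutations, and central elements are fixed by inversion because a
permutation is conjugate to its inverse (`exists_notMem_spanLT_iff`).

The stabilizer of `e_j` in `𝔖_{n_i}` contains the transpositions of the pairs joined by arcs, so `⊏`
always implies `RestrictsTo` (`restrictsTo_of_notMem_spanLT`). The stabilizer also permutes these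
pairs among themselves, so the converse argument needs adjacent levels, where there is just one pair
(`notMem_spanLT_of_restrictsTo`). Passing to the transitive closure removes this discrepancy:
`RestrictsTo` is transitive, and between distant levels it factors through some simple module at
every level in between (`RestrictsTo.trans`, `RestrictsTo.exists_intermediate`). -/

namespace TwistedBrauer

/-! ### Block idempotents of semisimple rings -/

section Blocks

variable {R : Type*} [Ring R]

/-- Evaluation at `x` restricts to a map from each simple left ideal in `s` to `N`, which vanishes
by Schur's lemma. -/
theorem smul_eq_zero_of_mem_sSup_simple {N : Type*} [AddCommGroup N] [Module R N]
    [IsSimpleModule R N] {s : Set (Submodule R R)}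
    (hs : ∀ m ∈ s, IsSimpleModule R m ∧ IsEmpty (m ≃ₗ[R] N)) {b : R} (hb : b ∈ sSup s) (x : N) :
    b • x = 0 := by
  have hle : sSup s ≤ LinearMap.ker (LinearMap.toSpanSingleton R N x) := by
    refine sSup_le fun m hm => ?_
    obtain ⟨hsimple, hempty⟩ := hs m hm
    rcases LinearMap.bijective_or_eq_zero ((LinearMap.toSpanSingleton R N x).comp m.subtype)
      with h | h
    · exact (hempty.false (LinearEquiv.ofBijective _ h)).elim
    · intro c hc
      exact LinearMap.congr_fun h ⟨c, hc⟩
  exact hle hb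

/-- The simple left ideals span the regular module, so an element is determined by its action on
them: compare the two products with `1`. -/
theorem eq_of_forall_simple_smul_eq [IsSemisimpleRing R] {a b : R}
    (h : ∀ m : Submodule R R, IsSimpleModule R m → ∀ x : m, a • x = b • x) : a = b := by
  have key : ∀ x ∈ sSup {m : Submodule R R | IsSimpleModule R m}, a * x = b * x := by
    intro x hx
    rw [sSup_eq_iSup'] at hx
    induction hx using Submodule.iSup_induction' with
    | mem m x hx => exact congrArg Subtype.val (h m m.2 ⟨x, hx⟩)
    | zero => simp
    | add x y _ _ hx hy => rw [mul_add, mul_add, hx, hy]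
  have := key 1 (by rw [IsSemisimpleModule.sSup_simples_eq_top]; trivial)
  simpa using this

/-- In a semisimple ring, some element acts as the identity on a given simple module and as zero
on all the simple modules that are not isomorphic to it. -/
theorem exists_smul_eq_of_simple [IsSemisimpleRing R] (M : Type*) [AddCommGroup M] [Module R M]
    [IsSimpleModule R M] : ∃ a : R, (∀ x : M, a • x = x) ∧
      ∀ m : Submodule R R, IsSimpleModule R m → IsEmpty (m ≃ₗ[R] M) → ∀ x : m, a • x = 0 := by
  -- The wanted element is the component of `1` in the `M`-isotypic part `I`; `J` collects the other
  -- simple left ideals.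
  let I := sSup {m : Submodule R R | IsSimpleModule R m ∧ Nonempty (m ≃ₗ[R] M)}
  let J := sSup {m : Submodule R R | IsSimpleModule R m ∧ IsEmpty (m ≃ₗ[R] M)}
  have htop : I ⊔ J = ⊤ := by
    rw [eq_top_iff, ← IsSemisimpleModule.sSup_simples_eq_top R R]
    refine sSup_le fun m hm => ?_
    rcases isEmpty_or_nonempty (m ≃ₗ[R] M) with h | h
    · exact (le_sSup ⟨hm, h⟩ : m ≤ J).trans le_sup_right
    · exact (le_sSup ⟨hm, h⟩ : m ≤ I).trans le_sup_left
  obtain ⟨a, ha, b, hb, hab⟩ := Submodule.mem_sup.1 (htop ▸ Submodule.mem_top : (1 : R) ∈ I ⊔ J)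
  refine ⟨a, fun x => ?_, fun m hm hempty x => ?_⟩
  · have : b • x = 0 := smul_eq_zero_of_mem_sSup_simple (fun m hm => hm) hb x
    rw [← add_zero (a • x), ← this, ← add_smul, hab, one_smul]
  · refine smul_eq_zero_of_mem_sSup_simple ?_ ha x
    rintro m' ⟨hm', ⟨e'⟩⟩
    exact ⟨hm', ⟨fun e => hempty.false (e.symm.trans e')⟩⟩

/-- A nonzero element of a semisimple module has a nonzero image under a projection onto some
simple submodule of the module that it generates. -/
theorem exists_simple_projection {X : Type*} [AddCommGroup X] [Module R X]
    [IsSemisimpleModule R X] {y : X} (hy : y ≠ 0) :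
    ∃ (m : Submodule R X) (p : X →ₗ[R] m), IsSimpleModule R m ∧ m ≤ R ∙ y ∧ p y ≠ 0 ∧
      ∀ x : m, p x = x := by
  rcases IsSemisimpleModule.eq_bot_or_exists_simple_le (R ∙ y) with h | ⟨m, hm, hs⟩
  · exact (hy (Submodule.span_singleton_eq_bot.1 h)).elim
  · obtain ⟨q, hq⟩ := exists_isCompl m
    refine ⟨m, m.projectionOnto q hq, hs, hm, fun h => ?_, fun x => ?_⟩
    · rw [Submodule.projectionOnto_apply_eq_zero_iff] at h
      -- If the projection killed `y`, the complement `q` would contain `R ∙ y` and with it `m`.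
      have hmq : m ≤ q := hm.trans ((Submodule.span_singleton_le_iff_mem _ _).2 h)
      have hbot : m = ⊥ := by
        rw [eq_bot_iff, ← hq.inf_eq_bot]
        exact le_inf le_rfl hmq
      have := IsSimpleModule.nontrivial R m
      rw [Submodule.nontrivial_iff_ne_bot] at this
      exact this hbot
    · exact Submodule.projectionOnto_apply_left hq x

variable {M : Type*} [AddCommGroup M] [Module R M]

/-- The element acts as `0` or `1` on each simple left ideal, and in a semisimple ring both
identities may be checked there. -/
theorem central_idempotent_of_exists [IsSemisimpleRing R] {a : R} (h₁ : ∀ x : M, a • x = x)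
    (h₂ : ∀ m : Submodule R R, IsSimpleModule R m → IsEmpty (m ≃ₗ[R] M) → ∀ x : m, a • x = 0) :
    a ∈ Subring.center R ∧ IsIdempotentElem a := by
  have h₃ : ∀ m : Submodule R R, Nonempty (m ≃ₗ[R] M) → ∀ x : m, a • x = x := by
    rintro m ⟨e⟩ x
    apply e.injective
    rw [map_smul, h₁]
  constructor
  · rw [Subring.mem_center_iff]
    refine fun r => eq_of_forall_simple_smul_eq fun m hm x => ?_
    rcases isEmpty_or_nonempty (m ≃ₗ[R] M) with h | h
    · rw [mul_smul, mul_smul, h₂ m hm h, h₂ m hm h, smul_zero]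
    · rw [mul_smul, mul_smul, h₃ m h, h₃ m h]
  · refine eq_of_forall_simple_smul_eq fun m hm x => ?_
    rcases isEmpty_or_nonempty (m ≃ₗ[R] M) with h | h
    · rw [mul_smul, h₂ m hm h, h₂ m hm h]
    · rw [mul_smul, h₃ m h]

variable [IsSimpleModule R M]

/-- A central element acts by an endomorphism, which is zero or surjective by Schur's lemma; a
surjective idempotent map is the identity. -/
theorem smul_eq_or_of_central {a : R} (ha : a ∈ Subring.center R) (hi : IsIdempotentElem a) :
    (∀ x : M, a • x = 0) ∨ ∀ x : M, a • x = x := by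
  let f : M →ₗ[R] M :=
    { toFun := fun x => a • x
      map_add' := smul_add a
      map_smul' := fun r x => by
        rw [RingHom.id_apply, smul_smul, smul_smul, Subring.mem_center_iff.1 ha r] }
  rcases LinearMap.surjective_or_eq_zero f with h | h
  · refine Or.inr fun x => ?_
    obtain ⟨y, rfl⟩ := h x
    change a • a • y = a • y
    rw [smul_smul, hi.eq]
  · exact Or.inl fun x => LinearMap.congr_fun h x

theorem IsBlockIdempotent.smul_eq {f : R} (hf : IsBlockIdempotent M f) (x : M) : f • x = x := by
  rcases smul_eq_or_of_central (M := M) hf.central hf.idempotent with h | h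
  · obtain ⟨m, hm⟩ := hf.acts
    exact (hm (h m)).elim
  · exact h x

variable [IsSemisimpleRing R]

-- The element `a` acting as the identity on the `M`-isotypic part is primitive: a central
-- idempotent `g` with `g * a = g` vanishes on the other simple left ideals and is `0` or `1` on
-- those isomorphic to `M`.
variable (M) in
theorem exists_isBlockIdempotent : ∃ f : R, IsBlockIdempotent M f := by
  obtain ⟨a, h₁, h₂⟩ := exists_smul_eq_of_simple (R := R) M
  obtain ⟨hc, hi⟩ := central_idempotent_of_exists h₁ h₂
  have := IsSimpleModule.nontrivial R M
  obtain ⟨x, hx⟩ := exists_ne (0 : M)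
  refine ⟨a, hi, hc, fun h => hx ?_, fun g hg hgi hga => ?_, x, by rwa [h₁]⟩
  · rw [← h₁ x, h, zero_smul]
  · rcases smul_eq_or_of_central (M := M) hg hgi with h | h
    · left
      refine eq_of_forall_simple_smul_eq fun m hm y => ?_
      rcases isEmpty_or_nonempty (m ≃ₗ[R] M) with h' | ⟨⟨e⟩⟩
      · rw [← hga, mul_smul, h₂ m hm h', smul_zero, zero_smul]
      · apply e.injective
        rw [map_smul, h, zero_smul, map_zero]
    · right
      refine eq_of_forall_simple_smul_eq fun m hm y => ?_
      rcases isEmpty_or_nonempty (m ≃ₗ[R] M) with h' | ⟨⟨e⟩⟩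
      · rw [← hga, mul_smul, h₂ m hm h', smul_zero]
      · apply e.injective
        rw [map_smul, map_smul, h, h₁]

/-- A simple module on which the block idempotent of `M` does not act by zero is isomorphic
to `M`. -/
theorem IsBlockIdempotent.nonempty_equiv {f : R} (hf : IsBlockIdempotent M f) {N : Type*}
    [AddCommGroup N] [Module R N] [IsSimpleModule R N] {x : N} (hx : f • x ≠ 0) :
    Nonempty (N ≃ₗ[R] M) := by
  obtain ⟨a, h₁, h₂⟩ := exists_smul_eq_of_simple (R := R) M
  obtain ⟨hc, hi⟩ := central_idempotent_of_exists h₁ h₂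
  have haf : Commute a f := (Subring.mem_center_iff.1 hc f).symm
  -- Primitivity leaves `a * f = 0` or `a * f = f`. The first is impossible because `a` is the
  -- identity on `M` and `f` is not zero there. So `f` kills whatever simple modules `a` kills.
  rcases hf.primitive (a * f) (mul_mem hc hf.central)
    (IsIdempotentElem.mul_of_commute haf hi hf.idempotent)
    (by rw [mul_assoc, hf.idempotent.eq]) with h | h
  · obtain ⟨y, hy⟩ := hf.acts
    exact (hy (by rw [← h₁ (f • y), smul_smul, h, zero_smul])).elim
  · obtain ⟨m, ⟨e⟩⟩ := IsSemisimpleRing.exists_linearEquiv_ideal_of_isSimpleModule R N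
    have hm : IsSimpleModule R m := IsSimpleModule.congr e.symm
    rcases isEmpty_or_nonempty (m ≃ₗ[R] M) with h' | ⟨⟨e'⟩⟩
    · refine (hx (e.injective ?_)).elim
      rw [← h, mul_smul, map_smul, h₂ m hm h', map_zero]
    · exact ⟨e.trans e'⟩

/-- A projection onto a simple submodule that does not kill `f • y` has a target on which `f` is
nonzero, that is, a copy of `M`. Its inclusion and the projection give the two maps. -/
theorem IsBlockIdempotent.exists_maps {f : R} (hf : IsBlockIdempotent M f) {X : Type*}
    [AddCommGroup X] [Module R X] {y : X} (hy : f • y ≠ 0) :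
    (∃ φ : M →ₗ[R] X, φ ≠ 0) ∧ ∃ ψ : X →ₗ[R] M, Function.Surjective ψ := by
  obtain ⟨m, p, hs, hle, hp, hpm⟩ := exists_simple_projection (R := R) hy
  obtain ⟨e⟩ := hf.nonempty_equiv (x := p y) (by
    rwa [map_smul] at hp)
  refine ⟨⟨m.subtype.comp e.symm.toLinearMap, fun h => ?_⟩, e.toLinearMap.comp p, ?_⟩
  · have := IsSimpleModule.nontrivial R M
    obtain ⟨x, hx⟩ := exists_ne (0 : M)
    have := LinearMap.congr_fun h x
    apply hx
    simpa using this
  · exact e.surjective.comp fun x => ⟨x, hpm x⟩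

/-- An element outside of a left ideal that lies in a block is detected by a vector of the simple
module of the block that is annihilated by the left ideal. -/
theorem IsBlockIdempotent.exists_annihilated {f : R} (hf : IsBlockIdempotent M f)
    {N : Submodule R R} (hN : f ∉ N) : ∃ v : M, v ≠ 0 ∧ ∀ b ∈ N, b • v = 0 := by
  -- The class of `1` in `R ⧸ N` is not killed by `f`, so `R ⧸ N` maps onto `M`; the image of that
  -- class generates `M` and is annihilated by `N`.
  have h : f • N.mkQ 1 ≠ 0 := by
    rwa [← map_smul, smul_eq_mul, mul_one, Submodule.mkQ_apply, Ne, Submodule.Quotient.mk_eq_zero]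
  obtain ⟨-, ψ, hψ⟩ := hf.exists_maps h
  have hb : ∀ b, b • ψ (N.mkQ 1) = ψ (N.mkQ b) := fun b => by
    rw [← map_smul, ← map_smul, smul_eq_mul, mul_one]
  refine ⟨ψ (N.mkQ 1), fun h0 => ?_, fun b hbN => ?_⟩
  · have := IsSimpleModule.nontrivial R M
    obtain ⟨x, hx⟩ := exists_ne (0 : M)
    obtain ⟨y, rfl⟩ := hψ x
    obtain ⟨b, rfl⟩ := N.mkQ_surjective y
    rw [← hb, h0, smul_zero] at hx
    exact hx rfl
  · rw [hb, Submodule.mkQ_apply, (Submodule.Quotient.mk_eq_zero N).2 hbN, map_zero]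

end Blocks

end TwistedBrauer

namespace TwistedBrauer

namespace BrauerDiagram

variable {n : ℕ}

/-! ### Partners and relabellings -/

/-- The other end of the edge at a node. -/
noncomputable def partner (t : BrauerDiagram n) (x : Fin n ⊕ Fin n) : Fin n ⊕ Fin n :=
  (t.existsUnique_partner x).choose

theorem partner_ne (t : BrauerDiagram n) (x : Fin n ⊕ Fin n) : t.partner x ≠ x :=
  (t.existsUnique_partner x).choose_spec.1.1

theorem rel_partner (t : BrauerDiagram n) (x : Fin n ⊕ Fin n) : t.rel x (t.partner x) :=
  (t.existsUnique_partner x).choose_spec.1.2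

theorem rel_iff (t : BrauerDiagram n) {x y : Fin n ⊕ Fin n} :
    t.rel x y ↔ y = x ∨ y = t.partner x := by
  constructor
  · intro h
    by_cases hy : y = x
    · exact Or.inl hy
    · exact Or.inr ((t.existsUnique_partner x).choose_spec.2 y ⟨hy, h⟩)
  · rintro (rfl | rfl)
    · exact t.rel.refl' _
    · exact t.rel_partner x

theorem eq_of_rel {t : BrauerDiagram n} {x y z : Fin n ⊕ Fin n} (hy : y ≠ x) (hz : z ≠ x)
    (hxy : t.rel x y) (hxz : t.rel x z) : y = z :=
  (t.existsUnique_partner x).unique ⟨hy, hxy⟩ ⟨hz, hxz⟩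

/-- The diagram obtained by a permutation of the nodes. -/
def relabel (e : Equiv.Perm (Fin n ⊕ Fin n)) (t : BrauerDiagram n) : BrauerDiagram n where
  rel := t.rel.comap e
  existsUnique_partner x := by
    obtain ⟨y, ⟨h1, h2⟩, h3⟩ := t.existsUnique_partner (e x)
    refine ⟨e.symm y, ⟨fun h => h1 ?_, ?_⟩, fun z hz => ?_⟩
    · rw [← h, e.apply_symm_apply]
    · rw [Setoid.comap_rel, e.apply_symm_apply]
      exact h2
    · rw [e.eq_symm_apply]
      exact h3 _ ⟨fun h => hz.1 (e.injective h), hz.2⟩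

/-- The reflection of a diagram that exchanges its northern and southern nodes. -/
def flip (t : BrauerDiagram n) : BrauerDiagram n := relabel (Equiv.sumComm _ _) t

theorem flip_rel (t : BrauerDiagram n) (x y : Fin n ⊕ Fin n) :
    t.flip.rel x y ↔ t.rel x.swap y.swap := Iff.rfl

theorem flip_flip (t : BrauerDiagram n) : t.flip.flip = t := by
  apply ext_rel
  ext x y
  rw [flip_rel, flip_rel, Sum.swap_swap, Sum.swap_swap]

theorem flip_injective : Function.Injective (flip : BrauerDiagram n → BrauerDiagram n) :=
  Function.LeftInverse.injective flip_flip

/-- Turning the stack upside down exchanges layers `0` and `2`. One inclusion suffices, since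
comparable diagrams are equal by `eq_of_le`. -/
theorem flip_mul (a b : BrauerDiagram n) : (a * b).flip = b.flip * a.flip := by
  have hpl : ∀ (x : Fin n ⊕ Fin n),
      lay ![2, 1, 0] (place (0 : Fin 3) 1 x) = place (1 : Fin 3) 2 x.swap ∧
      lay ![2, 1, 0] (place (1 : Fin 3) 2 x) = place (0 : Fin 3) 1 x.swap ∧
      lay ![2, 1, 0] (place (0 : Fin 3) 2 x.swap) = place (0 : Fin 3) 2 x := by
    rintro (p | p) <;> exact ⟨rfl, rfl, rfl⟩
  have hle : concat a b ≤ (concat b.flip a.flip).comap (lay ![2, 1, 0]) := by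
    refine sup_le (SetoidAux.map_le_iff_le_comap.2 fun x y h => ?_)
      (SetoidAux.map_le_iff_le_comap.2 fun x y h => ?_)
    · rw [Setoid.comap_rel, Setoid.comap_rel, (hpl x).1, (hpl y).1]
      apply concat_lower
      rwa [flip_rel, Sum.swap_swap, Sum.swap_swap]
    · rw [Setoid.comap_rel, Setoid.comap_rel, (hpl x).2.1, (hpl y).2.1]
      apply concat_upper
      rwa [flip_rel, Sum.swap_swap, Sum.swap_swap]
  refine eq_of_le fun x y h => ?_
  have := hle (show concat a b (place 0 2 x.swap) (place 0 2 y.swap) from h)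
  rwa [Setoid.comap_rel, (hpl x).2.2, (hpl y).2.2] at this

theorem mul_rel_inl (t s : BrauerDiagram n) {p q : Fin n} (h : t.rel (.inl p) (.inl q)) :
    (t * s).rel (.inl p) (.inl q) :=
  concat_upper t s (u := .inl p) (v := .inl q) h

/-- The invertible diagram whose edges connect the northern node `σ p` to the southern node
`p`. -/
def unitDiagram (σ : Equiv.Perm (Fin n)) : BrauerDiagram n :=
  relabel (Equiv.sumCongr 1 σ) (idDiagram n)

/-- In the concatenation, each southern node is joined by a line of the permutation to its
relabelled counterpart in the middle layer, so only the southern ends move. -/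
theorem mul_unitDiagram (t : BrauerDiagram n) (σ : Equiv.Perm (Fin n)) :
    t * unitDiagram σ = relabel (Equiv.sumCongr 1 σ) t := by
  refine (eq_of_le fun x y h => ?_).symm
  have key : ∀ x : Fin n ⊕ Fin n, concat t (unitDiagram σ) (place 0 2 x)
      (place 0 1 (Equiv.sumCongr 1 σ x)) := by
    rintro (p | p)
    · exact Setoid.refl' _ _
    · exact Setoid.symm' _ (concat_lower t (unitDiagram σ) (u := .inl (σ p)) (v := .inr p) rfl)
  exact Setoid.trans' (concat _ _) (key x) (Setoid.trans' _ 
    (concat_upper _ (unitDiagram σ) (u := Equiv.sumCongr 1 σ x) (v := Equiv.sumCongr 1 σ y) h)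
    (Setoid.symm' (concat _ _) (key y)))

theorem flip_unitDiagram (σ : Equiv.Perm (Fin n)) :
    (unitDiagram σ).flip = unitDiagram σ⁻¹ := by
  refine eq_of_le ?_
  rintro (p | p) (q | q) h
  · obtain rfl : p = q := σ.injective h
    exact Setoid.refl' _ _
  · change σ p = q at h
    change p = σ⁻¹ q
    simp [← h]
  · change p = σ q at h
    change σ⁻¹ p = q
    simp [h]
  · obtain rfl : p = q := h
    exact Setoid.refl' _ _

theorem unitDiagram_mul (σ : Equiv.Perm (Fin n)) (t : BrauerDiagram n) :
    unitDiagram σ * t = relabel (Equiv.sumCongr σ⁻¹ 1) t := by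
  apply flip_injective
  rw [flip_mul, flip_unitDiagram, mul_unitDiagram]
  refine eq_of_le ?_
  rintro (p | p) (q | q) h <;> exact h

/-- Invertible diagrams as a homomorphism from the symmetric group. -/
def unitHom (n : ℕ) : Equiv.Perm (Fin n) →* BrauerDiagram n where
  toFun := unitDiagram
  map_one' := by
    refine eq_of_le ?_
    rintro (p | p) (q | q) h <;> exact h
  map_mul' σ τ := by
    rw [mul_unitDiagram]
    refine eq_of_le ?_
    rintro (p | p) (q | q) h <;> exact h

theorem unitHom_mul_rel_inl (σ : Equiv.Perm (Fin n)) (t : BrauerDiagram n) (p q : Fin n) :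
    (unitHom n σ * t).rel (.inl p) (.inl q) ↔ t.rel (.inl (σ⁻¹ p)) (.inl (σ⁻¹ q)) := by
  change (unitDiagram σ * t).rel _ _ ↔ _
  rw [unitDiagram_mul]
  rfl

theorem flip_unitHom (σ : Equiv.Perm (Fin n)) : (unitHom n σ).flip = unitHom n σ⁻¹ :=
  flip_unitDiagram σ

theorem unitHom_inv_mul_cancel_left (σ : Equiv.Perm (Fin n)) (t : BrauerDiagram n) :
    unitHom n σ⁻¹ * (unitHom n σ * t) = t := by
  rw [← mul_assoc, ← map_mul, inv_mul_cancel, map_one, one_mul]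

theorem mul_unitHom_inv_cancel_right (σ : Equiv.Perm (Fin n)) (t : BrauerDiagram n) :
    t * unitHom n σ * unitHom n σ⁻¹ = t := by
  rw [mul_assoc, ← map_mul, mul_inv_cancel, map_one, mul_one]

/-- Each middle node is joined to a northern node, so no component stays inside the middle layer. -/
theorem numCycles_unitHom_left (σ : Equiv.Perm (Fin n)) (t : BrauerDiagram n) :
    numCycles (unitHom n σ) t = 0 := by
  rw [numCycles, Set.ncard_eq_zero]
  refine Set.eq_empty_of_forall_notMem ?_
  rintro c ⟨⟨⟨a, p⟩, rfl⟩, hc⟩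
  obtain rfl : a = 1 := hc (Setoid.refl' (concat (unitHom n σ) t) (a, p))
  have h : concat (unitHom n σ) t (0, σ p) (1, p) :=
    concat_upper (unitHom n σ) t (u := .inl (σ p)) (v := .inr p) rfl
  have h' : (0 : Fin 3) = 1 := hc h
  exact absurd h' (by decide)

theorem numCycles_unitHom_right (σ : Equiv.Perm (Fin n)) (t : BrauerDiagram n) :
    numCycles t (unitHom n σ) = 0 := by
  rw [numCycles, Set.ncard_eq_zero]
  refine Set.eq_empty_of_forall_notMem ?_
  rintro c ⟨⟨⟨a, p⟩, rfl⟩, hc⟩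
  obtain rfl : a = 1 := hc (Setoid.refl' (concat t (unitHom n σ)) (a, p))
  have h : concat t (unitHom n σ) (1, p) (2, σ⁻¹ p) :=
    concat_lower t (unitHom n σ) (u := .inl p) (v := .inr (σ⁻¹ p))
      ((Equiv.apply_symm_apply σ p).symm)
  have h' : (2 : Fin 3) = 1 := hc (Setoid.symm' _ h)
  exact absurd h' (by decide)

theorem numCycles_assoc (u t s : BrauerDiagram n) :
    numCycles (u * t) s + numCycles u t = numCycles u (t * s) + numCycles t s :=
  (numCycles_left u t s).symm.trans (numCycles_right u t s)

/-! ### The number of propagating lines -/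

/-- The number of propagating lines of a diagram. -/
noncomputable def thr (t : BrauerDiagram n) : ℕ := {p | ∃ q, t.rel (.inl p) (.inr q)}.ncard

/-- Northern arcs of `t` survive in `t * s`, so a northern node on a propagating line of the product
is already on one of `t`. -/
theorem thr_mul_le_left (t s : BrauerDiagram n) : thr (t * s) ≤ thr t := by
  refine Set.ncard_le_ncard (fun p hp => ?_) (Set.toFinite _)
  obtain ⟨q, hq⟩ := hp
  rcases h : t.partner (.inl p) with q' | q'
  · have h1 : t.rel (.inl p) (.inl q') := h ▸ t.rel_partner _
    have h2 : (Sum.inl q' : Fin n ⊕ Fin n) ≠ Sum.inl p := h ▸ t.partner_ne _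
    exact absurd (eq_of_rel (by simp) h2 hq (mul_rel_inl t s h1)) (by simp)
  · exact ⟨q', h ▸ t.rel_partner _⟩

theorem thr_flip (t : BrauerDiagram n) : thr t.flip = thr t := by
  have hle : ∀ t : BrauerDiagram n, thr t.flip ≤ thr t := by
    intro t
    have hex : ∀ p : Fin n, ∃ q, (∃ p', t.flip.rel (.inl p) (.inr p')) →
        t.rel (.inl q) (.inr p) := by
      -- The choice function sends the northern end of a propagating line to its southern end; off
      -- the propagating nodes its value is irrelevant.
      intro p
      by_cases hp : ∃ p', t.flip.rel (.inl p) (.inr p')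
      · obtain ⟨p', hp'⟩ := hp
        exact ⟨p', fun _ => t.rel.symm' hp'⟩
      · exact ⟨p, fun h => absurd h hp⟩
    choose f hf using hex
    refine Set.ncard_le_ncard_of_injOn f (fun p hp => ⟨p, hf p hp⟩) (fun p hp q hq h => ?_)
      (Set.toFinite _)
    have h1 := hf p hp
    have h2 := hf q hq
    rw [← h] at h2
    exact Sum.inr_injective (eq_of_rel (by simp) (by simp) h1 h2)
  refine le_antisymm (hle t) ?_
  simpa only [flip_flip] using hle t.flip

theorem thr_mul_le_right (t s : BrauerDiagram n) : thr (t * s) ≤ thr s := by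
  rw [← thr_flip, flip_mul, ← thr_flip s]
  exact thr_mul_le_left _ _

theorem thr_unitHom_mul (σ : Equiv.Perm (Fin n)) (t : BrauerDiagram n) :
    thr (unitHom n σ * t) = thr t := by
  refine le_antisymm (thr_mul_le_right _ _) ?_
  conv_lhs => rw [← unitHom_inv_mul_cancel_left σ t]
  exact thr_mul_le_right _ _

theorem thr_mul_unitHom (t : BrauerDiagram n) (σ : Equiv.Perm (Fin n)) :
    thr (t * unitHom n σ) = thr t := by
  refine le_antisymm (thr_mul_le_left _ _) ?_
  conv_lhs => rw [← mul_unitHom_inv_cancel_right σ t]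
  exact thr_mul_le_left _ _

theorem thr_le_of_twoSided_subset {s t : BrauerDiagram n} (h : twoSided s ⊆ twoSided t) :
    thr s ≤ thr t := by
  obtain ⟨a, b, hab⟩ := h ⟨1, 1, by rw [one_mul, mul_one]⟩
  rw [← hab]
  exact (thr_mul_le_left _ _).trans (thr_mul_le_right _ _)

theorem thr_eq_of_mem_jClass {s t : BrauerDiagram n} (h : s ∈ jClass t) : thr s = thr t :=
  have h' : twoSided s = twoSided t := h
  le_antisymm (thr_le_of_twoSided_subset h'.subset) (thr_le_of_twoSided_subset h'.superset)

/-! ### The idempotents `e_i` -/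

theorem level_le (i : Fin (n / 2 + 1)) : level n i ≤ n := by
  have := level_add (n := n) i
  omega

theorem level_mono {i j : Fin (n / 2 + 1)} : level n j ≤ level n i ↔ j ≤ i := by
  have h1 := level_add (n := n) i
  have h2 := level_add (n := n) j
  have h3 := i.2
  have h4 := j.2
  rw [Fin.le_def]
  omega

theorem level_strictMono {i j : Fin (n / 2 + 1)} : level n j < level n i ↔ j < i := by
  rw [← not_le, level_mono, not_le]

theorem level_last : level n (Fin.last _) = n := by
  simp [level]

theorem idem_rel_inl_inl (i : Fin (n / 2 + 1)) (p q : Fin n) :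
    (idem i).rel (.inl p) (.inl q) ↔ p = q ∨
      (level n i ≤ p ∧ level n i ≤ q ∧ (p - level n i) / 2 = (q - level n i) / 2) := by
  refine (permLabel_eq_iff _ _ _ _ _ _ _).trans ⟨?_, ?_⟩
  · rintro (⟨_, _, h⟩ | ⟨h1, h2, -, h3⟩)
    · exact Or.inl (Fin.ext (Fin.mk.inj_iff.1 h))
    · exact Or.inr ⟨h1, h2, h3⟩
  · rintro (rfl | ⟨h1, h2, h3⟩)
    · by_cases hp : (p : ℕ) < level n i
      · exact Or.inl ⟨hp, hp, rfl⟩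
      · exact Or.inr ⟨by omega, by omega, rfl, rfl⟩
    · exact Or.inr ⟨h1, h2, rfl, h3⟩

theorem idem_rel_inl_inr (i : Fin (n / 2 + 1)) (p q : Fin n) :
    (idem i).rel (.inl p) (.inr q) ↔ p = q ∧ (p : ℕ) < level n i := by
  refine (permLabel_eq_iff _ _ _ _ _ _ _).trans ⟨?_, ?_⟩
  · rintro (⟨h1, _, h⟩ | ⟨-, -, h, -⟩)
    · exact ⟨Fin.ext (Fin.mk.inj_iff.1 h), h1⟩
    · cases h
  · rintro ⟨rfl, h⟩
    exact Or.inl ⟨h, h, rfl⟩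

theorem permDiagram_flip (i : Fin (n / 2 + 1)) (σ : Equiv.Perm (Fin (level n i))) :
    (permDiagram i σ).flip = permDiagram i σ⁻¹ := by
  refine eq_of_le ?_
  rintro (p | p) (q | q) h <;>
    rcases (permLabel_eq_iff _ _ _ _ _ _ _).1 h with ⟨hp, hq, h⟩ | ⟨hp, hq, hb, h⟩ <;>
    refine (permLabel_eq_iff _ _ _ _ _ _ _).2 ?_
  · exact Or.inl ⟨hp, hq, σ.injective h⟩
  · exact Or.inr ⟨hp, hq, rfl, h⟩
  · refine Or.inl ⟨hp, hq, ?_⟩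
    rw [Equiv.Perm.eq_inv_iff_eq]
    exact h
  · cases hb
  · refine Or.inl ⟨hp, hq, ?_⟩
    rw [Equiv.Perm.inv_eq_iff_eq]
    exact h
  · cases hb
  · exact Or.inl ⟨hp, hq, congrArg _ h⟩
  · exact Or.inr ⟨hp, hq, rfl, h⟩

theorem flip_idem (i : Fin (n / 2 + 1)) : (idem (n := n) i).flip = idem i := by
  rw [idem, permDiagram_flip, inv_one]

/-- A diagram absorbs `e_i` from above if and only if it contains the northern arcs of `e_i`. -/
theorem idem_mul_eq_iff (i : Fin (n / 2 + 1)) (t : BrauerDiagram n) :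
    idem i * t = t ↔ ∀ p q : Fin n, level n i ≤ p → level n i ≤ q →
      (p - level n i) / 2 = (q - level n i) / 2 → t.rel (.inl p) (.inl q) := by
  constructor
  · intro h p q hp hq hpq
    rw [← h]
    exact mul_rel_inl _ _ ((idem_rel_inl_inl i p q).2 (Or.inr ⟨hp, hq, hpq⟩))
  · intro h
    have key : ∀ x : Fin n ⊕ Fin n, (∀ p, x = .inl p → (p : ℕ) < level n i) →
        concat (idem i) t (place 0 2 x) (place 1 2 x) := by
      rintro (p | p) hp
      · exact concat_upper (idem i) t (u := .inl p) (v := .inr p)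
          ((idem_rel_inl_inr i p p).2 ⟨rfl, hp p rfl⟩)
      · exact Setoid.refl' _ _
    -- Northern nodes from `n_i` on carry arcs of `e_i`, which persist in the product and by
    -- assumption are the arcs of `t` there. The other nodes are joined by `key` to their copies in
    -- `t`.
    have hbig : ∀ (p : Fin n) (y : Fin n ⊕ Fin n), level n i ≤ p → t.rel (.inl p) y →
        (idem i * t).rel (.inl p) y := by
      intro p y hp hy
      obtain ⟨q, h1, h2, h3, -⟩ := exists_neighbour i p hp
      by_cases hyp : y = .inl p
      · rw [hyp]
      · rw [eq_of_rel hyp (by simpa using h1) hy (h p q hp h2 h3)]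
        exact mul_rel_inl _ _ ((idem_rel_inl_inl i p q).2 (Or.inr ⟨hp, h2, h3⟩))
    refine (eq_of_le fun x y hxy => ?_).symm
    by_cases hx : ∀ p, x = .inl p → (p : ℕ) < level n i
    · by_cases hy : ∀ p, y = .inl p → (p : ℕ) < level n i
      · exact Setoid.trans' (concat _ _) (key x hx)
          (Setoid.trans' _ (concat_lower _ _ hxy) (Setoid.symm' (concat _ _) (key y hy)))
      · push Not at hy
        obtain ⟨p, rfl, hp⟩ := hy
        exact Setoid.symm' _ (hbig p x hp (Setoid.symm' _ hxy))
    · push Not at hx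
      obtain ⟨p, rfl, hp⟩ := hx
      exact hbig p y hp hxy

theorem mul_idem_eq_iff_flip (i : Fin (n / 2 + 1)) (t : BrauerDiagram n) :
    t * idem i = t ↔ idem i * t.flip = t.flip := by
  rw [← flip_injective.eq_iff, flip_mul, flip_idem]

theorem idem_mul_idem {i j : Fin (n / 2 + 1)} (h : j ≤ i) :
    idem (n := n) i * idem j = idem j := by
  rw [idem_mul_eq_iff]
  intro p q hp hq hpq
  rw [idem_rel_inl_inl]
  have h1 := level_add (n := n) i
  have h2 := level_add (n := n) j
  have h3 := level_mono.2 h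
  right
  refine ⟨by omega, by omega, by omega⟩

theorem idem_mul_idem' {i j : Fin (n / 2 + 1)} (h : j ≤ i) :
    idem (n := n) j * idem i = idem j := by
  rw [mul_idem_eq_iff_flip, flip_idem, idem_mul_idem h]

theorem idem_last : idem (n := n) (Fin.last _) = 1 := by
  have : idem (n := n) (Fin.last _) * 1 = 1 := by
    rw [idem_mul_eq_iff]
    intro p q hp
    rw [level_last] at hp
    omega
  rwa [mul_one] at this

theorem thr_idem (i : Fin (n / 2 + 1)) : thr (idem (n := n) i) = level n i := by
  have : {p : Fin n | ∃ q, (idem i).rel (.inl p) (.inr q)} =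
      Set.range (Fin.castLE (level_le i)) := by
    ext p
    simp only [idem_rel_inl_inr, Set.mem_ofPred_eq, Set.mem_range]
    constructor
    · rintro ⟨_, -, hp⟩
      exact ⟨⟨p, hp⟩, rfl⟩
    · rintro ⟨q, rfl⟩
      exact ⟨_, rfl, q.2⟩
  rw [thr, this, Set.ncard_range_of_injective (Fin.castLE_injective _), Nat.card_eq_fintype_card,
    Fintype.card_fin]

end BrauerDiagram

end TwistedBrauer

namespace TwistedBrauer

namespace BrauerDiagram

variable {n : ℕ}

/-! ### Normal forms of diagrams -/

-- All nontrivial cycles of an involution have length two, so the number of moved points determines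
-- its cycle type.
open Equiv in
theorem isConj_of_mul_self_eq_one {X : Type*} [Fintype X] [DecidableEq X] {w w' : Perm X}
    (h : w * w = 1) (h' : w' * w' = 1) (hc : w.support.card = w'.support.card) :
    IsConj w w' := by
  rw [← sq] at h h'
  have : Fact (Nat.Prime 2) := ⟨Nat.prime_two⟩
  have h1 := Perm.cycleType_of_pow_prime_eq_one h
  have h2 := Perm.cycleType_of_pow_prime_eq_one h'
  have h3 := w.sum_cycleType
  have h4 := w'.sum_cycleType
  rw [h1, Multiset.sum_replicate] at h3
  rw [h2, Multiset.sum_replicate] at h4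
  apply Perm.isConj_of_cycleType_eq
  rw [h1, h2]
  congr 1
  simp only [smul_eq_mul] at h3 h4
  omega

/-- The nodes from `n_i` on are paired among themselves by the arcs of `e_i`, so the northern arcs
of `t` at the first `n_i` nodes stay there. The fixed points of the resulting involution are the
ends of propagating lines, so `thr t` determines its conjugacy class. -/
theorem exists_northern_involution (i : Fin (n / 2 + 1)) (t : BrauerDiagram n)
    (h : idem i * t = t) : ∃ w : Equiv.Perm (Fin (level n i)), w * w = 1 ∧
      (∀ p q, t.rel (.inl (p.castLE (level_le i))) (.inl (q.castLE (level_le i))) ↔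
        q = p ∨ q = w p) ∧ w.support.card + thr t = level n i := by
  rw [idem_mul_eq_iff] at h
  set c : Fin (level n i) → Fin n := Fin.castLE (level_le i) with hc
  have hcinj : Function.Injective c := Fin.castLE_injective _
  have hbig : ∀ p : Fin n, level n i ≤ p → ∃ q : Fin n, level n i ≤ q ∧
      t.partner (.inl p) = .inl q := by
    intro p hp
    obtain ⟨q, h1, h2, h3, -⟩ := exists_neighbour i p hp
    exact ⟨q, h2, eq_of_rel (t.partner_ne _) (by simpa using h1) (t.rel_partner _)
      (h p q hp h2 h3)⟩
  have hpart : ∀ p : Fin (level n i), (∃ q, q ≠ p ∧ t.partner (.inl (c p)) = .inl (c q)) ∨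
      ∃ q, t.partner (.inl (c p)) = .inr q := by
    intro p
    rcases hq : t.partner (.inl (c p)) with q | q
    · left
      have hrel : t.rel (.inl (c p)) (.inl q) := hq ▸ t.rel_partner _
      have hne : q ≠ c p := fun h => t.partner_ne (.inl (c p)) (by rw [hq, h])
      have hlt : (q : ℕ) < level n i := by
        by_contra hlt
        obtain ⟨q', h1, h2⟩ := hbig q (by omega)
        have := eq_of_rel (t.partner_ne _) (by simpa using hne.symm) (t.rel_partner _)
          (t.rel.symm' hrel)
        rw [h2] at this
        have h3 : (q' : ℕ) = p := congrArg Fin.val (Sum.inl_injective this)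
        have := p.2
        omega
      exact ⟨⟨q, hlt⟩, fun h => hne (by rw [← h]; rfl), rfl⟩
    · exact Or.inr ⟨q, rfl⟩
  obtain ⟨w, hw, hwr⟩ := exists_perm_of_setoid (t.rel.comap fun p => .inl (c p)) (by
    intro p
    rcases hpart p with ⟨q, hq, hpq⟩ | ⟨q, hpq⟩
    · refine ⟨q, fun z => ?_⟩
      rw [Setoid.comap_rel, rel_iff, hpq, Sum.inl_injective.eq_iff, Sum.inl_injective.eq_iff,
        hcinj.eq_iff, hcinj.eq_iff]
    · refine ⟨p, fun z => ?_⟩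
      rw [Setoid.comap_rel, rel_iff, hpq, Sum.inl_injective.eq_iff, hcinj.eq_iff]
      simp)
  refine ⟨w, hw, hwr, ?_⟩
  have hset : {p : Fin n | ∃ q, t.rel (.inl p) (.inr q)} = c '' (w.supportᶜ : Finset _) := by
    ext p
    simp only [Set.mem_ofPred_eq, Set.mem_image, Finset.coe_compl, Set.mem_compl_iff,
      Finset.mem_coe, Equiv.Perm.mem_support, not_not]
    constructor
    · rintro ⟨q, hq⟩
      have hp : (p : ℕ) < level n i := by
        by_contra hp
        obtain ⟨q', -, h2⟩ := hbig p (by omega)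
        rcases t.rel_iff.1 hq with h3 | h3
        · cases h3
        · rw [h2] at h3; cases h3
      refine ⟨⟨p, hp⟩, ?_, rfl⟩
      by_contra hne
      have h1 := (hwr ⟨p, hp⟩ (w ⟨p, hp⟩)).2 (Or.inr rfl)
      rw [Setoid.comap_rel] at h1
      have := eq_of_rel (by simp) (fun h => hne (hcinj (Sum.inl_injective h))) hq h1
      cases this
    · rintro ⟨p, hp, rfl⟩
      rcases hpart p with ⟨q, hq, hpq⟩ | ⟨q, hpq⟩
      · have h1 : t.rel (.inl (c p)) (.inl (c q)) := hpq ▸ t.rel_partner _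
        rcases (hwr p q).1 h1 with h2 | h2
        · exact absurd h2 hq
        · exact absurd (h2.trans hp) hq
      · exact ⟨q, hpq ▸ t.rel_partner _⟩
  rw [thr, hset, Set.ncard_image_of_injective _ hcinj, Set.ncard_coe_finset,
    Finset.card_add_card_compl, Fintype.card_fin]

/-- An involution moves an even number `2 * m` of points; the `m` arcs correspond to the index `n /
2 - m`. -/
theorem exists_level_eq_thr (t : BrauerDiagram n) : ∃ i, thr t = level n i := by
  obtain ⟨w, hw, -, hcard⟩ := exists_northern_involution (Fin.last _) t
    (by rw [idem_last, one_mul])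
  have hlast := level_last (n := n)
  obtain ⟨m, hm⟩ := Equiv.Perm.two_dvd_card_support (by rw [sq, hw])
  refine ⟨⟨n / 2 - m, by omega⟩, ?_⟩
  unfold level
  simp only
  omega

/-- The extension of a permutation of the `n_j` leftmost nodes. -/
noncomputable def extHom {a b : ℕ} (h : a ≤ b) : Equiv.Perm (Fin a) →* Equiv.Perm (Fin b) :=
  Equiv.Perm.viaEmbeddingHom (Fin.castLEEmb h)

theorem extHom_castLE {a b : ℕ} (h : a ≤ b) (σ : Equiv.Perm (Fin a)) (p : Fin a) :
    extHom h σ (p.castLE h) = (σ p).castLE h :=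
  Equiv.Perm.viaEmbedding_apply σ (Fin.castLEEmb h) p

theorem extHom_of_lt {a b : ℕ} (h : a ≤ b) (σ : Equiv.Perm (Fin a)) (p : Fin b)
    (hp : (p : ℕ) < a) : extHom h σ p = (σ ⟨p, hp⟩).castLE h :=
  extHom_castLE h σ ⟨p, hp⟩

theorem extHom_of_le {a b : ℕ} (h : a ≤ b) (σ : Equiv.Perm (Fin a)) (p : Fin b)
    (hp : a ≤ (p : ℕ)) : extHom h σ p = p := by
  refine Equiv.Perm.viaEmbedding_apply_of_notMem σ (Fin.castLEEmb h) p ?_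
  rintro ⟨q, rfl⟩
  have := q.2
  simp at hp
  omega

theorem extHom_extHom {a b c : ℕ} (h : a ≤ b) (h' : b ≤ c) (σ : Equiv.Perm (Fin a)) :
    extHom h' (extHom h σ) = extHom (h.trans h') σ := by
  ext p
  by_cases hp : (p : ℕ) < a
  · rw [extHom_of_lt _ σ p hp, extHom_of_lt h' _ p (by omega),
      extHom_of_lt h σ ⟨p, by omega⟩ hp]
    rfl
  · rw [extHom_of_le _ σ p (by omega)]
    by_cases hp' : (p : ℕ) < b
    · rw [extHom_of_lt h' _ p (by omega), extHom_of_le h σ ⟨p, by omega⟩ (by simpa using hp)]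
      rfl
    · rw [extHom_of_le _ _ p (by omega)]

/-- The invertible diagram that extends `σ ∈ 𝔖_{n_i}`. -/
noncomputable def extUnit (i : Fin (n / 2 + 1)) : Equiv.Perm (Fin (level n i)) →* BrauerDiagram n :=
  (unitHom n).comp (extHom (level_le i))

/-- This reduces statements on cycles and propagating lines of `t_σ` to `e_i`, since invertible
diagrams affect neither. -/
theorem permDiagram_eq_idem_mul (i : Fin (n / 2 + 1)) (σ : Equiv.Perm (Fin (level n i))) :
    permDiagram i σ = idem i * extUnit i σ := by
  refine (eq_of_le ?_).symm
  change (idem i * unitDiagram (extHom (level_le i) σ)).rel ≤ _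
  rw [mul_unitDiagram]
  have key : ∀ q : Fin n, permLabel i 1 false (extHom (level_le i) σ q) =
      permLabel i σ false q := by
    intro q
    rw [permLabel_eq_iff]
    by_cases hq : (q : ℕ) < level n i
    · left
      rw [extHom_of_lt _ _ _ hq]
      exact ⟨(σ ⟨q, hq⟩).2, hq, rfl⟩
    · right
      rw [extHom_of_le _ _ _ (by omega)]
      exact ⟨by omega, by omega, rfl, rfl⟩
  rintro (p | p) (q | q) h
  · exact h
  · change permLabel i 1 true p = permLabel i 1 false _ at h
    rw [key] at h
    exact h
  · change permLabel i 1 false _ = permLabel i 1 true q at h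
    rw [key] at h
    exact h
  · change permLabel i 1 false _ = permLabel i 1 false _ at h
    rw [key, key] at h
    exact h

theorem flip_extUnit (i : Fin (n / 2 + 1)) (σ : Equiv.Perm (Fin (level n i))) :
    (extUnit i σ).flip = extUnit i σ⁻¹ := by
  change (unitHom n _).flip = unitHom n _
  rw [flip_unitHom, map_inv (extHom _)]

theorem permDiagram_eq_mul_idem (i : Fin (n / 2 + 1)) (σ : Equiv.Perm (Fin (level n i))) :
    permDiagram i σ = extUnit i σ * idem i := by
  apply flip_injective
  rw [permDiagram_flip, permDiagram_eq_idem_mul, flip_mul, flip_idem, flip_extUnit]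

theorem permDiagram_ext_mul_idem {i j : Fin (n / 2 + 1)} (h : j ≤ i)
    (σ : Equiv.Perm (Fin (level n j))) :
    permDiagram i (extHom (level_mono.2 h) σ) * idem j = permDiagram j σ := by
  rw [permDiagram_eq_mul_idem, mul_assoc, idem_mul_idem h, permDiagram_eq_mul_idem]
  change unitHom n (extHom _ (extHom _ σ)) * _ = unitHom n (extHom _ σ) * _
  rw [extHom_extHom]

theorem permDiagram_mul_of_idem_mul {i : Fin (n / 2 + 1)} {t : BrauerDiagram n}
    (h : idem i * t = t) (σ : Equiv.Perm (Fin (level n i))) :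
    permDiagram i σ * t = extUnit i σ * t := by
  rw [permDiagram_eq_mul_idem, mul_assoc, h]

theorem mul_permDiagram_of_mul_idem {i : Fin (n / 2 + 1)} {t : BrauerDiagram n}
    (h : t * idem i = t) (σ : Equiv.Perm (Fin (level n i))) :
    t * permDiagram i σ = t * extUnit i σ := by
  rw [permDiagram_eq_idem_mul, ← mul_assoc, h]

/-- The northern arcs of `t` and of `e_l` on the first `n_i` nodes are involutions with equally many
fixed points. A permutation conjugating one into the other moves the arcs of `t` onto those of
`e_l`. -/
theorem exists_idem_mul_extUnit_mul {i l : Fin (n / 2 + 1)} {t : BrauerDiagram n}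
    (h : idem i * t = t) (ht : thr t = level n l) :
    ∃ σ : Equiv.Perm (Fin (level n i)), idem l * (extUnit i σ * t) = extUnit i σ * t := by
  have hli : l ≤ i := by
    rw [← level_mono, ← ht, ← h, ← thr_idem i]
    exact thr_mul_le_left _ _
  have hle := level_mono.2 hli
  obtain ⟨w, hw, hwr, hcard⟩ := exists_northern_involution i t h
  obtain ⟨w', hw', hwr', hcard'⟩ := exists_northern_involution i (idem l) (idem_mul_idem hli)
  rw [thr_idem] at hcard'
  obtain ⟨σ, hσ⟩ := isConj_iff.1 (isConj_of_mul_self_eq_one hw hw' (by omega))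
  refine ⟨σ, ?_⟩
  rw [idem_mul_eq_iff]
  have hl := level_add (n := n) l
  have hi := level_add (n := n) i
  intro p q hp hq hpq
  change (unitHom n (extHom _ σ) * t).rel _ _
  rw [unitHom_mul_rel_inl, ← map_inv]
  by_cases hpi : (p : ℕ) < level n i
  · have hqi : (q : ℕ) < level n i := by omega
    rw [extHom_of_lt _ _ _ hpi, extHom_of_lt _ _ _ hqi, hwr]
    have h1 : (idem l).rel (.inl p) (.inl q) :=
      (idem_rel_inl_inl l p q).2 (Or.inr ⟨hp, hq, hpq⟩)
    rcases (hwr' ⟨p, hpi⟩ ⟨q, hqi⟩).1 h1 with h2 | h2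
    · rw [h2]; exact Or.inl rfl
    · right
      rw [h2, ← hσ]
      simp
  -- From `n_i` on the arcs of `e_l` are those of `e_i`, as `n_i` and `n_l` have the same parity.
  · rw [extHom_of_le _ _ _ (by omega), extHom_of_le _ _ _ (by omega)]
    exact (idem_mul_eq_iff i t).1 h p q (by omega) (by omega) (by omega)

theorem exists_mul_extUnit_mul_idem {i l : Fin (n / 2 + 1)} {t : BrauerDiagram n}
    (h : t * idem i = t) (ht : thr t = level n l) :
    ∃ σ : Equiv.Perm (Fin (level n i)), t * extUnit i σ * idem l = t * extUnit i σ := by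
  rw [mul_idem_eq_iff_flip] at h
  obtain ⟨σ, hσ⟩ := exists_idem_mul_extUnit_mul h ((thr_flip t).trans ht)
  refine ⟨σ⁻¹, ?_⟩
  rw [mul_idem_eq_iff_flip, flip_mul, flip_extUnit, inv_inv, hσ]

/-- The nodes from `n_l` on lie on arcs, so the propagating lines start among the first `n_l` nodes;
counting shows that they use them all. -/
theorem exists_northern_end {l : Fin (n / 2 + 1)} {t : BrauerDiagram n}
    (h : idem l * t = t) (ht : thr t = level n l) (p : Fin n) :
    (∃ q, t.rel (.inl p) (.inr q)) ↔ (p : ℕ) < level n l := by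
  have hsub : {p : Fin n | ∃ q, t.rel (.inl p) (.inr q)} ⊆
      {p | ∃ q, (idem l).rel (.inl p) (.inr q)} := by
    rintro p ⟨q, hq⟩
    refine ⟨p, (idem_rel_inl_inr l p p).2 ⟨rfl, ?_⟩⟩
    by_contra hp
    obtain ⟨q', h1, h2, h3, -⟩ := exists_neighbour l p (by omega)
    have := eq_of_rel (by simp) (by simpa using h1) hq
      ((idem_mul_eq_iff l t).1 h p q' (by omega) h2 h3)
    cases this
  have heq := Set.eq_of_subset_of_ncard_le hsub (by
    change thr (idem l) ≤ thr t
    rw [ht, thr_idem]) (Set.toFinite _)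
  change p ∈ {p : Fin n | ∃ q, t.rel (.inl p) (.inr q)} ↔ _
  rw [heq]
  simp [idem_rel_inl_inr]

/-- Exactly the first `n_l` nodes on either side propagate, so the lines define a permutation of
them, and the absorbed idempotents prescribe all arcs. -/
theorem exists_eq_permDiagram {l : Fin (n / 2 + 1)} {t : BrauerDiagram n}
    (h : idem l * t = t) (h' : t * idem l = t) (ht : thr t = level n l) :
    ∃ σ, t = permDiagram l σ := by
  have hN := exists_northern_end h ht
  rw [mul_idem_eq_iff_flip] at h'
  have hS := exists_northern_end h' ((thr_flip t).trans ht)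
  have hex : ∀ q : Fin (level n l), ∃ p : Fin (level n l),
      t.rel (.inl (p.castLE (level_le l))) (.inr (q.castLE (level_le l))) := by
    intro q
    obtain ⟨p, hp⟩ := (hS (q.castLE (level_le l))).2 q.2
    have hp' : t.rel (.inl p) (.inr (q.castLE (level_le l))) := t.rel.symm' hp
    exact ⟨⟨p, (hN p).1 ⟨_, hp'⟩⟩, hp'⟩
  choose f hf using hex
  have hfinj : Function.Injective f := by
    intro q q' hq
    have h1 := hf q
    rw [hq] at h1
    exact Fin.castLE_injective _ (Sum.inr_injective (eq_of_rel (by simp) (by simp) h1 (hf q')))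
  refine ⟨Equiv.ofBijective f (Finite.injective_iff_bijective.1 hfinj), (eq_of_le ?_).symm⟩
  have harcN := (idem_mul_eq_iff l t).1 h
  have harcS := (idem_mul_eq_iff l t.flip).1 h'
  have hNS : ∀ p q : Fin n, permLabel l 1 true p = permLabel l
      (Equiv.ofBijective f (Finite.injective_iff_bijective.1 hfinj)) false q →
      t.rel (.inl p) (.inr q) := by
    intro p q hpq
    rcases (permLabel_eq_iff _ _ _ _ _ _ _).1 hpq with ⟨hp, hq, h1⟩ | ⟨-, -, h1, -⟩
    · have h2 := hf ⟨q, hq⟩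
      have h3 : (⟨p, hp⟩ : Fin (level n l)) = f ⟨q, hq⟩ := h1
      rw [← h3] at h2
      exact h2
    · cases h1
  rintro (p | p) (q | q) hpq
  · rcases (permLabel_eq_iff _ _ _ _ _ _ _).1 hpq with ⟨hp, hq, h1⟩ | ⟨hp, hq, -, h1⟩
    · obtain rfl : p = q := Fin.ext (Fin.mk.inj_iff.1 h1)
      exact Setoid.refl' _ _
    · exact harcN p q hp hq h1
  · exact hNS p q hpq
  · exact Setoid.symm' _ (hNS q p hpq.symm)
  · rcases (permLabel_eq_iff _ _ _ _ _ _ _).1 hpq with ⟨hp, hq, h1⟩ | ⟨hp, hq, -, h1⟩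
    · obtain rfl : p = q := Fin.ext (Fin.mk.inj_iff.1 (Equiv.injective _ h1))
      exact Setoid.refl' _ _
    · exact harcS p q hp hq h1

theorem extUnit_inv_mul_cancel_left (i : Fin (n / 2 + 1)) (σ : Equiv.Perm (Fin (level n i)))
    (t : BrauerDiagram n) : extUnit i σ⁻¹ * (extUnit i σ * t) = t := by
  rw [← mul_assoc, ← map_mul, inv_mul_cancel, map_one, one_mul]

theorem mul_extUnit_inv_cancel_right (i : Fin (n / 2 + 1)) (σ : Equiv.Perm (Fin (level n i)))
    (t : BrauerDiagram n) : t * extUnit i σ * extUnit i σ⁻¹ = t := by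
  rw [mul_assoc, ← map_mul, mul_inv_cancel, map_one, mul_one]

/-- The normal form of a diagram with `n_l` propagating lines. -/
theorem exists_eq_extUnit_mul {i j l : Fin (n / 2 + 1)} {t : BrauerDiagram n}
    (h : idem i * t = t) (h' : t * idem j = t) (ht : thr t = level n l) :
    ∃ (σ : Equiv.Perm (Fin (level n i))) (ρ : Equiv.Perm (Fin (level n l)))
      (τ : Equiv.Perm (Fin (level n j))), t = extUnit i σ * permDiagram l ρ * extUnit j τ := by
  obtain ⟨σ, hσ⟩ := exists_idem_mul_extUnit_mul h ht
  obtain ⟨τ, hτ⟩ := exists_mul_extUnit_mul_idem h' ht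
  obtain ⟨ρ, hρ⟩ := exists_eq_permDiagram (l := l) (t := extUnit i σ * t * extUnit j τ)
    (by rw [← mul_assoc, hσ]) (by rw [mul_assoc, mul_assoc, ← mul_assoc t, hτ, ← mul_assoc])
    (by
      change thr (unitHom n _ * t * unitHom n _) = _
      rw [thr_mul_unitHom, thr_unitHom_mul, ht])
  refine ⟨σ⁻¹, ρ, τ⁻¹, ?_⟩
  rw [← hρ, mul_assoc (extUnit i σ) t, extUnit_inv_mul_cancel_left, mul_extUnit_inv_cancel_right]

/-- The normal form writes `s` as `e_l` multiplied on both sides by invertible diagrams. -/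
theorem mem_jClass_idem_iff {s : BrauerDiagram n} {l : Fin (n / 2 + 1)} :
    s ∈ jClass (idem l) ↔ thr s = level n l := by
  constructor
  · intro h
    rw [thr_eq_of_mem_jClass h, thr_idem]
  · intro h
    obtain ⟨σ, ρ, τ, rfl⟩ := exists_eq_extUnit_mul (i := Fin.last _) (j := Fin.last _)
      (by rw [idem_last, one_mul]) (by rw [idem_last, mul_one]) h
    rw [permDiagram_eq_mul_idem]
    apply Set.Subset.antisymm
    · rintro _ ⟨a, b, rfl⟩
      exact ⟨a * extUnit _ σ * extUnit l ρ, extUnit _ τ * b, by simp only [mul_assoc]⟩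
    · rintro _ ⟨a, b, rfl⟩
      refine ⟨a * extUnit l ρ⁻¹ * extUnit _ σ⁻¹, extUnit _ τ⁻¹ * b, ?_⟩
      simp only [mul_assoc]
      rw [extUnit_inv_mul_cancel_left, extUnit_inv_mul_cancel_left, ← mul_assoc (extUnit _ τ),
        ← map_mul, mul_inv_cancel, map_one, one_mul]

/-- The normal form of a diagram with `n_j` propagating lines in `e_i ∘ S ∘ e_j`. -/
theorem exists_eq_permDiagram_mul {i j : Fin (n / 2 + 1)} (hij : j ≤ i) {t : BrauerDiagram n}
    (h : idem i * t = t) (h' : t * idem j = t) (ht : thr t = level n j) :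
    ∃ σ τ, t = permDiagram i σ * idem j * permDiagram j τ := by
  obtain ⟨σ, ρ, τ, rfl⟩ := exists_eq_extUnit_mul h h' ht
  refine ⟨σ, ρ * τ, ?_⟩
  rw [permDiagram_mul_of_idem_mul (idem_mul_idem hij), permDiagram_eq_idem_mul j ρ,
    permDiagram_eq_idem_mul j (ρ * τ), map_mul]
  simp only [mul_assoc]
  rw [← mul_assoc (idem j) (idem j), (isIdempotentElem_idem j).eq]

theorem twoSided_idem_subset_iff {i j : Fin (n / 2 + 1)} :
    twoSided (idem (n := n) j) ⊆ twoSided (idem i) ↔ j ≤ i := by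
  constructor
  · intro h
    have := thr_le_of_twoSided_subset h
    rwa [thr_idem, thr_idem, level_mono] at this
  · rintro h _ ⟨a, b, rfl⟩
    exact ⟨a, idem j * b, by rw [mul_assoc, ← mul_assoc (idem i), idem_mul_idem h, mul_assoc]⟩

theorem jlt_idem_iff {i j : Fin (n / 2 + 1)} :
    JLT (idem (n := n) j) (idem i) ↔ j < i := by
  rw [JLT, ssubset_iff_subset_not_subset, twoSided_idem_subset_iff, twoSided_idem_subset_iff,
    lt_iff_le_not_ge]

theorem incl_injective {S : Type*} [Monoid S] {e : S} (he : IsIdempotentElem e) :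
    Function.Injective (MaxSubgroup.incl he) := fun _ _ h => Units.ext (Subtype.ext h)

theorem permHom_bijective (i : Fin (n / 2 + 1)) : Function.Bijective (permHom (n := n) i) := by
  constructor
  · intro σ τ h
    have h1 : permDiagram i σ = permDiagram i τ := congrArg (MaxSubgroup.incl _) h
    ext1 p
    have h2 : (permDiagram i σ).rel (.inl ((σ p).castLE (level_le i)))
        (.inr (p.castLE (level_le i))) :=
      (permLabel_eq_iff _ _ _ _ _ _ _).2 (Or.inl ⟨(σ p).2, p.2, rfl⟩)
    rw [h1] at h2
    rcases (permLabel_eq_iff _ _ _ _ _ _ _).1 h2 with ⟨_, _, h3⟩ | ⟨-, -, h3, -⟩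
    · exact h3
    · cases h3
  · intro x
    have hx := (Subsemigroup.mem_corner_iff (isIdempotentElem_idem i)).1 x.1.2
    have hxx : MaxSubgroup.incl _ x * MaxSubgroup.incl _ x⁻¹ = idem i := by
      rw [← map_mul, mul_inv_cancel]; rfl
    -- A unit `x` has at most `n_i` propagating lines because `e_i * x = x`, and at least `n_i`
    -- because `x * x⁻¹ = e_i`.
    obtain ⟨σ, hσ⟩ := exists_eq_permDiagram (t := MaxSubgroup.incl _ x) hx.1 hx.2 (by
      apply le_antisymm
      · rw [← thr_idem i, show MaxSubgroup.incl _ x = _ from hx.1.symm]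
        exact thr_mul_le_left _ _
      · have := thr_mul_le_left (MaxSubgroup.incl _ x) (MaxSubgroup.incl _ x⁻¹)
        rwa [hxx, thr_idem] at this)
    exact ⟨σ, incl_injective _ hσ.symm⟩

/-! ### Values of the cocycle -/

/-- The cocycle identity for `(e_i, e_i, t)` reads `m(e_i, t) + m(e_i, e_i) = 2 m(e_i, t)`, so no
cycles have to be inspected. -/
theorem numCycles_idem_left {i : Fin (n / 2 + 1)} {t : BrauerDiagram n} (h : idem i * t = t) :
    numCycles (idem i) t = n / 2 - i := by
  have h1 := numCycles_assoc (idem i) (idem i) t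
  have h2 : numCycles (idem i) (idem i) = n / 2 - i := numCycles_permDiagram i 1 1
  rw [(isIdempotentElem_idem i).eq, h, h2] at h1
  omega

theorem numCycles_idem_right {i : Fin (n / 2 + 1)} {t : BrauerDiagram n} (h : t * idem i = t) :
    numCycles t (idem i) = n / 2 - i := by
  have h1 := numCycles_assoc t (idem i) (idem i)
  have h2 : numCycles (idem i) (idem i) = n / 2 - i := numCycles_permDiagram i 1 1
  rw [(isIdempotentElem_idem i).eq, h, h2] at h1
  omega

/-- As `t_σ` is an invertible diagram times `e_i`, and invertible diagrams create no cycles, the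
cocycle identity reduces this to `e_i`. -/
theorem numCycles_permDiagram_left {i : Fin (n / 2 + 1)} {t : BrauerDiagram n}
    (h : idem i * t = t) (σ : Equiv.Perm (Fin (level n i))) :
    numCycles (permDiagram i σ) t = n / 2 - i := by
  have h1 := numCycles_assoc (extUnit i σ) (idem i) t
  have h2 : ∀ s, numCycles (extUnit i σ) s = 0 := numCycles_unitHom_left _
  rwa [← permDiagram_eq_mul_idem, h2, h2, numCycles_idem_left h, zero_add, add_zero] at h1

theorem numCycles_permDiagram_right {i : Fin (n / 2 + 1)} {t : BrauerDiagram n}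
    (h : t * idem i = t) (σ : Equiv.Perm (Fin (level n i))) :
    numCycles t (permDiagram i σ) = n / 2 - i := by
  have h1 := numCycles_assoc t (idem i) (extUnit i σ)
  have h2 : ∀ s, numCycles s (extUnit i σ) = 0 := numCycles_unitHom_right _
  rw [← permDiagram_eq_idem_mul, h2, h2, numCycles_idem_right h, zero_add, add_zero] at h1
  exact h1.symm

end BrauerDiagram

end TwistedBrauer

/-! ### The twisted group algebras and their inclusions into the Brauer algebra -/

namespace TwistedBrauer

theorem GroupAlg.incl_basis {S k : Type*} [Monoid S] [Field k] (α : TwoCocycle S k) {e : S}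
    (he : IsIdempotentElem e) (x : MaxSubgroup he) :
    GroupAlg.incl α he (TwistedAlgebra.basis _ x) =
      TwistedAlgebra.basis α (MaxSubgroup.incl he x) :=
  Module.Basis.constr_basis _ _ _ _

/-- The inclusion is multiplicative but in general not unital: the identity goes to a scalar
multiple of `e`. -/
theorem GroupAlg.incl_mul {S k : Type*} [Monoid S] [Field k] (α : TwoCocycle S k) {e : S}
    (he : IsIdempotentElem e) (a b : GroupAlg α he) :
    GroupAlg.incl α he (a * b) = GroupAlg.incl α he a * GroupAlg.incl α he b := by
  have : (LinearMap.mul k (GroupAlg α he)).compr₂ (GroupAlg.incl α he) =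
      (LinearMap.mul k (TwistedAlgebra α)).compl₁₂ (GroupAlg.incl α he) (GroupAlg.incl α he) := by
    refine LinearMap.ext_basis (TwistedAlgebra.basis _) (TwistedAlgebra.basis _) fun x y => ?_
    simp only [LinearMap.compr₂_apply, LinearMap.compl₁₂_apply, LinearMap.mul_apply']
    rw [TwistedAlgebra.basis_mul_basis, map_smul, GroupAlg.incl_basis, GroupAlg.incl_basis,
      GroupAlg.incl_basis, TwistedAlgebra.basis_mul_basis, map_mul]
    rfl
  exact LinearMap.congr_fun₂ this a b

namespace BrauerDiagram

variable {n : ℕ} {k : Type*} [Field k] (δ : kˣ)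

/-- The Brauer algebra. -/
abbrev BrauerAlg (n : ℕ) (δ : kˣ) : Type _ := TwistedAlgebra (brauerCocycle n δ)

/-- The twisted group algebra `k_α Γ_{e_i}`. -/
abbrev SymmAlg (i : Fin (n / 2 + 1)) : Type _ :=
  GroupAlg (brauerCocycle n δ) (isIdempotentElem_idem i)

/-- The inclusion of `k_α Γ_{e_i}` into the Brauer algebra. -/
noncomputable abbrev symmIncl (i : Fin (n / 2 + 1)) : SymmAlg δ i →ₗ[k] BrauerAlg n δ :=
  GroupAlg.incl (brauerCocycle n δ) (isIdempotentElem_idem i)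

/-- The basis of the Brauer algebra consisting of the diagrams. -/
noncomputable abbrev diag (n : ℕ) (δ : kˣ) : Module.Basis (BrauerDiagram n) k (BrauerAlg n δ) :=
  TwistedAlgebra.basis (brauerCocycle n δ)

/-- The permutations as units of `k_α Γ_{e_i}`. -/
noncomputable def symmUnit (i : Fin (n / 2 + 1)) : Equiv.Perm (Fin (level n i)) →* SymmAlg δ i :=
  TwistedAlgebra.untwist (permHom i) (δ ^ (n / 2 - (i : ℕ)))
    fun σ τ => congrArg (δ ^ ·) (numCycles_permDiagram i σ τ)

/-- The basis of `k_α Γ_{e_i}` consisting of the permutations. -/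
noncomputable def symmBasis (i : Fin (n / 2 + 1)) :
    Module.Basis (Equiv.Perm (Fin (level n i))) k (SymmAlg δ i) :=
  ((TwistedAlgebra.basis _).reindex (Equiv.ofBijective _ (permHom_bijective i)).symm).unitsSMul
    fun _ => (δ ^ (n / 2 - (i : ℕ)))⁻¹

theorem symmBasis_apply (i : Fin (n / 2 + 1)) (σ : Equiv.Perm (Fin (level n i))) :
    symmBasis δ i σ = symmUnit δ i σ := by
  rw [symmBasis, Module.Basis.unitsSMul_apply, Module.Basis.reindex_apply]
  rfl

theorem symmRep_apply (i : Fin (n / 2 + 1)) {V : Type*} [AddCommGroup V] [Module k V]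
    [Module (SymmAlg δ i) V] [IsScalarTower k (SymmAlg δ i) V]
    (σ : Equiv.Perm (Fin (level n i))) (v : V) :
    symmRep δ i V σ v = symmUnit δ i σ • v := rfl

/-- The algebra is an image of the group algebra of `𝔖_{n_i}`, to which Maschke's theorem applies
because `n_i!` divides `n!`. -/
theorem isSemisimpleRing_symmAlg (hn : (n.factorial : k) ≠ 0) (i : Fin (n / 2 + 1)) :
    IsSemisimpleRing (SymmAlg δ i) := by
  have hcard : NeZero (Nat.card (Equiv.Perm (Fin (level n i))) : k) := by
    refine ⟨fun h => hn ?_⟩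
    rw [Nat.card_eq_fintype_card, Fintype.card_perm, Fintype.card_fin] at h
    obtain ⟨c, hc⟩ := Nat.factorial_dvd_factorial (level_le i)
    rw [hc, Nat.cast_mul, h, zero_mul]
  let F : MonoidAlgebra k (Equiv.Perm (Fin (level n i))) →ₐ[k] SymmAlg δ i :=
    MonoidAlgebra.lift k _ _ (symmUnit δ i)
  refine RingHom.isSemisimpleRing_of_surjective F.toRingHom fun x => ?_
  have hx : x ∈ Submodule.span k (Set.range (symmBasis δ i)) := by
    rw [Module.Basis.span_eq]; trivial
  have hle : Submodule.span k (Set.range (symmBasis δ i)) ≤ LinearMap.range F.toLinearMap := by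
    rw [Submodule.span_le]
    rintro _ ⟨σ, rfl⟩
    refine ⟨MonoidAlgebra.of k _ σ, ?_⟩
    rw [symmBasis_apply]
    exact MonoidAlgebra.lift_of _ _
  exact hle hx

/-! ### Representations of symmetric groups as modules over the twisted group algebras -/

section RepModule

variable {V : Type*} [AddCommGroup V] [Module k V]

/-- The extension of a representation of `𝔖_{n_i}` to `k_α Γ_{e_i}`. -/
noncomputable def liftRep (i : Fin (n / 2 + 1))
    (ρ : Representation k (Equiv.Perm (Fin (level n i))) V) : SymmAlg δ i →ₐ[k] Module.End k V :=
  AlgHom.ofLinearMap ((symmBasis δ i).constr k ρ)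
    (by rw [← map_one (symmUnit δ i), ← symmBasis_apply, Module.Basis.constr_basis, map_one])
    (by
      have : (LinearMap.mul k (SymmAlg δ i)).compr₂ ((symmBasis δ i).constr k ρ) =
          (LinearMap.mul k (Module.End k V)).compl₁₂ ((symmBasis δ i).constr k ρ)
            ((symmBasis δ i).constr k ρ) := by
        refine LinearMap.ext_basis (symmBasis δ i) (symmBasis δ i) fun σ τ => ?_
        simp only [LinearMap.compr₂_apply, LinearMap.compl₁₂_apply, LinearMap.mul_apply',
          Module.Basis.constr_basis]
        rw [symmBasis_apply, symmBasis_apply, ← map_mul, ← symmBasis_apply,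
          Module.Basis.constr_basis, map_mul]
      exact LinearMap.congr_fun₂ this)

theorem liftRep_symmUnit (i : Fin (n / 2 + 1))
    (ρ : Representation k (Equiv.Perm (Fin (level n i))) V) (σ : Equiv.Perm (Fin (level n i))) :
    liftRep δ i ρ (symmUnit δ i σ) = ρ σ := by
  rw [← symmBasis_apply]
  exact (symmBasis δ i).constr_basis k ρ σ

/-- The space of a representation of `𝔖_{n_i}`, viewed as a `k_α Γ_{e_i}`-module. -/
def RepModule (_δ : kˣ) (i : Fin (n / 2 + 1))
    (_ρ : Representation k (Equiv.Perm (Fin (level n i))) V) : Type _ := V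

variable {i : Fin (n / 2 + 1)} (ρ : Representation k (Equiv.Perm (Fin (level n i))) V)

instance : AddCommGroup (RepModule δ i ρ) := inferInstanceAs (AddCommGroup V)

instance : Module k (RepModule δ i ρ) := inferInstanceAs (Module k V)

noncomputable instance : Module (SymmAlg δ i) (RepModule δ i ρ) :=
  Module.compHom V (liftRep δ i ρ).toRingHom

instance : IsScalarTower k (SymmAlg δ i) (RepModule δ i ρ) where
  smul_assoc c a v := by
    change liftRep δ i ρ (c • a) v = c • liftRep δ i ρ a v
    rw [map_smul]
    rfl

theorem symmUnit_smul_repModule (σ : Equiv.Perm (Fin (level n i))) (v : RepModule δ i ρ) :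
    symmUnit δ i σ • v = (ρ σ (show V from v) : V) :=
  LinearMap.congr_fun (liftRep_symmUnit δ i ρ σ) v

/-- A subspace that is stable under the permutations, as a submodule over `k_α Γ_{e_i}`. -/
def stableSubmodule {M : Type*} [AddCommGroup M] [Module k M] [Module (SymmAlg δ i) M]
    [IsScalarTower k (SymmAlg δ i) M] (W : Submodule k M)
    (hW : ∀ σ, ∀ w ∈ W, symmUnit δ i σ • w ∈ W) : Submodule (SymmAlg δ i) M where
  __ := W
  smul_mem' a w hw := by
    rw [← (symmBasis δ i).sum_repr a, Finset.sum_smul]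
    refine W.sum_mem fun σ _ => ?_
    rw [smul_assoc, symmBasis_apply]
    exact W.smul_mem _ (hW σ w hw)

end RepModule

/-! ### Products with diagrams -/

theorem diag_mul (s t : BrauerDiagram n) :
    diag n δ s * diag n δ t = ((δ ^ numCycles s t : kˣ) : k) • diag n δ (s * t) :=
  TwistedAlgebra.basis_mul_basis s t

theorem symmIncl_symmUnit (i : Fin (n / 2 + 1)) (σ : Equiv.Perm (Fin (level n i))) :
    symmIncl δ i (symmUnit δ i σ) =
      (((δ ^ (n / 2 - (i : ℕ)))⁻¹ : kˣ) : k) • diag n δ (permDiagram i σ) := by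
  have : symmUnit δ i σ = (((δ ^ (n / 2 - (i : ℕ)))⁻¹ : kˣ) : k) •
    TwistedAlgebra.basis _ (permHom i σ) := rfl
  rw [this, map_smul, symmIncl, GroupAlg.incl_basis]
  rfl

/-- The factor `δ ^ (n / 2 - i)` from the cocycle cancels the normalization of `symmUnit`, so the
result is a diagram without a scalar. -/
theorem symmUnit_mul_diag {i : Fin (n / 2 + 1)} {t : BrauerDiagram n} (h : idem i * t = t)
    (σ : Equiv.Perm (Fin (level n i))) :
    symmIncl δ i (symmUnit δ i σ) * diag n δ t = diag n δ (permDiagram i σ * t) := by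
  rw [symmIncl_symmUnit, smul_mul_assoc, diag_mul, numCycles_permDiagram_left h, smul_smul,
    Units.inv_mul, one_smul]

theorem diag_mul_symmUnit {i : Fin (n / 2 + 1)} {t : BrauerDiagram n} (h : t * idem i = t)
    (σ : Equiv.Perm (Fin (level n i))) :
    diag n δ t * symmIncl δ i (symmUnit δ i σ) = diag n δ (t * permDiagram i σ) := by
  rw [symmIncl_symmUnit, mul_smul_comm, diag_mul, numCycles_permDiagram_right h, smul_smul,
    Units.inv_mul, one_smul]

theorem symmUnit_mul_idem_mul_symmUnit {i j : Fin (n / 2 + 1)} (h : j ≤ i)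
    (σ : Equiv.Perm (Fin (level n i))) (τ : Equiv.Perm (Fin (level n j))) :
    symmIncl δ i (symmUnit δ i σ) * diag n δ (idem j) * symmIncl δ j (symmUnit δ j τ) =
      diag n δ (permDiagram i σ * idem j * permDiagram j τ) := by
  rw [symmUnit_mul_diag δ (idem_mul_idem h), diag_mul_symmUnit]
  rw [mul_assoc, (isIdempotentElem_idem j).eq]

theorem symmUnit_mul_idem_mul_symmUnit' {i j : Fin (n / 2 + 1)} (h : j ≤ i)
    (σ : Equiv.Perm (Fin (level n i))) (τ : Equiv.Perm (Fin (level n j))) :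
    symmIncl δ j (symmUnit δ j τ) * diag n δ (idem j) * symmIncl δ i (symmUnit δ i σ) =
      diag n δ (permDiagram j τ * idem j * permDiagram i σ) := by
  rw [symmUnit_mul_diag δ (isIdempotentElem_idem j).eq, diag_mul_symmUnit]
  rw [mul_assoc, idem_mul_idem' h]

theorem mul_symmIncl_one {i : Fin (n / 2 + 1)} (b : SymmAlg δ i) :
    symmIncl δ i b * symmIncl δ i (symmUnit δ i 1) = symmIncl δ i b := by
  rw [map_one, ← GroupAlg.incl_mul, mul_one]

theorem symmIncl_one_mul {i : Fin (n / 2 + 1)} (b : SymmAlg δ i) :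
    symmIncl δ i (symmUnit δ i 1) * symmIncl δ i b = symmIncl δ i b := by
  rw [map_one, ← GroupAlg.incl_mul, one_mul]

/-! ### The layers of the Brauer algebra -/

theorem mem_spanLT_of_thr_lt {j : Fin (n / 2 + 1)} {s : BrauerDiagram n} (h : thr s < level n j) :
    diag n δ s ∈ spanLT (idem (n := n)) (brauerCocycle n δ) j := by
  obtain ⟨i, hi⟩ := exists_level_eq_thr s
  exact Submodule.subset_span ⟨s, ⟨i, level_strictMono.1 (hi ▸ h), mem_jClass_idem_iff.2 hi⟩, rfl⟩

theorem mem_spanLE_idem (j : Fin (n / 2 + 1)) :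
    diag n δ (idem j) ∈ spanLE (idem (n := n)) (brauerCocycle n δ) j :=
  Submodule.subset_span ⟨idem j, ⟨j, le_rfl, mem_jClass_idem_iff.2 (thr_idem j)⟩, rfl⟩

theorem spanLT_induction {j : Fin (n / 2 + 1)} {W : Submodule k (BrauerAlg n δ)}
    (h : ∀ s, thr s < level n j → diag n δ s ∈ W) :
    spanLT (idem (n := n)) (brauerCocycle n δ) j ≤ W := by
  refine Submodule.span_le.2 ?_
  rintro _ ⟨s, ⟨i, hi, hs⟩, rfl⟩
  exact h s (by rw [mem_jClass_idem_iff.1 hs]; exact level_strictMono.2 hi)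

theorem spanLE_induction {j : Fin (n / 2 + 1)} {W : Submodule k (BrauerAlg n δ)}
    (h : ∀ s, thr s ≤ level n j → diag n δ s ∈ W) :
    spanLE (idem (n := n)) (brauerCocycle n δ) j ≤ W := by
  refine Submodule.span_le.2 ?_
  rintro _ ⟨s, ⟨i, hi, hs⟩, rfl⟩
  exact h s (by rw [mem_jClass_idem_iff.1 hs]; exact level_mono.2 hi)

/-- With `mem_spanLT_mul`: `J_{j-1}` is a two-sided ideal, because products have no more propagating
lines than their factors. -/
theorem mul_mem_spanLT {j : Fin (n / 2 + 1)} (b : BrauerAlg n δ) {a : BrauerAlg n δ}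
    (ha : a ∈ spanLT (idem (n := n)) (brauerCocycle n δ) j) :
    b * a ∈ spanLT (idem (n := n)) (brauerCocycle n δ) j := by
  refine spanLT_induction δ
    (W := (spanLT (idem (n := n)) (brauerCocycle n δ) j).comap (LinearMap.mulLeft k b))
    (fun s hs => ?_) ha
  rw [Submodule.mem_comap, LinearMap.mulLeft_apply]
  have hb : b ∈ Submodule.span k (Set.range (diag n δ)) := by
    rw [Module.Basis.span_eq]; trivial
  induction hb using Submodule.span_induction with
  | mem x hx =>
    obtain ⟨t, rfl⟩ := hx
    rw [diag_mul]
    exact Submodule.smul_mem _ _ (mem_spanLT_of_thr_lt δ ((thr_mul_le_right _ _).trans_lt hs))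
  | zero => rw [zero_mul]; exact Submodule.zero_mem _
  | add x y _ _ hx hy => rw [add_mul]; exact Submodule.add_mem _ hx hy
  | smul c x _ hx => rw [smul_mul_assoc]; exact Submodule.smul_mem _ _ hx

theorem mem_spanLT_mul {j : Fin (n / 2 + 1)} (b : BrauerAlg n δ) {a : BrauerAlg n δ}
    (ha : a ∈ spanLT (idem (n := n)) (brauerCocycle n δ) j) :
    a * b ∈ spanLT (idem (n := n)) (brauerCocycle n δ) j := by
  refine spanLT_induction δ
    (W := (spanLT (idem (n := n)) (brauerCocycle n δ) j).comap (LinearMap.mulRight k b))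
    (fun s hs => ?_) ha
  rw [Submodule.mem_comap, LinearMap.mulRight_apply]
  have hb : b ∈ Submodule.span k (Set.range (diag n δ)) := by
    rw [Module.Basis.span_eq]; trivial
  induction hb using Submodule.span_induction with
  | mem x hx =>
    obtain ⟨t, rfl⟩ := hx
    rw [diag_mul]
    exact Submodule.smul_mem _ _ (mem_spanLT_of_thr_lt δ ((thr_mul_le_left _ _).trans_lt hs))
  | zero => rw [mul_zero]; exact Submodule.zero_mem _
  | add x y _ _ hx hy => rw [mul_add]; exact Submodule.add_mem _ hx hy
  | smul c x _ hx => rw [mul_smul_comm]; exact Submodule.smul_mem _ _ hx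

theorem symmIncl_mul_comm {i : Fin (n / 2 + 1)} {f : SymmAlg δ i}
    (hf : f ∈ Subring.center (SymmAlg δ i)) (b : SymmAlg δ i) :
    symmIncl δ i f * symmIncl δ i b = symmIncl δ i b * symmIncl δ i f := by
  rw [← GroupAlg.incl_mul, ← GroupAlg.incl_mul, Subring.mem_center_iff.1 hf]

/-- The identity elements of the two group algebras are scalar multiples of `e_i` and `e_j`, so `f`
and `g` see `s` only through `e_i s e_j`, up to a scalar. -/
theorem mul_diag_mul_mem_spanLT {i j m : Fin (n / 2 + 1)} {f : SymmAlg δ i} {g : SymmAlg δ j}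
    {s : BrauerDiagram n} (h : symmIncl δ i f * diag n δ (idem i * s * idem j) * symmIncl δ j g ∈
      spanLT (idem (n := n)) (brauerCocycle n δ) m) :
    symmIncl δ i f * diag n δ s * symmIncl δ j g ∈
      spanLT (idem (n := n)) (brauerCocycle n δ) m := by
  have hU : ∀ i : Fin (n / 2 + 1), symmIncl δ i (symmUnit δ i 1) =
      (((δ ^ (n / 2 - (i : ℕ)))⁻¹ : kˣ) : k) • diag n δ (idem i) := fun i =>
    symmIncl_symmUnit δ i 1
  have h2 : ∃ c : k, symmIncl δ i (symmUnit δ i 1) * diag n δ s * symmIncl δ j (symmUnit δ j 1) =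
      c • diag n δ (idem i * s * idem j) := by
    rw [hU, hU, smul_mul_assoc, smul_mul_assoc, mul_smul_comm, diag_mul, smul_mul_assoc, diag_mul,
      smul_smul, smul_smul, smul_smul]
    exact ⟨_, rfl⟩
  obtain ⟨c, hc⟩ := h2
  rw [← mul_symmIncl_one δ f, ← symmIncl_one_mul δ g,
    show symmIncl δ i f * symmIncl δ i (symmUnit δ i 1) * diag n δ s *
      (symmIncl δ j (symmUnit δ j 1) * symmIncl δ j g) = symmIncl δ i f *
      (symmIncl δ i (symmUnit δ i 1) * diag n δ s * symmIncl δ j (symmUnit δ j 1)) *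
        symmIncl δ j g by simp only [mul_assoc], hc, mul_smul_comm, smul_mul_assoc]
  exact Submodule.smul_mem _ _ h

/-- Centrality moves `b` and `c` to the outside, where the ideal property absorbs them. -/
theorem central_mul_mul_mem_spanLT {i j m : Fin (n / 2 + 1)} {f : SymmAlg δ i} {g : SymmAlg δ j}
    (hf : f ∈ Subring.center (SymmAlg δ i)) (hg : g ∈ Subring.center (SymmAlg δ j))
    {x : BrauerAlg n δ} (h : symmIncl δ i f * x * symmIncl δ j g ∈
      spanLT (idem (n := n)) (brauerCocycle n δ) m) (b : SymmAlg δ i) (c : SymmAlg δ j) :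
    symmIncl δ i f * (symmIncl δ i b * x * symmIncl δ j c) * symmIncl δ j g ∈
      spanLT (idem (n := n)) (brauerCocycle n δ) m := by
  have : symmIncl δ i f * (symmIncl δ i b * x * symmIncl δ j c) * symmIncl δ j g =
      symmIncl δ i b * (symmIncl δ i f * x * symmIncl δ j g) * symmIncl δ j c := by
    calc _ = symmIncl δ i f * symmIncl δ i b * x * (symmIncl δ j c * symmIncl δ j g) := by
          simp only [mul_assoc]
      _ = _ := by
          rw [symmIncl_mul_comm δ hf, ← symmIncl_mul_comm δ hg]
          simp only [mul_assoc]
  rw [this]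
  exact mem_spanLT_mul δ _ (mul_mem_spanLT δ _ h)

/-- A diagram of `e_i ∘ S ∘ e_j` with fewer than `n_j` lines is already in `J_{j-1}`; one with `n_j`
lines has the form `σ e_j τ`, so the claim follows from that for `e_j`. -/
theorem mul_mul_mem_spanLT {i j : Fin (n / 2 + 1)} (hij : j ≤ i) {f : SymmAlg δ i}
    {g : SymmAlg δ j} (hf : f ∈ Subring.center (SymmAlg δ i))
    (hg : g ∈ Subring.center (SymmAlg δ j))
    (h : symmIncl δ i f * diag n δ (idem j) * symmIncl δ j g ∈
      spanLT (idem (n := n)) (brauerCocycle n δ) j) {a : BrauerAlg n δ}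
    (ha : a ∈ spanLE (idem (n := n)) (brauerCocycle n δ) j) :
    symmIncl δ i f * a * symmIncl δ j g ∈ spanLT (idem (n := n)) (brauerCocycle n δ) j := by
  refine spanLE_induction δ (W := (spanLT (idem (n := n)) (brauerCocycle n δ) j).comap
    (LinearMap.mulRight k (symmIncl δ j g) ∘ₗ LinearMap.mulLeft k (symmIncl δ i f)))
    (fun s hs => ?_) ha
  rw [Submodule.mem_comap, LinearMap.comp_apply, LinearMap.mulLeft_apply,
    LinearMap.mulRight_apply]
  apply mul_diag_mul_mem_spanLT
  rcases (((thr_mul_le_left _ _).trans (thr_mul_le_right _ _)).trans hs :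
      thr (idem i * s * idem j) ≤ level n j).lt_or_eq with h' | h'
  · exact mem_spanLT_mul δ _ (mul_mem_spanLT δ _ (mem_spanLT_of_thr_lt δ h'))
  · obtain ⟨σ, τ, hστ⟩ := exists_eq_permDiagram_mul hij
      (by rw [← mul_assoc, ← mul_assoc, (isIdempotentElem_idem i).eq])
      (by rw [mul_assoc, (isIdempotentElem_idem j).eq]) h'
    rw [hστ, ← symmUnit_mul_idem_mul_symmUnit δ hij]
    exact central_mul_mul_mem_spanLT δ hf hg h _ _

theorem mul_mul_mem_spanLT' {i j : Fin (n / 2 + 1)} (hij : j ≤ i) {f : SymmAlg δ i}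
    {g : SymmAlg δ j} (hf : f ∈ Subring.center (SymmAlg δ i))
    (hg : g ∈ Subring.center (SymmAlg δ j))
    (h : symmIncl δ j g * diag n δ (idem j) * symmIncl δ i f ∈
      spanLT (idem (n := n)) (brauerCocycle n δ) j) {a : BrauerAlg n δ}
    (ha : a ∈ spanLE (idem (n := n)) (brauerCocycle n δ) j) :
    symmIncl δ j g * a * symmIncl δ i f ∈ spanLT (idem (n := n)) (brauerCocycle n δ) j := by
  refine spanLE_induction δ (W := (spanLT (idem (n := n)) (brauerCocycle n δ) j).comap
    (LinearMap.mulRight k (symmIncl δ i f) ∘ₗ LinearMap.mulLeft k (symmIncl δ j g)))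
    (fun s hs => ?_) ha
  rw [Submodule.mem_comap, LinearMap.comp_apply, LinearMap.mulLeft_apply,
    LinearMap.mulRight_apply]
  apply mul_diag_mul_mem_spanLT
  rcases (((thr_mul_le_left _ _).trans (thr_mul_le_right _ _)).trans hs :
      thr (idem j * s * idem i) ≤ level n j).lt_or_eq with h' | h'
  · exact mem_spanLT_mul δ _ (mul_mem_spanLT δ _ (mem_spanLT_of_thr_lt δ h'))
  -- The normal form is available for `e_i ∘ S ∘ e_j` with `j ≤ i`, so it is applied to the
  -- reflected diagram.
  · obtain ⟨σ, τ, hστ⟩ := exists_eq_permDiagram_mul (t := (idem j * s * idem i).flip) hij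
      (by rw [← mul_idem_eq_iff_flip, mul_assoc, (isIdempotentElem_idem i).eq])
      (by
        rw [mul_idem_eq_iff_flip, flip_flip, ← mul_assoc, ← mul_assoc,
          (isIdempotentElem_idem j).eq])
      (by rw [thr_flip, h'])
    rw [← flip_injective.eq_iff, flip_flip, flip_mul, flip_mul, flip_idem, permDiagram_flip,
      permDiagram_flip, ← mul_assoc] at hστ
    rw [hστ, ← symmUnit_mul_idem_mul_symmUnit' δ hij]
    exact central_mul_mul_mem_spanLT δ hg hf h _ _

/-! ### Reflection -/

/-- The reflection of diagrams, extended to the Brauer algebra. -/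
noncomputable def flipHom : BrauerAlg n δ →ₗ[k] BrauerAlg n δ :=
  (diag n δ).constr k fun t => diag n δ t.flip

theorem flipHom_diag (t : BrauerDiagram n) : flipHom δ (diag n δ t) = diag n δ t.flip :=
  (diag n δ).constr_basis k _ t

theorem flipHom_mem_spanLT {j : Fin (n / 2 + 1)} {a : BrauerAlg n δ}
    (ha : a ∈ spanLT (idem (n := n)) (brauerCocycle n δ) j) :
    flipHom δ a ∈ spanLT (idem (n := n)) (brauerCocycle n δ) j := by
  refine spanLT_induction δ
    (W := (spanLT (idem (n := n)) (brauerCocycle n δ) j).comap (flipHom δ)) (fun s hs => ?_) ha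
  rw [Submodule.mem_comap, flipHom_diag]
  exact mem_spanLT_of_thr_lt δ (by rwa [thr_flip])

/-- The inversion of permutations, extended to `k_α Γ_{e_i}`. -/
noncomputable def symmInv (i : Fin (n / 2 + 1)) : SymmAlg δ i →ₗ[k] SymmAlg δ i :=
  (symmBasis δ i).constr k fun σ => symmUnit δ i σ⁻¹

theorem symmInv_symmUnit (i : Fin (n / 2 + 1)) (σ : Equiv.Perm (Fin (level n i))) :
    symmInv δ i (symmUnit δ i σ) = symmUnit δ i σ⁻¹ := by
  rw [← symmBasis_apply]
  exact (symmBasis δ i).constr_basis k _ σ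

/-- Summing over all conjugates multiplies a central element by `n_i!`, which is invertible. Such
sums are invariant under inversion because `σ` and `σ⁻¹` have the same cycle type. -/
theorem symmInv_of_mem_center (hn : (n.factorial : k) ≠ 0) {i : Fin (n / 2 + 1)}
    {f : SymmAlg δ i} (hf : f ∈ Subring.center (SymmAlg δ i)) : symmInv δ i f = f := by
  let P : SymmAlg δ i →ₗ[k] SymmAlg δ i := ∑ τ : Equiv.Perm (Fin (level n i)),
    LinearMap.mulLeft k (symmUnit δ i τ) ∘ₗ LinearMap.mulRight k (symmUnit δ i τ⁻¹)
  have hP : ∀ σ, P (symmUnit δ i σ) =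
      ∑ τ : Equiv.Perm (Fin (level n i)), symmUnit δ i (τ * σ * τ⁻¹) := by
    intro σ
    simp only [P, LinearMap.sum_apply, LinearMap.comp_apply, LinearMap.mulLeft_apply,
      LinearMap.mulRight_apply, ← map_mul, mul_assoc]
  have hPinv : ∀ σ, symmInv δ i (P (symmUnit δ i σ)) = P (symmUnit δ i σ) := by
    intro σ
    obtain ⟨ρ, hρ⟩ := isConj_iff.1 (Equiv.Perm.isConj_of_cycleType_eq
      (Equiv.Perm.cycleType_inv σ).symm)
    rw [hP, map_sum]
    simp only [symmInv_symmUnit]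
    refine Fintype.sum_equiv (Equiv.mulRight ρ) _ _ fun τ => ?_
    rw [Equiv.coe_mulRight]
    congr 1
    have hinv : (τ * σ * τ⁻¹)⁻¹ = τ * σ⁻¹ * τ⁻¹ := by group
    rw [hinv, ← hρ]
    group
  have hcomp : symmInv δ i ∘ₗ P = P := (symmBasis δ i).ext fun σ => by
    rw [symmBasis_apply, LinearMap.comp_apply, hPinv]
  have hPf : P f = (Fintype.card (Equiv.Perm (Fin (level n i))) : k) • f := by
    have : ∀ τ, symmUnit δ i τ * (f * symmUnit δ i τ⁻¹) = f := fun τ => by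
      rw [← mul_assoc, Subring.mem_center_iff.1 hf, mul_assoc, ← map_mul, mul_inv_cancel,
        map_one, mul_one]
    simp only [P, LinearMap.sum_apply, LinearMap.comp_apply, LinearMap.mulLeft_apply,
      LinearMap.mulRight_apply, this]
    rw [Finset.sum_const, Finset.card_univ, Nat.cast_smul_eq_nsmul]
  have hcard : (Fintype.card (Equiv.Perm (Fin (level n i))) : k) ≠ 0 := by
    intro h
    rw [Fintype.card_perm, Fintype.card_fin] at h
    obtain ⟨c, hc⟩ := Nat.factorial_dvd_factorial (level_le i)
    exact hn (by rw [hc, Nat.cast_mul, h, zero_mul])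
  have := LinearMap.congr_fun hcomp f
  rw [LinearMap.comp_apply, hPf, map_smul] at this
  exact (smul_right_injective _ hcard) this

/-- On permutations both sides are single diagrams without scalars, and reflection reverses
products, fixes `e_j` and inverts permutations; bilinearity does the rest. -/
theorem flipHom_mul_mul {i j : Fin (n / 2 + 1)} (h : j ≤ i) (b : SymmAlg δ i) (c : SymmAlg δ j) :
    flipHom δ (symmIncl δ j c * diag n δ (idem j) * symmIncl δ i b) =
      symmIncl δ i (symmInv δ i b) * diag n δ (idem j) * symmIncl δ j (symmInv δ j c) := by
  have : ((LinearMap.mul k (BrauerAlg n δ)).compl₁₂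
        (LinearMap.mulRight k (diag n δ (idem j)) ∘ₗ symmIncl δ j) (symmIncl δ i)).compr₂
          (flipHom δ) =
      ((LinearMap.mul k (BrauerAlg n δ)).compl₁₂
        (LinearMap.mulRight k (diag n δ (idem j)) ∘ₗ symmIncl δ i ∘ₗ symmInv δ i)
        (symmIncl δ j ∘ₗ symmInv δ j)).flip := by
    refine LinearMap.ext_basis (symmBasis δ j) (symmBasis δ i) fun τ σ => ?_
    simp only [LinearMap.compr₂_apply, LinearMap.compl₁₂_apply, LinearMap.mul_apply',
      LinearMap.flip_apply, LinearMap.comp_apply, LinearMap.mulRight_apply, symmBasis_apply,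
      symmInv_symmUnit]
    rw [symmUnit_mul_idem_mul_symmUnit' δ h, symmUnit_mul_idem_mul_symmUnit δ h, flipHom_diag,
      flip_mul, flip_mul, permDiagram_flip, permDiagram_flip, flip_idem, mul_assoc]
  exact LinearMap.congr_fun₂ this c b

/-- The relation between two blocks is detected by the idempotent diagram `e_j`. -/
theorem exists_notMem_spanLT_iff (hn : (n.factorial : k) ≠ 0) {i j : Fin (n / 2 + 1)}
    (hij : j ≤ i) {f : SymmAlg δ i} {g : SymmAlg δ j} (hf : f ∈ Subring.center (SymmAlg δ i))
    (hg : g ∈ Subring.center (SymmAlg δ j)) :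
    ((∃ a ∈ spanLE (idem (n := n)) (brauerCocycle n δ) j, symmIncl δ i f * a * symmIncl δ j g ∉
        spanLT (idem (n := n)) (brauerCocycle n δ) j) ∨
      (∃ a ∈ spanLE (idem (n := n)) (brauerCocycle n δ) j, symmIncl δ j g * a * symmIncl δ i f ∉
        spanLT (idem (n := n)) (brauerCocycle n δ) j)) ↔
      symmIncl δ i f * diag n δ (idem j) * symmIncl δ j g ∉
        spanLT (idem (n := n)) (brauerCocycle n δ) j := by
  constructor
  · rintro (⟨a, ha, h⟩ | ⟨a, ha, h⟩) h'
    · exact h (mul_mul_mem_spanLT δ hij hf hg h' ha)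
    · refine h (mul_mul_mem_spanLT' δ hij hf hg ?_ ha)
      have hflip : ∀ x : BrauerAlg n δ, flipHom δ (flipHom δ x) = x := fun x =>
        LinearMap.congr_fun (f := flipHom δ ∘ₗ flipHom δ) (g := LinearMap.id)
          ((diag n δ).ext fun t => by
            rw [LinearMap.comp_apply, flipHom_diag, flipHom_diag, flip_flip, LinearMap.id_apply]) x
      -- Reflection preserves `J_{j-1}` and carries `g e_j f` to `f e_j g`, as it fixes the central
      -- elements `f` and `g`.
      have h2 := flipHom_mul_mul δ hij f g
      rw [symmInv_of_mem_center δ hn hf, symmInv_of_mem_center δ hn hg] at h2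
      rw [← hflip (symmIncl δ j g * _ * _), h2]
      exact flipHom_mem_spanLT δ h'
  · exact fun h => Or.inl ⟨_, mem_spanLE_idem δ j, h⟩

end BrauerDiagram

end TwistedBrauer

namespace TwistedBrauer

namespace BrauerDiagram

variable {n : ℕ} {k : Type*} [Field k] (δ : kˣ)

/-! ### Restrictions to Young subgroups -/

section Restriction

variable {V V' V'' : Type*} [AddCommGroup V] [Module k V] [AddCommGroup V'] [Module k V']
  [AddCommGroup V''] [Module k V'']

/-- There is a nonzero `𝔖_{n_j}`-equivariant map from `V'` to the restriction of `V` whose image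
consists of invariants of the remaining factors `𝔖_2` of the standard Young subgroup. -/
def RestrictsTo {i j : Fin (n / 2 + 1)} (h : j ≤ i)
    (ρ : Representation k (Equiv.Perm (Fin (level n i))) V)
    (ρ' : Representation k (Equiv.Perm (Fin (level n j))) V') : Prop :=
  ∃ φ : V' →ₗ[k] V, φ ≠ 0 ∧
    (∀ σ v, ρ (extHom (level_mono.2 h) σ) (φ v) = φ (ρ' σ v)) ∧
    ∀ a b : Fin (level n i), level n j ≤ a → level n j ≤ b →
      (a - level n j) / 2 = (b - level n j) / 2 → ∀ v, ρ (Equiv.swap a b) (φ v) = φ v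

theorem extHom_swap {a b : ℕ} (h : a ≤ b) (p q : Fin a) :
    extHom h (Equiv.swap p q) = Equiv.swap (p.castLE h) (q.castLE h) := by
  ext x
  have hinj := Fin.castLE_injective h
  by_cases hx : (x : ℕ) < a
  · obtain ⟨y, rfl⟩ : ∃ y : Fin a, y.castLE h = x := ⟨⟨x, hx⟩, rfl⟩
    rw [extHom_castLE, ← hinj.map_swap]
  · rw [extHom_of_le _ _ _ (by omega), Equiv.swap_apply_of_ne_of_ne]
    · rintro rfl
      exact hx p.2
    · rintro rfl
      exact hx q.2

theorem swap_mul_extHom {a b : ℕ} (h : a ≤ b) (σ : Equiv.Perm (Fin a)) {p q : Fin b}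
    (hp : a ≤ (p : ℕ)) (hq : a ≤ (q : ℕ)) :
    Equiv.swap p q * extHom h σ = extHom h σ * Equiv.swap p q := by
  rw [Equiv.mul_swap_eq_swap_mul, extHom_of_le _ _ _ hp, extHom_of_le _ _ _ hq]

/-- The position of a node in the decomposition of the nodes according to the Young subgroup. -/
def youngEquiv {i j : Fin (n / 2 + 1)} (h : j < i) :
    Fin (level n j) ⊕ (Σ _ : Fin ((i : ℕ) - j), Fin 2) ≃ Fin (level n i) :=
  ((Equiv.refl _).sumCongr ((Equiv.sigmaEquivProd _ _).trans finProdFinEquiv)).trans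
    (finSumFinEquiv.trans (finCongr (level_eq h)))

theorem youngHom_apply {i j : Fin (n / 2 + 1)} (h : j < i) (σ : Equiv.Perm (Fin (level n j)))
    (π : Fin ((i : ℕ) - j) → Equiv.Perm (Fin 2)) (x) :
    youngHom h (σ, π) (youngEquiv h x) =
      youngEquiv h (Sum.map σ (Sigma.map id fun q => π q) x) := by
  change youngEquiv h (Equiv.Perm.sumCongrHom _ _ (σ, Equiv.Perm.sigmaCongrRightHom _ π)
    ((youngEquiv h).symm (youngEquiv h x))) = _
  rw [Equiv.symm_apply_apply]
  rcases x with p | ⟨q, r⟩ <;> rfl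

theorem youngEquiv_inl {i j : Fin (n / 2 + 1)} (h : j < i) (p : Fin (level n j)) :
    youngEquiv h (.inl p) = p.castLE (level_mono.2 h.le) := rfl

theorem youngEquiv_inr_val {i j : Fin (n / 2 + 1)} (h : j < i) (q : Fin ((i : ℕ) - j))
    (r : Fin 2) : (youngEquiv h (.inr ⟨q, r⟩) : ℕ) = level n j + (r + 2 * q) := rfl

theorem youngHom_one_right {i j : Fin (n / 2 + 1)} (h : j < i)
    (σ : Equiv.Perm (Fin (level n j))) :
    youngHom h (σ, 1) = extHom (level_mono.2 h.le) σ := by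
  ext1 x
  obtain ⟨x, rfl⟩ := (youngEquiv h).surjective x
  rw [youngHom_apply]
  rcases x with p | ⟨q, r⟩
  · rw [youngEquiv_inl, extHom_castLE]
    rfl
  · rw [extHom_of_le]
    · rfl
    · rw [youngEquiv_inr_val]
      omega

theorem youngHom_mulSingle_swap {i j : Fin (n / 2 + 1)} (h : j < i) (q : Fin ((i : ℕ) - j)) :
    youngHom h (1, Pi.mulSingle q (Equiv.swap 0 1)) =
      Equiv.swap (youngEquiv h (.inr ⟨q, 0⟩)) (youngEquiv h (.inr ⟨q, 1⟩)) := by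
  ext1 x
  obtain ⟨x, rfl⟩ := (youngEquiv h).surjective x
  rw [youngHom_apply, ← (youngEquiv h).injective.map_swap]
  congr 1
  rcases x with p | ⟨q', r⟩
  · rw [Equiv.swap_apply_of_ne_of_ne (by simp) (by simp)]
    rfl
  · by_cases hq : q' = q
    · subst hq
      change Sum.inr (⟨q', (Pi.mulSingle q' (Equiv.swap 0 1) : Fin _ → Equiv.Perm (Fin 2)) q' r⟩ :
        Σ _ : Fin ((i : ℕ) - j), Fin 2) = _
      rw [Pi.mulSingle_eq_same]
      fin_cases r
      · simp
      · simp
    · rw [Equiv.swap_apply_of_ne_of_ne (by simp [hq]) (by simp [hq])]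
      change Sum.inr (⟨q', (Pi.mulSingle q (Equiv.swap 0 1) : Fin _ → Equiv.Perm (Fin 2)) q' r⟩ :
        Σ _ : Fin ((i : ℕ) - j), Fin 2) = _
      rw [Pi.mulSingle_eq_of_ne hq]
      rfl

/-- `RestrictsTo` tests equivariance on generators of the Young subgroup: `𝔖_{n_j}` and the
transposition of each factor `𝔖_2`. -/
theorem restrictsTo_iff_young {i j : Fin (n / 2 + 1)} (h : j < i)
    (ρ : Representation k (Equiv.Perm (Fin (level n i))) V)
    (ρ' : Representation k (Equiv.Perm (Fin (level n j))) V') :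
    RestrictsTo h.le ρ ρ' ↔ ∃ φ : V' →ₗ[k] V, φ ≠ 0 ∧
      ∀ x v, ρ (youngHom h x) (φ v) = φ (ρ' x.1 v) := by
  refine exists_congr fun φ => and_congr_right fun _ => ⟨?_, ?_⟩
  · rintro ⟨h1, h2⟩
    -- The elements of `𝔖_2 × ⋯ × 𝔖_2` that fix the image of `φ` form a subgroup; it contains every
    -- factor, hence is everything.
    let J : Subgroup (Fin ((i : ℕ) - j) → Equiv.Perm (Fin 2)) :=
      { carrier := {π | ∀ v, ρ (youngHom h (1, π)) (φ v) = φ v}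
        one_mem' := fun v => by
          rw [show ((1 : Equiv.Perm (Fin (level n j))), (1 : Fin _ → Equiv.Perm (Fin 2))) = 1
            from rfl, map_one, map_one]
          rfl
        mul_mem' := fun {π π'} hπ hπ' v => by
          rw [show ((1 : Equiv.Perm (Fin (level n j))), π * π') = (1, π) * (1, π') by simp,
            map_mul, map_mul, Module.End.mul_apply, hπ', hπ]
        inv_mem' := fun {π} hπ v => by
          conv_lhs => rw [← hπ v]
          rw [← Module.End.mul_apply, ← map_mul, ← map_mul]
          simp only [Prod.mk_mul_mk, inv_mul_cancel, mul_one]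
          rw [show ((1 : Equiv.Perm (Fin (level n j))), (1 : Fin _ → Equiv.Perm (Fin 2))) = 1
            from rfl, map_one, map_one]
          rfl }
    have hJ : ∀ π, π ∈ J := by
      intro π
      have hle : Subgroup.pi Set.univ (fun _ => ⊤) ≤ J := by
        rw [Subgroup.pi_le_iff]
        rintro q _ ⟨τ, -, rfl⟩
        have hτ : ∀ τ : Equiv.Perm (Fin 2), τ = 1 ∨ τ = Equiv.swap 0 1 := by decide
        rcases hτ τ with rfl | rfl
        · rw [map_one]
          exact J.one_mem
        · intro v
          change ρ (youngHom h (1, Pi.mulSingle q (Equiv.swap 0 1))) (φ v) = φ v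
          rw [youngHom_mulSingle_swap]
          refine h2 _ _ ?_ ?_ ?_ v <;> (simp only [youngEquiv_inr_val]; simp; try omega)
      exact hle (fun _ _ => trivial)
    rintro ⟨σ, π⟩ v
    rw [show (σ, π) = (σ, 1) * (1, π) by simp, map_mul, map_mul, Module.End.mul_apply, hJ π v,
      youngHom_one_right, h1]
    simp
  · intro h3
    have hsw : ∀ q : Fin ((i : ℕ) - j), ∀ v, ρ (Equiv.swap (youngEquiv h (.inr ⟨q, 0⟩))
        (youngEquiv h (.inr ⟨q, 1⟩))) (φ v) = φ v := by
      intro q v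
      rw [← youngHom_mulSingle_swap, h3, map_one]
      rfl
    refine ⟨fun σ v => ?_, fun a b ha hb hab v => ?_⟩
    · rw [← youngHom_one_right h, h3]
    · have hlev := level_eq h
      have hji : (j : ℕ) < i := h
      have ha' := a.2
      have hb' := b.2
      let q : Fin ((i : ℕ) - j) := ⟨(a - level n j) / 2, by omega⟩
      -- The condition on the halved differences says that `a` and `b` belong to the same pair, the
      -- one with number `q`.
      have hmem : ∀ c : Fin (level n i), level n j ≤ c → (c - level n j) / 2 = (q : ℕ) →
          c = youngEquiv h (.inr ⟨q, 0⟩) ∨ c = youngEquiv h (.inr ⟨q, 1⟩) := by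
        intro c hc hcq
        simp only [Fin.ext_iff, youngEquiv_inr_val]
        simp only [Fin.val_zero, Fin.val_one]
        omega
      rcases hmem a ha rfl with h4 | h4 <;> rcases hmem b hb hab.symm with h5 | h5 <;> rw [h4, h5]
      · rw [Equiv.swap_self]; exact LinearMap.congr_fun (map_one ρ) _
      · exact hsw q v
      · rw [Equiv.swap_comm]; exact hsw q v
      · rw [Equiv.swap_self]; exact LinearMap.congr_fun (map_one ρ) _

end Restriction

end BrauerDiagram

/-! ### Frobenius reciprocity -/

section Frobenius

open Representation

variable {k G H V W : Type*} [Field k] [Group G] [Group H] [AddCommGroup V] [Module k V]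
  [AddCommGroup W] [Module k W]

/-- The map from an induced representation that corresponds to an equivariant map. -/
noncomputable def indLift (f : G →* H) (τ : Representation k G W) (ρ : Representation k H V)
    (φ : W →ₗ[k] V) (hφ : ∀ g w, ρ (f g) (φ w) = φ (τ g w)) : IndV f τ →ₗ[k] V :=
  -- The inverse in `ρ h⁻¹` matches the convention that `H` acts on the induced representation by
  -- right multiplication with inverses.
  Coinvariants.lift _
    (TensorProduct.lift <| (Finsupp.lift _ _ _ fun h => ρ h⁻¹ ∘ₗ φ) ∘ₗ
      (MonoidAlgebra.coeffLinearEquiv k).toLinearMap)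
    fun g ↦ by
      ext h x
      simp only [LinearMap.coe_comp, Function.comp_apply, MonoidAlgebra.lsingle_apply]
      simp [mul_inv_rev, ← hφ]

theorem indLift_mk (f : G →* H) (τ : Representation k G W) (ρ : Representation k H V)
    (φ : W →ₗ[k] V) (hφ : ∀ g w, ρ (f g) (φ w) = φ (τ g w)) (h : H) (w : W) :
    indLift f τ ρ φ hφ (IndV.mk f τ h w) = ρ h⁻¹ (φ w) := by
  simp [indLift]

theorem indLift_ind (f : G →* H) (τ : Representation k G W) (ρ : Representation k H V)
    (φ : W →ₗ[k] V) (hφ : ∀ g w, ρ (f g) (φ w) = φ (τ g w)) (h : H) (x : IndV f τ) :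
    indLift f τ ρ φ hφ (ind f τ h x) = ρ h (indLift f τ ρ φ hφ x) := by
  have : indLift f τ ρ φ hφ ∘ₗ ind f τ h = ρ h ∘ₗ indLift f τ ρ φ hφ := by
    refine IndV.hom_ext _ _ fun h' => LinearMap.ext fun w => ?_
    simp only [LinearMap.comp_apply (indLift _ _ _ _ _), LinearMap.comp_apply (ρ h),
      LinearMap.comp_apply (_ ∘ₗ _)]
    rw [ind_mk, indLift_mk, indLift_mk, mul_inv_rev, inv_inv, map_mul, Module.End.mul_apply]
  exact LinearMap.congr_fun this x

/-- This is the defining relation of the coinvariants, applied to `g` and `(f g)⁻¹ ⊗ w`. -/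
theorem indV_mk_apply (f : G →* H) (τ : Representation k G W) (g : G) (w : W) :
    IndV.mk f τ 1 (τ g w) = ind f τ (f g) (IndV.mk f τ 1 w) := by
  rw [ind_mk, one_mul]
  have := Coinvariants.mk_self_apply (tprod ((leftRegular k H).comp f) τ) g
    (TensorProduct.tmul k (MonoidAlgebra.single (f g)⁻¹ 1) w)
  rw [Representation.tprod_apply, TensorProduct.map_tmul] at this
  simpa using this

/-- An irreducible representation is a direct summand of an induced representation if and only if
there is a nonzero equivariant map to it. -/
theorem isDirectSummand_ind_iff [Fintype H] (hcard : (Fintype.card H : k) ≠ 0) (f : G →* H)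
    (τ : Representation k G W) (ρ : Representation k H V) [Nontrivial V]
    (hρ : ∀ U : Submodule k V, (∀ h, ∀ u ∈ U, ρ h u ∈ U) → U = ⊥ ∨ U = ⊤) :
    IsDirectSummand ρ (ind f τ) ↔
      ∃ φ : W →ₗ[k] V, φ ≠ 0 ∧ ∀ g w, ρ (f g) (φ w) = φ (τ g w) := by
  constructor
  · rintro ⟨F, P, hPF⟩
    refine ⟨P.toLinearMap ∘ₗ IndV.mk f τ 1, fun h0 => ?_, fun g w => ?_⟩
    -- The vectors `mk 1 w` generate the induced representation, so an equivariant map vanishing on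
    -- them is zero.
    · have hP : P.toLinearMap = 0 := by
        refine IndV.hom_ext _ _ fun h => LinearMap.ext fun w => ?_
        have h1 : IndV.mk f τ h w = ind f τ h⁻¹ (IndV.mk f τ 1 w) := by
          rw [ind_mk, one_mul, inv_inv]
        change P (IndV.mk f τ h w) = 0
        rw [h1, P.isIntertwining, show P (IndV.mk f τ 1 w) = 0 from LinearMap.congr_fun h0 w,
          map_zero]
      obtain ⟨v, hv⟩ := exists_ne (0 : V)
      apply hv
      rw [← hPF v]
      exact LinearMap.congr_fun hP (F v)
    · change ρ (f g) (P (IndV.mk f τ 1 w)) = P (IndV.mk f τ 1 (τ g w))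
      rw [indV_mk_apply, P.isIntertwining]
  · rintro ⟨φ, hφ0, hφ⟩
    let P := indLift f τ ρ φ hφ
    -- The range is stable under `H` and nonzero, so irreducibility makes `P` surjective.
    have hrange : LinearMap.range P = ⊤ := by
      refine (hρ _ ?_).resolve_left fun h0 => hφ0 ?_
      · rintro h _ ⟨x, rfl⟩
        exact ⟨ind f τ h x, indLift_ind f τ ρ φ hφ h x⟩
      · rw [LinearMap.range_eq_bot] at h0
        ext w
        have h1 := indLift_mk f τ ρ φ hφ 1 w
        rw [inv_one, map_one, Module.End.one_apply] at h1
        rw [← h1]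
        exact LinearMap.congr_fun h0 _
    obtain ⟨s, hs⟩ := P.exists_rightInverse_of_surjective hrange
    -- Maschke's averaging turns the linear section `s` of `P` into an equivariant one.
    let F : V →ₗ[k] IndV f τ := (Fintype.card H : k)⁻¹ •
      ∑ h : H, ind f τ h ∘ₗ s ∘ₗ ρ h⁻¹
    have hF : ∀ v, F v = (Fintype.card H : k)⁻¹ • ∑ h : H, ind f τ h (s (ρ h⁻¹ v)) := by
      intro v
      simp only [F, LinearMap.smul_apply, LinearMap.sum_apply, LinearMap.comp_apply]
    refine ⟨⟨F, fun g => LinearMap.ext fun v => ?_⟩,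
      ⟨P, fun h => LinearMap.ext fun x => indLift_ind f τ ρ φ hφ h x⟩, fun v => ?_⟩
    · rw [LinearMap.comp_apply, LinearMap.comp_apply, hF, hF, map_smul, map_sum]
      congr 1
      symm
      refine Fintype.sum_equiv (Equiv.mulLeft g) _ _ fun h => ?_
      rw [Equiv.coe_mulLeft, map_mul, Module.End.mul_apply, mul_inv_rev, map_mul,
        Module.End.mul_apply, ← Module.End.mul_apply (ρ g⁻¹), ← map_mul, inv_mul_cancel, map_one,
        Module.End.one_apply]
    · change P (F v) = v
      rw [hF, map_smul, map_sum]
      have : ∀ h : H, P (ind f τ h (s (ρ h⁻¹ v))) = v := by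
        intro h
        rw [indLift_ind]
        change ρ h (P (s (ρ h⁻¹ v))) = v
        rw [show P (s (ρ h⁻¹ v)) = ρ h⁻¹ v from LinearMap.congr_fun hs _,
          ← Module.End.mul_apply, ← map_mul, mul_inv_cancel, map_one, Module.End.one_apply]
      simp only [this]
      rw [Finset.sum_const, Finset.card_univ, ← Nat.cast_smul_eq_nsmul k, smul_smul,
        inv_mul_cancel₀ hcard, one_smul]

end Frobenius

namespace BrauerDiagram

variable {n : ℕ} {k : Type*} [Field k]

/-- Frobenius reciprocity, after the trivial tensor factor has been removed through `V' ⊗ k ≅ V'`.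
-/
theorem isDirectSummand_youngInd_iff (hn : (n.factorial : k) ≠ 0) {V V' : Type*} [AddCommGroup V]
    [Module k V] [AddCommGroup V'] [Module k V'] [Nontrivial V] {i j : Fin (n / 2 + 1)}
    (h : j < i) (ρ : Representation k (Equiv.Perm (Fin (level n i))) V)
    (ρ' : Representation k (Equiv.Perm (Fin (level n j))) V')
    (hρ : ∀ U : Submodule k V, (∀ h, ∀ u ∈ U, ρ h u ∈ U) → U = ⊥ ∨ U = ⊤) :
    IsDirectSummand ρ (youngInd h ρ') ↔ RestrictsTo h.le ρ ρ' := by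
  have hcard : (Fintype.card (Equiv.Perm (Fin (level n i))) : k) ≠ 0 := by
    intro h
    rw [Fintype.card_perm, Fintype.card_fin] at h
    obtain ⟨c, hc⟩ := Nat.factorial_dvd_factorial (level_le i)
    exact hn (by rw [hc, Nat.cast_mul, h, zero_mul])
  rw [restrictsTo_iff_young, youngInd, isDirectSummand_ind_iff hcard _ _ _ hρ]
  constructor
  · rintro ⟨φ, h0, hφ⟩
    refine ⟨φ ∘ₗ (TensorProduct.rid k V').symm.toLinearMap, fun h1 => h0 ?_, fun x v => ?_⟩
    · ext v
      simpa using LinearMap.congr_fun h1 v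
    · have := hφ x (TensorProduct.tmul k v 1)
      rw [Representation.tprod_apply, TensorProduct.map_tmul] at this
      simpa using this
  · rintro ⟨φ, h0, hφ⟩
    refine ⟨φ ∘ₗ (TensorProduct.rid k V').toLinearMap, fun h1 => h0 ?_, fun x w => ?_⟩
    · ext v
      simpa using LinearMap.congr_fun h1 (TensorProduct.tmul k v 1)
    · induction w using TensorProduct.induction_on with
      | zero => simp
      | add a b ha hb => simp only [map_add, ha, hb]
      | tmul v c =>
        rw [Representation.tprod_apply, TensorProduct.map_tmul]
        simp [hφ]

end BrauerDiagram

end TwistedBrauer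

namespace TwistedBrauer

namespace BrauerDiagram

variable {n : ℕ} {k : Type*} [Field k] (δ : kˣ)

/-! ### Comparison of the relation between blocks with restriction -/

/-- The permutations span `k_α Γ_{e_i}`, so a subspace stable under them is a submodule. -/
theorem eq_bot_or_eq_top_of_stable {i : Fin (n / 2 + 1)} {V : Type*} [AddCommGroup V]
    [Module k V] [Module (SymmAlg δ i) V] [IsScalarTower k (SymmAlg δ i) V]
    [IsSimpleModule (SymmAlg δ i) V] (U : Submodule k V)
    (hU : ∀ σ, ∀ u ∈ U, symmRep δ i V σ u ∈ U) : U = ⊥ ∨ U = ⊤ := by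
  rcases eq_bot_or_eq_top (stableSubmodule δ U hU) with h | h
  · left
    rw [eq_bot_iff]
    intro u hu
    have : u ∈ stableSubmodule δ U hU := hu
    rw [h] at this
    exact this
  · right
    rw [eq_top_iff]
    intro u _
    have : u ∈ stableSubmodule δ U hU := h ▸ Submodule.mem_top
    exact this

theorem unitHom_swap_mul {t : BrauerDiagram n} {a b : Fin n} (h : t.rel (.inl a) (.inl b)) :
    unitHom n (Equiv.swap a b) * t = t := by
  change unitDiagram _ * t = t
  rw [unitDiagram_mul, Equiv.swap_inv]
  have key : ∀ x, t.rel x (Equiv.sumCongr (Equiv.swap a b) 1 x) := by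
    rintro (p | p)
    · change t.rel (.inl p) (.inl (Equiv.swap a b p))
      rcases eq_or_ne p a with rfl | ha
      · rwa [Equiv.swap_apply_left]
      · rcases eq_or_ne p b with rfl | hb
        · rw [Equiv.swap_apply_right]
          exact Setoid.symm' _ h
        · rw [Equiv.swap_apply_of_ne_of_ne ha hb]
    · exact Setoid.refl' _ _
  refine (eq_of_le fun x y hxy => ?_).symm
  exact Setoid.trans' t.rel (Setoid.symm' _ (key x)) (Setoid.trans' t.rel hxy (key y))

/-- Exchanging the two ends of an arc changes nothing. These transpositions are the part of the
stabilizer of `e_j` that the Young subgroup contains. -/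
theorem permDiagram_swap_mul_idem {i j : Fin (n / 2 + 1)} (hij : j ≤ i) {a b : Fin (level n i)}
    (ha : level n j ≤ a) (hb : level n j ≤ b)
    (hab : (a - level n j) / 2 = (b - level n j) / 2) :
    permDiagram i (Equiv.swap a b) * idem j = idem j := by
  rw [permDiagram_mul_of_idem_mul (idem_mul_idem hij)]
  change unitHom n (extHom _ _) * _ = _
  rw [extHom_swap]
  exact unitHom_swap_mul ((idem_rel_inl_inl j _ _).2 (Or.inr ⟨ha, hb, hab⟩))

section

variable {V : Type*} [AddCommGroup V] [Module k V] {i j : Fin (n / 2 + 1)} (hij : j ≤ i)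

theorem swap_extHom_apply_eq (ρ : Representation k (Equiv.Perm (Fin (level n i))) V)
    {a b : Fin (level n i)} (ha : level n j ≤ a) (hb : level n j ≤ b) {v : V}
    (hv : ρ (Equiv.swap a b) v = v) (σ : Equiv.Perm (Fin (level n j))) :
    ρ (Equiv.swap a b) (ρ (extHom (level_mono.2 hij) σ) v) =
      ρ (extHom (level_mono.2 hij) σ) v := by
  rw [← Module.End.mul_apply, ← map_mul, swap_mul_extHom _ _ ha hb, map_mul,
    Module.End.mul_apply, hv]

/-- The invariants, in a representation of `𝔖_{n_i}`, of the factors `𝔖_2` of the standard Young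
subgroup `𝔖_{n_j} × 𝔖_2 × ⋯ × 𝔖_2`, as a `k_α Γ_{e_j}`-module. -/
noncomputable def youngInvariants (ρ : Representation k (Equiv.Perm (Fin (level n i))) V) :
    Submodule (SymmAlg δ j) (RepModule δ j (ρ.comp (extHom (level_mono.2 hij)))) :=
  stableSubmodule δ
    { carrier := {v : V | ∀ a b : Fin (level n i), level n j ≤ a → level n j ≤ b →
        (a - level n j) / 2 = (b - level n j) / 2 → ρ (Equiv.swap a b) v = v}
      zero_mem' := fun _ _ _ _ _ => map_zero (ρ _)
      add_mem' := fun {v w} hv hw a b ha hb hab =>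
        (map_add (ρ _) v w).trans (congrArg₂ _ (hv a b ha hb hab) (hw a b ha hb hab))
      smul_mem' := fun c v hv a b ha hb hab =>
        (map_smul (ρ _) c v).trans (congrArg _ (hv a b ha hb hab)) }
    fun σ v hv a b ha hb hab => by
      rw [symmUnit_smul_repModule]
      exact swap_extHom_apply_eq hij ρ ha hb (hv a b ha hb hab) σ

theorem mem_youngInvariants {ρ : Representation k (Equiv.Perm (Fin (level n i))) V} {v : V} :
    (show RepModule δ j (ρ.comp (extHom (level_mono.2 hij))) from v) ∈ youngInvariants δ hij ρ ↔
      ∀ a b : Fin (level n i), level n j ≤ a → level n j ≤ b →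
        (a - level n j) / 2 = (b - level n j) / 2 → ρ (Equiv.swap a b) v = v := Iff.rfl

/-- A nonzero homomorphism to the invariants exhibits a constituent of the restriction. -/
theorem restrictsTo_of_linearMap {ρ : Representation k (Equiv.Perm (Fin (level n i))) V}
    {V' : Type*} [AddCommGroup V'] [Module k V'] [Module (SymmAlg δ j) V']
    [IsScalarTower k (SymmAlg δ j) V'] {φ : V' →ₗ[SymmAlg δ j] youngInvariants δ hij ρ}
    (hφ : φ ≠ 0) : RestrictsTo hij ρ (symmRep δ j V') := by
  let ψ : V' →ₗ[SymmAlg δ j] RepModule δ j (ρ.comp (extHom (level_mono.2 hij))) :=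
    (youngInvariants δ hij ρ).subtype ∘ₗ φ
  refine ⟨(ψ.restrictScalars k : _ →ₗ[k] RepModule δ j (ρ.comp (extHom (level_mono.2 hij)))),
    fun h => hφ ?_, fun σ v => ?_, fun a b ha hb hab v => ?_⟩
  · ext v
    exact LinearMap.congr_fun h v
  · exact (symmUnit_smul_repModule δ _ σ (ψ v)).symm.trans (map_smul ψ (symmUnit δ j σ) v).symm
  · exact (φ v).2 a b ha hb hab

end

section

variable {i j : Fin (n / 2 + 1)} (hij : j ≤ i)

/-- The extension of permutations, as a map from `k_α Γ_{e_j}` to `k_α Γ_{e_i}`. -/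
noncomputable def symmExt : SymmAlg δ j →ₗ[k] SymmAlg δ i :=
  (symmBasis δ j).constr k fun σ => symmUnit δ i (extHom (level_mono.2 hij) σ)

theorem symmExt_symmUnit (σ : Equiv.Perm (Fin (level n j))) :
    symmExt δ hij (symmUnit δ j σ) = symmUnit δ i (extHom (level_mono.2 hij) σ) := by
  rw [← symmBasis_apply]
  exact (symmBasis δ j).constr_basis k _ σ

/-- A permutation of the first `n_j` nodes slides through the vertical lines of `e_j` and leaves the
arcs alone. -/
theorem symmIncl_symmExt_mul_idem (c : SymmAlg δ j) :
    symmIncl δ i (symmExt δ hij c) * diag n δ (idem j) = diag n δ (idem j) * symmIncl δ j c := by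
  have : LinearMap.mulRight k (diag n δ (idem j)) ∘ₗ symmIncl δ i ∘ₗ symmExt δ hij =
      LinearMap.mulLeft k (diag n δ (idem j)) ∘ₗ symmIncl δ j := by
    refine (symmBasis δ j).ext fun σ => ?_
    simp only [LinearMap.comp_apply, LinearMap.mulRight_apply, LinearMap.mulLeft_apply,
      symmBasis_apply, symmExt_symmUnit]
    rw [symmUnit_mul_diag δ (idem_mul_idem hij), diag_mul_symmUnit δ (isIdempotentElem_idem j).eq,
      permDiagram_ext_mul_idem hij, mul_permDiagram_of_mul_idem (isIdempotentElem_idem j).eq,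
      permDiagram_eq_idem_mul]
  exact LinearMap.congr_fun this c

variable {V V' : Type*} [AddCommGroup V] [Module k V] [Module (SymmAlg δ i) V]
  [IsScalarTower k (SymmAlg δ i) V]

theorem symmExt_smul (c : SymmAlg δ j) (v : V) : symmExt δ hij c • v =
    (c • (show RepModule δ j ((symmRep δ i V).comp (extHom (level_mono.2 hij))) from v) : V) := by
  have : (LinearMap.toSpanSingleton (SymmAlg δ i) V v).restrictScalars k ∘ₗ symmExt δ hij =
      ((LinearMap.toSpanSingleton (SymmAlg δ j)
        (RepModule δ j ((symmRep δ i V).comp (extHom (level_mono.2 hij)))) v).restrictScalars k :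
          SymmAlg δ j →ₗ[k] V) := by
    refine (symmBasis δ j).ext fun σ => ?_
    rw [LinearMap.comp_apply, symmBasis_apply, symmExt_symmUnit]
    exact (symmUnit_smul_repModule δ ((symmRep δ i V).comp (extHom (level_mono.2 hij))) σ v).symm
  exact LinearMap.congr_fun this c

variable [IsSimpleModule (SymmAlg δ i) V] [AddCommGroup V'] [Module k V']
  [Module (SymmAlg δ j) V'] [IsScalarTower k (SymmAlg δ j) V'] [IsSimpleModule (SymmAlg δ j) V']

/-- The left ideal `N` of all `b` with `b e_j g ∈ J_{j-1}` does not contain `f`, so it annihilates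
some `v ≠ 0` in `V`. This `v` imitates `e_j g`: if `b e_j g = e_j g`, then `b - 1 ∈ N` and `b • v =
v`. Hence `v` is fixed by the pair transpositions and by the extension of `g`, so the invariants
have a nonzero part in the block of `V'`. -/
theorem restrictsTo_of_notMem_spanLT (hn : (n.factorial : k) ≠ 0) {f : SymmAlg δ i}
    {g : SymmAlg δ j} (hf : IsBlockIdempotent V f) (hg : IsBlockIdempotent V' g)
    (h : symmIncl δ i f * diag n δ (idem j) * symmIncl δ j g ∉
      spanLT (idem (n := n)) (brauerCocycle n δ) j) :
    RestrictsTo hij (symmRep δ i V) (symmRep δ j V') := by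
  have := isSemisimpleRing_symmAlg δ hn i
  have := isSemisimpleRing_symmAlg δ hn j
  let N : Submodule (SymmAlg δ i) (SymmAlg δ i) :=
    { carrier := {b | symmIncl δ i b * diag n δ (idem j) * symmIncl δ j g ∈
        spanLT (idem (n := n)) (brauerCocycle n δ) j}
      zero_mem' := by
        rw [Set.mem_ofPred_eq, map_zero, zero_mul, zero_mul]
        exact Submodule.zero_mem _
      add_mem' := fun {a b} ha hb => by
        rw [Set.mem_ofPred_eq, map_add, add_mul, add_mul]
        exact Submodule.add_mem _ ha hb
      smul_mem' := fun c b hb => by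
        rw [Set.mem_ofPred_eq, smul_eq_mul, GroupAlg.incl_mul, mul_assoc, mul_assoc]
        refine mul_mem_spanLT δ _ ?_
        rw [← mul_assoc]
        exact hb }
  obtain ⟨v, hv, hN⟩ := hf.exists_annihilated (N := N) h
  have hone : symmIncl δ i 1 * diag n δ (idem j) = diag n δ (idem j) := by
    rw [← map_one (symmUnit δ i), symmUnit_mul_diag δ (idem_mul_idem hij)]
    exact congrArg _ (idem_mul_idem hij)
  have hfix : ∀ b : SymmAlg δ i, symmIncl δ i b * diag n δ (idem j) * symmIncl δ j g =
      diag n δ (idem j) * symmIncl δ j g → b • v = v := by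
    intro b hb
    have h1 : b - 1 ∈ N := by
      change symmIncl δ i (b - 1) * diag n δ (idem j) * symmIncl δ j g ∈
        spanLT (idem (n := n)) (brauerCocycle n δ) j
      rw [map_sub, sub_mul, sub_mul, hone, hb, sub_self]
      exact Submodule.zero_mem _
    have h2 := hN _ h1
    rwa [sub_smul, one_smul, sub_eq_zero] at h2
  have hvW : (show RepModule δ j ((symmRep δ i V).comp (extHom (level_mono.2 hij))) from v) ∈
      youngInvariants δ hij (symmRep δ i V) := by
    rw [mem_youngInvariants]
    intro a b ha hb hab
    rw [symmRep_apply]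
    apply hfix
    rw [symmUnit_mul_diag δ (idem_mul_idem hij), permDiagram_swap_mul_idem hij ha hb hab]
  -- Sliding `g` through `e_j` gives `e_j g g = e_j g`.
  have hgv : symmExt δ hij g • v = v := by
    apply hfix
    rw [symmIncl_symmExt_mul_idem, mul_assoc, ← GroupAlg.incl_mul, hg.idempotent.eq]
  rw [symmExt_smul] at hgv
  obtain ⟨⟨φ, hφ⟩, -⟩ := hg.exists_maps
    (X := youngInvariants δ hij (symmRep δ i V)) (y := ⟨v, hvW⟩) (by
      intro h0
      apply hv
      rw [← hgv]
      exact congrArg Subtype.val h0)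
  exact restrictsTo_of_linearMap δ hij hφ

end

end BrauerDiagram

end TwistedBrauer

/-! ### The converse for adjacent levels -/

namespace TwistedBrauer

namespace BrauerDiagram

variable {n : ℕ} {k : Type*} [Field k] (δ : kˣ)

theorem apply_eq_of_permDiagram_mul_idem {i j : Fin (n / 2 + 1)} (hij : j ≤ i)
    {κ : Equiv.Perm (Fin (level n i))} (h : permDiagram i κ * idem j = idem j)
    (p : Fin (level n i)) (hp : (p : ℕ) < level n j) : κ p = p := by
  rw [permDiagram_mul_of_idem_mul (idem_mul_idem hij)] at h
  have hκ : (extHom (level_le i) κ)⁻¹ ((κ p).castLE (level_le i)) = p.castLE (level_le i) := by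
    rw [Equiv.Perm.inv_eq_iff_eq, extHom_castLE]
  have h1 : (idem j).rel (.inl ((κ p).castLE (level_le i))) (.inr (p.castLE (level_le i))) := by
    rw [← h]
    change (unitDiagram (extHom (level_le i) κ) * idem j).rel _ _
    rw [unitDiagram_mul]
    change (idem j).rel (.inl ((extHom (level_le i) κ)⁻¹ _)) (.inr _)
    rw [hκ, idem_rel_inl_inr]
    exact ⟨rfl, hp⟩
  exact Fin.castLE_injective _ ((idem_rel_inl_inr _ _ _).1 h1).1

/-- The stabilizer of `e_j` for adjacent levels. -/
theorem eq_one_or_swap_of_permDiagram_mul_idem {i j : Fin (n / 2 + 1)}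
    (hij : (j : ℕ) + 1 = i) {κ : Equiv.Perm (Fin (level n i))}
    (h : permDiagram i κ * idem j = idem j) :
    ∃ a b : Fin (level n i), level n j ≤ a ∧ level n j ≤ b ∧
      (a - level n j) / 2 = (b - level n j) / 2 ∧ κ = Equiv.swap a b := by
  have hji : j < i := by rw [Fin.lt_def]; omega
  have hlev : level n j + 2 = level n i := by
    have := level_eq hji
    omega
  have hfix := apply_eq_of_permDiagram_mul_idem hji.le h
  have hbig : ∀ p : Fin (level n i), level n j ≤ p → level n j ≤ κ p := by
    intro p hp
    by_contra hlt
    have h1 := hfix (κ p) (by omega)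
    have h2 := κ.injective h1
    rw [h2] at hlt
    exact hlt hp
  let a : Fin (level n i) := ⟨level n j, by omega⟩
  let b : Fin (level n i) := ⟨level n j + 1, by omega⟩
  have hab : a ≠ b := by simp [a, b, Fin.ext_iff]
  have hcases : ∀ p : Fin (level n i), level n j ≤ p → p = a ∨ p = b := by
    intro p hp
    have := p.2
    simp only [a, b, Fin.ext_iff]
    omega
  have ha := hcases _ (hbig a le_rfl)
  have hb := hcases _ (hbig b (Nat.le_succ _))
  have hne : κ a ≠ κ b := fun h => hab (κ.injective h)
  rcases ha with ha | ha
  · have hb : κ b = b := hb.resolve_left fun h => hne (ha.trans h.symm)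
    -- The identity is covered as the degenerate transposition `swap a a`.
    refine ⟨a, a, le_rfl, le_rfl, rfl, ?_⟩
    rw [Equiv.swap_self]
    ext1 p
    by_cases hp : (p : ℕ) < level n j
    · rw [hfix p hp]; rfl
    · rcases hcases p (by omega) with rfl | rfl
      · rw [ha]; rfl
      · rw [hb]; rfl
  · have hb : κ b = a := hb.resolve_right fun h => hne (ha.trans h.symm)
    refine ⟨a, b, le_rfl, Nat.le_succ _, ?_, ?_⟩
    · simp only [a, b]; omega
    ext1 p
    by_cases hp : (p : ℕ) < level n j
    · rw [hfix p hp, Equiv.swap_apply_of_ne_of_ne]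
      · rintro rfl
        simp [a] at hp
      · rintro rfl
        simp [b] at hp
    · rcases hcases p (by omega) with rfl | rfl
      · rw [ha, Equiv.swap_apply_left]
      · rw [hb, Equiv.swap_apply_right]

section

variable {i j : Fin (n / 2 + 1)} {V V' : Type*} [AddCommGroup V] [Module k V]
  [Module (SymmAlg δ i) V] [IsScalarTower k (SymmAlg δ i) V] [IsSimpleModule (SymmAlg δ i) V]
  [AddCommGroup V'] [Module k V'] [Module (SymmAlg δ j) V'] [IsScalarTower k (SymmAlg δ j) V']
  [IsSimpleModule (SymmAlg δ j) V']

/-- A linear map `Φ` on the Brauer algebra detects `f e_j g`: it sends `σ e_j` to `σ ∘ φ` and all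
other diagrams to zero. It kills `J_{j-1}`, and `Φ (f e_j g) = f ∘ φ ∘ g = φ` is not zero. Adjacency
of the levels is what makes `Φ` well defined, as the stabilizer of `e_j` is then generated by a
single transposition. -/
theorem notMem_spanLT_of_restrictsTo (hij : (j : ℕ) + 1 = i) (hle : j ≤ i) {f : SymmAlg δ i}
    {g : SymmAlg δ j} (hf : IsBlockIdempotent V f) (hg : IsBlockIdempotent V' g)
    (h : RestrictsTo hle (symmRep δ i V) (symmRep δ j V')) :
    symmIncl δ i f * diag n δ (idem j) * symmIncl δ j g ∉
      spanLT (idem (n := n)) (brauerCocycle n δ) j := by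
  classical
  obtain ⟨φ, h0, hext, hsw⟩ := h
  intro hmem
  have hstab : ∀ κ, permDiagram i κ * idem j = idem j → ∀ v, symmRep δ i V κ (φ v) = φ v := by
    intro κ hκ
    obtain ⟨a, b, ha, hb, hab, rfl⟩ := eq_one_or_swap_of_permDiagram_mul_idem hij hκ
    exact hsw a b ha hb hab
  let Φ : BrauerAlg n δ →ₗ[k] V' →ₗ[k] V := (diag n δ).constr k fun s =>
    if hs : ∃ σ, s = permDiagram i σ * idem j then symmRep δ i V hs.choose ∘ₗ φ else 0
  have hΦ : ∀ s, Φ (diag n δ s) =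
      if hs : ∃ σ, s = permDiagram i σ * idem j then symmRep δ i V hs.choose ∘ₗ φ else 0 :=
    fun s => (diag n δ).constr_basis k _ s
  -- Independence of the chosen representative: two of them differ by an element stabilizing `e_j`,
  -- which fixes the image of `φ`.
  have hΦσ : ∀ σ, Φ (diag n δ (permDiagram i σ * idem j)) = symmRep δ i V σ ∘ₗ φ := by
    intro σ
    have hs : ∃ τ, permDiagram i σ * idem j = permDiagram i τ * idem j := ⟨σ, rfl⟩
    rw [hΦ, dif_pos hs]
    ext v
    have h1 : permDiagram i (σ⁻¹ * hs.choose) * idem j = idem j := by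
      rw [← permDiagram_mul, mul_assoc, ← hs.choose_spec, ← mul_assoc, permDiagram_mul,
        inv_mul_cancel]
      exact idem_mul_idem hle
    have h2 := hstab _ h1 v
    rw [map_mul, Module.End.mul_apply] at h2
    change symmRep δ i V hs.choose (φ v) = symmRep δ i V σ (φ v)
    conv_rhs => rw [← h2]
    rw [← Module.End.mul_apply (symmRep δ i V σ), ← map_mul, mul_inv_cancel, map_one,
      Module.End.one_apply]
  have hker : Φ (symmIncl δ i f * diag n δ (idem j) * symmIncl δ j g) = 0 := by
    refine spanLT_induction δ (W := LinearMap.ker Φ) (fun s hs => ?_) hmem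
    rw [LinearMap.mem_ker, hΦ, dif_neg]
    rintro ⟨σ, rfl⟩
    rw [permDiagram_mul_of_idem_mul (idem_mul_idem hle)] at hs
    change thr (unitHom n _ * idem j) < _ at hs
    rw [thr_unitHom_mul, thr_idem] at hs
    exact lt_irrefl _ hs
  have hbil : ∀ (b : SymmAlg δ i) (c : SymmAlg δ j) (v : V'),
      Φ (symmIncl δ i b * diag n δ (idem j) * symmIncl δ j c) v = b • φ (c • v) := by
    intro b c v
    have : ((LinearMap.mul k (BrauerAlg n δ)).compl₁₂
        (LinearMap.mulRight k (diag n δ (idem j)) ∘ₗ symmIncl δ i) (symmIncl δ j)).compr₂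
          (LinearMap.applyₗ v ∘ₗ Φ) =
        (Algebra.lsmul k k V).toLinearMap.compl₂
          (φ ∘ₗ (LinearMap.toSpanSingleton (SymmAlg δ j) V' v).restrictScalars k) := by
      refine LinearMap.ext_basis (symmBasis δ i) (symmBasis δ j) fun σ τ => ?_
      simp only [LinearMap.compr₂_apply, LinearMap.compl₁₂_apply, LinearMap.mul_apply',
        LinearMap.comp_apply, LinearMap.mulRight_apply, symmBasis_apply, LinearMap.compl₂_apply,
        LinearMap.applyₗ_apply_apply]
      -- Sliding `τ` to the left of `e_j` brings the diagram into the form on which `Φ` is known.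
      have h3 : permDiagram i σ * idem j * permDiagram j τ =
          permDiagram i (σ * extHom (level_mono.2 hle) τ) * idem j := by
        rw [← permDiagram_mul, mul_assoc _ _ (idem j), permDiagram_ext_mul_idem hle, mul_assoc]
        congr 1
        rw [mul_permDiagram_of_mul_idem (isIdempotentElem_idem j).eq, permDiagram_eq_idem_mul]
      rw [symmUnit_mul_idem_mul_symmUnit δ hle, h3, hΦσ, LinearMap.comp_apply, map_mul,
        Module.End.mul_apply, hext]
      rfl
    exact LinearMap.congr_fun₂ this b c
  apply h0
  ext v
  have := hbil f g v
  rw [hker, hg.smul_eq, hf.smul_eq] at this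
  exact this.symm

end

/-! ### Transitivity and interpolation of restrictions -/

section Composition

variable {V V' V'' : Type*} [AddCommGroup V] [Module k V] [AddCommGroup V'] [Module k V']
  [AddCommGroup V''] [Module k V'']

theorem level_parity (i j : Fin (n / 2 + 1)) : level n i % 2 = level n j % 2 := by
  have h1 := level_add (n := n) i
  have h2 := level_add (n := n) j
  omega

/-- Simplicity of the middle module makes `φ` injective, so the composite is nonzero. Pairs beyond
`n_j` fix the image of `φ`; those between `n_m` and `n_j` act through the equivariance of `φ` and
fix the image of `ψ`. -/
theorem RestrictsTo.trans {i j m : Fin (n / 2 + 1)} (hij : j ≤ i) (hjm : m ≤ j)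
    [Module (SymmAlg δ j) V'] [IsScalarTower k (SymmAlg δ j) V'] [IsSimpleModule (SymmAlg δ j) V']
    {ρ : Representation k (Equiv.Perm (Fin (level n i))) V}
    {ρ'' : Representation k (Equiv.Perm (Fin (level n m))) V''}
    (h : RestrictsTo hij ρ (symmRep δ j V')) (h' : RestrictsTo hjm (symmRep δ j V') ρ'') :
    RestrictsTo (hjm.trans hij) ρ ρ'' := by
  obtain ⟨φ, h0, h1, h2⟩ := h
  obtain ⟨ψ, h0', h1', h2'⟩ := h'
  have hinj : LinearMap.ker φ = ⊥ := by
    refine (eq_bot_or_eq_top_of_stable δ (i := j) (LinearMap.ker φ) fun σ v hv => ?_).resolve_right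
      fun h => h0 (LinearMap.ker_eq_top.1 h)
    rw [LinearMap.mem_ker] at hv ⊢
    rw [← h1, hv, map_zero]
  refine ⟨φ ∘ₗ ψ, fun h => h0' ?_, fun σ v => ?_, fun a b ha hb hab v => ?_⟩
  · ext v
    exact LinearMap.ker_eq_bot.1 hinj ((LinearMap.congr_fun h v).trans (map_zero φ).symm)
  · rw [LinearMap.comp_apply, LinearMap.comp_apply, ← h1', ← h1, extHom_extHom]
  · rw [LinearMap.comp_apply]
    have hp1 := level_parity m j
    have hle := level_mono.2 hjm
    -- All levels have the same parity, so no pair straddles `n_j`.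
    by_cases hja : level n j ≤ a
    · exact h2 a b hja (by omega) (by omega) _
    · have hjb : (b : ℕ) < level n j := by omega
      have h3 := extHom_swap (level_mono.2 hij) ⟨a, by omega⟩ ⟨b, hjb⟩
      rw [show Equiv.swap a b = _ from h3.symm, h1, h2' _ _ ha hb hab]

/-- The image of `φ` lies in the space `W` of invariants of the pairs beyond `n_j`, a semisimple
module at level `j`. A simple submodule `M` of `W` with a projection not killing `φ v₀` does both
jobs: its inclusion gives the first restriction, and `φ` followed by the projection gives the
second. -/
theorem RestrictsTo.exists_intermediate (hn : (n.factorial : k) ≠ 0) {V : Type u}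
    [AddCommGroup V] [Module k V] {i j m : Fin (n / 2 + 1)} (hij : j ≤ i) (hjm : m ≤ j)
    {ρ : Representation k (Equiv.Perm (Fin (level n i))) V}
    {ρ'' : Representation k (Equiv.Perm (Fin (level n m))) V''}
    (h : RestrictsTo (hjm.trans hij) ρ ρ'') {ι : Type*} {T : ι → Type u}
    [∀ r, AddCommGroup (T r)] [∀ r, Module k (T r)] [∀ r, Module (SymmAlg δ j) (T r)]
    [∀ r, IsScalarTower k (SymmAlg δ j) (T r)]
    (hT : ∀ (M : Type u) [AddCommGroup M] [Module (SymmAlg δ j) M] [IsSimpleModule (SymmAlg δ j) M],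
      ∃ r, Nonempty (M ≃ₗ[SymmAlg δ j] T r)) :
    ∃ r, RestrictsTo hij ρ (symmRep δ j (T r)) ∧ RestrictsTo hjm (symmRep δ j (T r)) ρ'' := by
  have := isSemisimpleRing_symmAlg δ hn j
  obtain ⟨φ, h0, h1, h2⟩ := h
  have hp1 := level_parity m j
  have hle := level_mono.2 hjm
  let W := youngInvariants δ hij ρ
  let φ' : V'' → W := fun v => ⟨φ v, (mem_youngInvariants δ hij).2 fun a b ha hb hab =>
    h2 a b (by omega) (by omega) (by omega) v⟩
  obtain ⟨v₀, hv₀⟩ : ∃ v, φ v ≠ 0 := by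
    by_contra! hall
    exact h0 (LinearMap.ext hall)
  obtain ⟨M, p, hM, -, hp, -⟩ := exists_simple_projection (R := SymmAlg δ j) (y := φ' v₀)
    fun h => hv₀ (congrArg Subtype.val h)
  obtain ⟨r, ⟨e⟩⟩ := hT M
  refine ⟨r, restrictsTo_of_linearMap δ hij (φ := M.subtype ∘ₗ e.symm.toLinearMap) fun h => hp ?_,
    ?_⟩
  · have h3 := LinearMap.congr_fun h (e (p (φ' v₀)))
    apply Subtype.val_injective
    simpa using h3
  · let ψ : W →ₗ[SymmAlg δ j] T r := e.toLinearMap ∘ₗ p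
    have hadd : ∀ v w, φ' (v + w) = φ' v + φ' w := fun v w => Subtype.ext (map_add φ v w)
    -- The map `ψ` is linear over `SymmAlg δ j`, so scalars from `k` are passed through
    -- `algebraMap`.
    have hsmul : ∀ (c : k) v, φ' (c • v) = algebraMap k (SymmAlg δ j) c • φ' v := fun c v =>
      Subtype.ext ((map_smul φ c v).trans
        (algebraMap_smul (A := SymmAlg δ j) c (φ' v).1).symm)
    have hunit : ∀ σ v, symmUnit δ j σ • ψ (φ' v) = ψ (symmUnit δ j σ • φ' v) := fun σ v =>
      (map_smul ψ _ _).symm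
    refine ⟨
      { toFun := fun v => ψ (φ' v)
        map_add' := fun v w => by rw [hadd, map_add]
        map_smul' := fun c v => by rw [hsmul, map_smul, algebraMap_smul, RingHom.id_apply] },
      fun h => hp (e.injective ?_), fun σ v => ?_, fun a b ha hb hab v => ?_⟩
    · rw [map_zero]
      exact LinearMap.congr_fun h v₀
    · change symmUnit δ j _ • ψ (φ' v) = ψ (φ' _)
      rw [hunit]
      congr 1
      apply Subtype.ext
      refine (symmUnit_smul_repModule δ _ _ (φ v)).trans ?_
      change ρ (extHom _ (extHom _ σ)) (φ v) = φ (ρ'' σ v)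
      rw [extHom_extHom, h1]
    · change symmUnit δ j _ • ψ (φ' v) = ψ (φ' _)
      rw [hunit]
      congr 1
      apply Subtype.ext
      refine (symmUnit_smul_repModule δ _ _ (φ v)).trans ?_
      change ρ (extHom _ (Equiv.swap a b)) (φ v) = φ v
      rw [extHom_swap]
      exact h2 _ _ ha hb hab v

end Composition

/-! ### The order relations on labels -/

theorem brauerCocycle_incl_left {i : Fin (n / 2 + 1)}
    (x : MaxSubgroup (isIdempotentElem_idem (n := n) i)) {t : BrauerDiagram n}
    (ht : ∃ s, t = idem i * s) :
    brauerCocycle n δ (MaxSubgroup.incl _ x) t = δ ^ (n / 2 - (i : ℕ)) := by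
  obtain ⟨s, rfl⟩ := ht
  obtain ⟨σ, rfl⟩ := (permHom_bijective i).2 x
  exact congrArg (δ ^ ·) (numCycles_permDiagram_left
    (by rw [← mul_assoc, (isIdempotentElem_idem i).eq]) σ)

theorem brauerCocycle_incl_right {i : Fin (n / 2 + 1)}
    (x : MaxSubgroup (isIdempotentElem_idem (n := n) i)) {u : BrauerDiagram n}
    (hu : ∃ s, u = s * idem i) :
    brauerCocycle n δ u (MaxSubgroup.incl _ x) = δ ^ (n / 2 - (i : ℕ)) := by
  obtain ⟨s, rfl⟩ := hu
  obtain ⟨σ, rfl⟩ := (permHom_bijective i).2 x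
  exact congrArg (δ ^ ·) (numCycles_permDiagram_right
    (by rw [mul_assoc, (isIdempotentElem_idem i).eq]) σ)

theorem idem_mem_homSet {i j : Fin (n / 2 + 1)} (h : j ≤ i) :
    idem (n := n) j ∈ HomSet (idem i) (idem j) :=
  ⟨rfl, 1, by rw [mul_one, idem_mul_idem h]⟩

theorem isPretransitive_homSet {i j : Fin (n / 2 + 1)} (h : j ≤ i) :
    MulAction.IsPretransitive
      (Equiv.Perm (Fin (level n i)) × Equiv.Perm (Fin (level n j)))
      (HomSet (idem (n := n) i) (idem j)) := by
  rw [MulAction.isPretransitive_iff_base ⟨idem j, idem_mem_homSet h⟩]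
  rintro ⟨t, hJ, s, rfl⟩
  obtain ⟨σ, τ, hστ⟩ := exists_eq_permDiagram_mul h
    (by rw [← mul_assoc, ← mul_assoc, (isIdempotentElem_idem i).eq])
    (by rw [mul_assoc, (isIdempotentElem_idem j).eq]) (mem_jClass_idem_iff.1 hJ)
  -- The action inverts its second component, hence `τ⁻¹`.
  refine ⟨(σ, τ⁻¹), Subtype.ext ?_⟩
  change permDiagram i σ * idem j * MaxSubgroup.incl _ (permHom j τ⁻¹)⁻¹ = _
  rw [← map_inv, inv_inv]
  exact hστ.symm

/-! ### Comparison of the orders on the labels -/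

section Labels

variable {k : Type u} [Field k] {δ : kˣ} {l : Fin (n / 2 + 1) → ℕ} {T : ∀ i, Fin (l i) → Type u}
  [∀ i r, AddCommGroup (T i r)] [∀ i r, Module k (T i r)]
  [∀ i r, Module (SymmAlg δ i) (T i r)] [∀ i r, IsScalarTower k (SymmAlg δ i) (T i r)]

theorem restrictsTo_of_sqLT (hn : (n.factorial : k) ≠ 0)
    (hT : ∀ i, IsSimpleRepresentatives (SymmAlg δ i) (T i)) {x y : Σ i, Fin (l i)}
    (h : SqLT isIdempotentElem_idem (brauerCocycle n δ) T x y) :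
    ∃ hlt : y.1 < x.1,
      RestrictsTo hlt.le (symmRep δ x.1 (T x.1 x.2)) (symmRep δ y.1 (T y.1 y.2)) := by
  obtain ⟨hJ, f, g, hf, hg, hfg⟩ := h
  have hlt := jlt_idem_iff.1 hJ
  have := (hT x.1).simple x.2
  have := (hT y.1).simple y.2
  exact ⟨hlt, restrictsTo_of_notMem_spanLT δ hlt.le hn hf hg
    ((exists_notMem_spanLT_iff δ hn hlt.le hf.central hg.central).1 hfg)⟩

theorem sqLT_of_restrictsTo (hn : (n.factorial : k) ≠ 0)
    (hT : ∀ i, IsSimpleRepresentatives (SymmAlg δ i) (T i)) {x y : Σ i, Fin (l i)}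
    (hxy : (y.1 : ℕ) + 1 = x.1) (hle : y.1 ≤ x.1)
    (h : RestrictsTo hle (symmRep δ x.1 (T x.1 x.2)) (symmRep δ y.1 (T y.1 y.2))) :
    SqLT isIdempotentElem_idem (brauerCocycle n δ) T x y := by
  have := (hT x.1).simple x.2
  have := (hT y.1).simple y.2
  have := isSemisimpleRing_symmAlg δ hn x.1
  have := isSemisimpleRing_symmAlg δ hn y.1
  obtain ⟨f, hf⟩ := exists_isBlockIdempotent (R := SymmAlg δ x.1) (T x.1 x.2)
  obtain ⟨g, hg⟩ := exists_isBlockIdempotent (R := SymmAlg δ y.1) (T y.1 y.2)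
  have hlt : y.1 < x.1 := by rw [Fin.lt_def]; omega
  exact ⟨jlt_idem_iff.2 hlt, f, g, hf, hg,
    (exists_notMem_spanLT_iff δ hn hle hf.central hg.central).2
      (notMem_spanLT_of_restrictsTo δ hxy hle hf hg h)⟩

/-- Interpolation at the level just below `x` splits off a step between adjacent levels, where
`RestrictsTo` yields `⊏`; induction on the distance of the levels finishes. -/
theorem unlhdLE_of_restrictsTo (hn : (n.factorial : k) ≠ 0)
    (hT : ∀ i, IsSimpleRepresentatives (SymmAlg δ i) (T i)) {x y : Σ i, Fin (l i)}
    (hlt : y.1 < x.1)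
    (h : RestrictsTo hlt.le (symmRep δ x.1 (T x.1 x.2)) (symmRep δ y.1 (T y.1 y.2))) :
    UnlhdLE isIdempotentElem_idem (brauerCocycle n δ) T x y := by
  induction hd : (x.1 : ℕ) - y.1 using Nat.strong_induction_on generalizing x with
  | _ d ih =>
    subst hd
    have hlt' := Fin.lt_def.1 hlt
    by_cases hxy : (y.1 : ℕ) + 1 = x.1
    · exact Relation.TransGen.single (Or.inr (sqLT_of_restrictsTo hn hT hxy hlt.le h))
    · let j : Fin (n / 2 + 1) := ⟨x.1 - 1, by omega⟩
      have hj : (j : ℕ) = x.1 - 1 := rfl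
      have hjx : j ≤ x.1 := by rw [Fin.le_def]; omega
      have hyj : y.1 < j := by rw [Fin.lt_def]; omega
      obtain ⟨r, h1, h2⟩ := RestrictsTo.exists_intermediate δ hn hjx hyj.le h (hT j).complete
      exact Relation.TransGen.head
        (Or.inr (sqLT_of_restrictsTo hn hT (y := ⟨j, r⟩) (by change (j : ℕ) + 1 = _; omega)
          hjx h1))
        (ih _ (by change (j : ℕ) - y.1 < _; omega) (x := ⟨j, r⟩) hyj h2 rfl)

/-- Each step `⊏`, of whatever length, yields a restriction, and restrictions compose because the
modules in between are simple. -/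
theorem restrictsTo_of_unlhdLE (hn : (n.factorial : k) ≠ 0)
    (hT : ∀ i, IsSimpleRepresentatives (SymmAlg δ i) (T i)) {x y : Σ i, Fin (l i)}
    (h : UnlhdLE isIdempotentElem_idem (brauerCocycle n δ) T x y) :
    x = y ∨ ∃ hlt : y.1 < x.1,
      RestrictsTo hlt.le (symmRep δ x.1 (T x.1 x.2)) (symmRep δ y.1 (T y.1 y.2)) := by
  induction h with
  | single h => exact h.imp_right (restrictsTo_of_sqLT hn hT)
  | @tail y z _ h ih =>
    have := (hT y.1).simple y.2
    rcases h with rfl | h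
    · exact ih
    · obtain ⟨hzy, h'⟩ := restrictsTo_of_sqLT hn hT h
      rcases ih with rfl | ⟨hyx, h''⟩
      · exact Or.inr ⟨hzy, h'⟩
      · exact Or.inr ⟨hzy.trans hyx, h''.trans δ hyx.le hzy.le h'⟩

theorem unlhdLT_iff (hn : (n.factorial : k) ≠ 0)
    (hT : ∀ i, IsSimpleRepresentatives (SymmAlg δ i) (T i)) (x y : Σ i, Fin (l i)) :
    UnlhdLT isIdempotentElem_idem (brauerCocycle n δ) T x y ↔
      ∃ h : y.1 < x.1, IsDirectSummand (symmRep δ x.1 (T x.1 x.2))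
        (youngInd h (symmRep δ y.1 (T y.1 y.2))) := by
  have := (hT x.1).simple x.2
  have := IsSimpleModule.nontrivial (SymmAlg δ x.1) (T x.1 x.2)
  have key (h : y.1 < x.1) := isDirectSummand_youngInd_iff hn h (symmRep δ x.1 (T x.1 x.2))
    (symmRep δ y.1 (T y.1 y.2)) (eq_bot_or_eq_top_of_stable δ)
  constructor
  · rintro ⟨h, hne⟩
    obtain ⟨hlt, h'⟩ := (restrictsTo_of_unlhdLE hn hT h).resolve_left hne
    exact ⟨hlt, (key hlt).2 h'⟩
  · rintro ⟨hlt, h⟩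
    exact ⟨unlhdLE_of_restrictsTo hn hT hlt ((key hlt).1 h), fun hxy => hlt.ne (by rw [hxy])⟩

end Labels

end BrauerDiagram

end TwistedBrauer

open TwistedBrauer TwistedBrauer.BrauerDiagram in
theorem mainTheorem5 (n : ℕ) (k : Type u) [Field k] (hn : (n.factorial : k) ≠ 0) (δ : kˣ)
    (l : Fin (n / 2 + 1) → ℕ) (T : ∀ i, Fin (l i) → Type u)
    [∀ i r, AddCommGroup (T i r)] [∀ i r, Module k (T i r)]
    [∀ i r, Module (GroupAlg (brauerCocycle n δ) (isIdempotentElem_idem i)) (T i r)]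
    [∀ i r, IsScalarTower k (GroupAlg (brauerCocycle n δ) (isIdempotentElem_idem i)) (T i r)]
    (hT : ∀ i, IsSimpleRepresentatives
      (GroupAlg (brauerCocycle n δ) (isIdempotentElem_idem i)) (T i)) :
    -- the order `<`
    (∀ x y : Σ i, Fin (l i), LabelLT (idem (n := n)) x y ↔ y.1 < x.1) ∧
    -- the values of the cocycle
    (∀ (i : Fin (n / 2 + 1)) (x : MaxSubgroup (isIdempotentElem_idem (n := n) i)),
      (∀ t, (∃ s, t = idem i * s) →
        brauerCocycle n δ (MaxSubgroup.incl _ x) t = δ ^ (n / 2 - (i : ℕ))) ∧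
      (∀ u, (∃ s, u = s * idem i) →
        brauerCocycle n δ u (MaxSubgroup.incl _ x) = δ ^ (n / 2 - (i : ℕ)))) ∧
    -- transitivity of the action on `S_j ∩ e_i ∘ S ∘ e_j`, which contains `e_j`
    (∀ i j : Fin (n / 2 + 1), j < i →
      MulAction.IsPretransitive
        (Equiv.Perm (Fin (level n i)) × Equiv.Perm (Fin (level n j)))
        (HomSet (idem (n := n) i) (idem j)) ∧
      idem j ∈ HomSet (idem (n := n) i) (idem j)) ∧
    -- the order `⊲`
    (∀ x y : Σ i, Fin (l i),
      UnlhdLT isIdempotentElem_idem (brauerCocycle n δ) T x y ↔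
        ∃ h : y.1 < x.1, IsDirectSummand (symmRep δ x.1 (T x.1 x.2))
          (youngInd h (symmRep δ y.1 (T y.1 y.2)))) := by
  exact ⟨fun x y => jlt_idem_iff,
    fun i x => ⟨fun t ht => brauerCocycle_incl_left δ x ht,
      fun u hu => brauerCocycle_incl_right δ x hu⟩,
    fun i j h => ⟨isPretransitive_homSet h.le, idem_mem_homSet h.le⟩,
    unlhdLT_iff hn hT⟩
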